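/- **Setting.** Let $g$ be a smooth Lorentzian metric of signature $(-,+,+,+)$ on an open set $U\subseteq\mathbb R^4$ (a coordinate domain of a spacetime; all notions below are local), $\nabla$ its Levi-Civita connection, $W$ its Weyl tensor, $*$ the Hodge dual and $\mathcal W=\frac12(W-\mathrm i*W)$ the self-dual Weyl tensor, acting on 2-forms by $\mathcal W(B)_{ab}=\frac12\mathcal W_{abcd}B^{cd}$. The metric is *vacuum* if $\mathrm{Ric}=0$, and of *Petrov type I* if at every point $\mathcal W$ has three distinct eigenvalues on the space of self-dual 2-forms ($*B=\mathrm iB$). A *Weyl principal frame* is a smooth orthonormal frame $\{e_0,e_1,e_2,e_3\}$ ($e_0$ timelike) such that the bivectors $\mathcal U_i=\frac1{\sqrt2}(U_i-\mathrm i*U_i)$, $U_i=e_0\wedge e_i$ ($i=1,2,3$), satisfy $\mathcal W(\mathcal U_i)=\alpha_i\,\mathcal U_i$; the smooth complex functions $\alpha_i$ are the *Weyl eigenvalues*, $\mathcal U_i$ the *Weyl principal bivectors*, and the directions of the dual coframe $\theta^0,\dots,\theta^3$ the *Weyl principal directions*. Put $\mathcal U_i(\omega)_a=(\mathcal U_i)_{ab}\,\omega^b$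 for a 1-form $\omega$, and $\lambda_i=-\mathcal U_i(\nabla\cdot\mathcal U_i)$. A Petrov type I vacuum metric is of *class* $I_{13}$ if around every point it has a Weyl principal frame, labelled so that $\mathrm d\alpha_1\neq0$ everywhere, for which $\lambda_1,\lambda_2,\lambda_3$ span a one-dimensional complex space at every point and all three complex 1-forms $u=\mathcal U_i(\mathrm d\alpha_1)$ are integrable ($u\wedge\mathrm du=0$). The gradient of the Weyl eigenvalue *is a Weyl principal direction* if, for such a frame, $\mathrm d\alpha_1\wedge\theta^a=0$ for some $a\in\{0,1,2,3\}$. The *Papapetrou field* of a Killing field $\xi$ is the 2-form $\nabla_a\xi_b$; it is *aligned* with $\mathcal U_i$ if $\nabla\xi=\Omega\,\mathcal U_i+\overline{\Omega\,\mathcal U_i}$ with a nowhere vanishing complex function $\Omega$. For $k\in\mathbb R\setminus\{0,-1,1,-2,-\frac12\}$ and $\beta=1+k+k^2$ consider on $\mathbb R^4$ the Kasner metric $$-e^{-2\tau}\mathrm d\tau^2+e^{2(\frac1\beta-1)\tau}(\mathrm dx^1)^2+e^{2(\frac{k^2}\beta-1)\tau}(\mathrm dx^2)^2+e^{2(\frac{(1+k)^2}\beta-1)\tau}(\mathrm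 dx^3)^2\qquad(21)$$ and the static Kasner metric $$e^{-2\tau}\mathrm d\tau^2-e^{2(\frac1\beta-1)\tau}(\mathrm dx^1)^2+e^{2(\frac{k^2}\beta-1)\tau}(\mathrm dy^2)^2+e^{2(\frac{(1+k)^2}\beta-1)\tau}(\mathrm dy^3)^2.\qquad(22)$$ **Proposition.** 1. For every such $k$, the metrics (21) and (22) are vacuum solutions of Petrov type I and class $I_{13}$ in which the gradient of the Weyl eigenvalue is a Weyl principal direction (with a Weyl principal frame defined on all of $\mathbb R^4$). 2. They are the only ones: if $g$ is a vacuum metric on $U$ of Petrov type I and class $I_{13}$ in which the gradient of the Weyl eigenvalue is a Weyl principal direction, then every point of $U$ has a neighbourhood with smooth coordinates in which $g$ takes the form (21) or (22) for some such $k$. 3. Let $g$ be as in 2, with a Weyl principal frame and Weyl eigenvalues on all of $U$ as in the definitions above (in particular, let $g$ be one of the metrics (21), (22) with the frame of 1). Then $g$ admits on $U$ three nowhere vanishing real Killing fields $\xi_1,\xi_2,\xi_3$ such that, for each $i$, $\xi_i$ is collinear with $\mathcal U_i(\mathrm d\alpha_1)$ and its Papapetrou field $\nabla\xi_i$ is aligned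 with the Weyl principal bivector $\mathcal U_i$. -/

import Mathlib

open scoped ContDiff

noncomputable section

namespace Spacetime

/-- Points of a coordinate domain of a four-dimensional spacetime. -/
abbrev Pt := Fin 4 → ℝ

/-- Components `g_{μν}(x)` of a metric tensor in a coordinate domain. -/
abbrev MetricField := Pt → Matrix (Fin 4) (Fin 4) ℝ

/-- Complex two-index covariant tensors at a point; the 2-forms are the antisymmetric ones. -/
abbrev Biform := Matrix (Fin 4) (Fin 4) ℂ

/-- The partial derivative `∂_μ f`. -/
def pd {F : Type*} [NormedAddCommGroup F] [NormedSpace ℝ F] (μ : Fin 4) (f : Pt → F) (x : Pt) : F :=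
  fderiv ℝ f x (Pi.single μ 1)

/-- `g` is a smooth Lorentzian metric, of signature `(-,+,+,+)`, on `U`. -/
structure IsLorentzMetric (g : MetricField) (U : Set Pt) : Prop where
  smooth : ∀ a b, ContDiffOn ℝ ∞ (fun x => g x a b) U
  symm : ∀ x ∈ U, (g x).IsSymm
  signature : ∀ x ∈ U, ∃ P : Matrix (Fin 4) (Fin 4) ℝ,
    P.transpose * g x * P = Matrix.diagonal ![-1, 1, 1, 1]

/-! ### Levi-Civita connection and curvature -/

/-- `Γ^c_{ab}`. -/
def christoffel (g : MetricField) (x : Pt) (c a b : Fin 4) : ℝ :=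
  (1 / 2) * ∑ d, (g x)⁻¹ c d *
    (pd a (fun y => g y b d) x + pd b (fun y => g y a d) x - pd d (fun y => g y a b) x)

/-- `R^a_{bcd} = ∂_c Γ^a_{db} - ∂_d Γ^a_{cb} + Γ^a_{cm} Γ^m_{db} - Γ^a_{dm} Γ^m_{cb}`. -/
def riemannUp (g : MetricField) (x : Pt) (a b c d : Fin 4) : ℝ :=
  pd c (fun y => christoffel g y a d b) x - pd d (fun y => christoffel g y a c b) x
    + ∑ m, (christoffel g x a c m * christoffel g x m d b
      - christoffel g x a d m * christoffel g x m c b)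

/-- `R_{abcd}`. -/
def riemann (g : MetricField) (x : Pt) (a b c d : Fin 4) : ℝ :=
  ∑ m, g x a m * riemannUp g x m b c d

/-- `R_{ab} = R^m_{amb}`. -/
def ricci (g : MetricField) (x : Pt) (a b : Fin 4) : ℝ :=
  ∑ m, riemannUp g x m a m b

def scalarCurvature (g : MetricField) (x : Pt) : ℝ :=
  ∑ a, ∑ b, (g x)⁻¹ a b * ricci g x a b

/-- The vacuum Einstein equations `Ric = 0`. -/
def IsVacuum (g : MetricField) (U : Set Pt) : Prop :=
  ∀ x ∈ U, ∀ a b, ricci g x a b = 0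

/-- The Weyl tensor `W_{abcd}`, in dimension four. -/
def weyl (g : MetricField) (x : Pt) (a b c d : Fin 4) : ℝ :=
  riemann g x a b c d
    - (1 / 2) * (g x a c * ricci g x b d - g x a d * ricci g x b c
      - g x b c * ricci g x a d + g x b d * ricci g x a c)
    + (scalarCurvature g x / 6) * (g x a c * g x b d - g x a d * g x b c)

/-! ### Self-dual 2-forms and the self-dual Weyl tensor -/

/-- The Levi-Civita symbol. -/
def levi (a b c d : Fin 4) : ℝ :=
  Matrix.det (Matrix.of fun i j : Fin 4 => if (![a, b, c, d] : Fin 4 → Fin 4) i = j then (1 : ℝ) else 0)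

/-- The metric volume element `η_{abcd}`. -/
def volumeElement (g : MetricField) (x : Pt) (a b c d : Fin 4) : ℝ :=
  Real.sqrt |(g x).det| * levi a b c d

/-- `B^{ab} = g^{ac} g^{bd} B_{cd}`. -/
def raiseBoth (g : MetricField) (x : Pt) (B : Biform) (a b : Fin 4) : ℂ :=
  ∑ c, ∑ d, (((g x)⁻¹ a c : ℝ) : ℂ) * (((g x)⁻¹ b d : ℝ) : ℂ) * B c d

/-- The Hodge dual `(*B)_{ab} = (1/2) η_{abcd} B^{cd}`. -/
def hodge (g : MetricField) (x : Pt) (B : Biform) : Biform :=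
  Matrix.of fun a b => (1 / 2) * ∑ c, ∑ d, (volumeElement g x a b c d : ℂ) * raiseBoth g x B c d

/-- Self-dual 2-forms (bivectors): `*B = i B`. -/
def IsSelfDual (g : MetricField) (x : Pt) (B : Biform) : Prop :=
  (∀ a b, B a b = - B b a) ∧ hodge g x B = Complex.I • B

/-- The self-dual Weyl tensor `𝒲 = (1/2)(W - i *W)`. -/
def selfDualWeyl (g : MetricField) (x : Pt) (a b c d : Fin 4) : ℂ :=
  (1 / 2) * ((weyl g x a b c d : ℂ)
    - Complex.I * hodge g x (Matrix.of fun p q => (weyl g x p q c d : ℂ)) a b)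

/-- `𝒲` as an endomorphism of 2-forms: `𝒲(B)_{ab} = (1/2) 𝒲_{abcd} B^{cd}`. -/
def weylMap (g : MetricField) (x : Pt) (B : Biform) : Biform :=
  Matrix.of fun a b => (1 / 2) * ∑ c, ∑ d, selfDualWeyl g x a b c d * raiseBoth g x B c d

/-- Petrov type I (algebraically general): the self-dual Weyl tensor has three distinct eigenvalues
on the (three-dimensional) space of self-dual 2-forms. -/
def IsPetrovTypeI (g : MetricField) (U : Set Pt) : Prop :=
  ∀ x ∈ U, ∃ (lam : Fin 3 → ℂ) (B : Fin 3 → Biform), Function.Injective lam ∧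
    ∀ i, IsSelfDual g x (B i) ∧ B i ≠ 0 ∧ weylMap g x (B i) = lam i • B i

/-! ### The Weyl principal frame -/

/-- A tangent frame: `e a x` is the vector `e_a` at `x`, in components. -/
abbrev FrameField := Fin 4 → Pt → (Fin 4 → ℝ)

/-- `v_a = g_{ab} v^b`. -/
def lowerVec (g : MetricField) (x : Pt) (v : Fin 4 → ℝ) (a : Fin 4) : ℝ :=
  ∑ b, g x a b * v b

/-- The unitary bivectors `𝒰_i = (1/√2)(U_i - i *U_i)`, `U_i = e_0 ∧ e_i`, `i = 1, 2, 3`, normalized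
by `2 𝒰_i × 𝒰_i = g`; the index `i : Fin 3` stands for the frame index `i.succ`. -/
def frameBivector (g : MetricField) (e : FrameField) (i : Fin 3) (x : Pt) : Biform :=
  let U : Biform := Matrix.of fun a b =>
    ((lowerVec g x (e 0 x) a * lowerVec g x (e i.succ x) b
      - lowerVec g x (e i.succ x) a * lowerVec g x (e 0 x) b : ℝ) : ℂ)
  ((Real.sqrt 2 : ℝ) : ℂ)⁻¹ • (U - Complex.I • hodge g x U)

/-- `e` is a smooth orthonormal frame on `U` whose bivectors `𝒰_i` are eigenbivectors of the
self-dual Weyl tensor, with eigenvalues `α i`. -/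
structure IsWeylPrincipalFrame (g : MetricField) (U : Set Pt) (e : FrameField)
    (α : Fin 3 → Pt → ℂ) : Prop where
  smooth_frame : ∀ a b, ContDiffOn ℝ ∞ (fun x => e a x b) U
  smooth_eigenvalue : ∀ i, ContDiffOn ℝ ∞ (α i) U
  orthonormal : ∀ x ∈ U, ∀ a b, ∑ c, e a x c * lowerVec g x (e b x) c
    = Matrix.diagonal (![-1, 1, 1, 1] : Fin 4 → ℝ) a b
  eigen : ∀ x ∈ U, ∀ i, weylMap g x (frameBivector g e i x) = α i x • frameBivector g e i x

/-- The action of a 2-form on a 1-form: `B(w)_a = B_{ab} g^{bc} w_c`. -/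
def applyForm (g : MetricField) (x : Pt) (B : Biform) (w : Fin 4 → ℂ) (a : Fin 4) : ℂ :=
  ∑ b, ∑ c, B a b * (((g x)⁻¹ b c : ℝ) : ℂ) * w c

/-- The covariant derivative `∇_c B_{ab}` of a 2-form. -/
def covDerivBiform (g : MetricField) (B : Pt → Biform) (x : Pt) (c a b : Fin 4) : ℂ :=
  pd c (fun y => B y a b) x
    - ∑ m, ((christoffel g x m c a : ℂ) * B x m b + (christoffel g x m c b : ℂ) * B x a m)

/-- The divergence `(∇·B)_b = g^{ca} ∇_c B_{ab}`. -/
def divBiform (g : MetricField) (B : Pt → Biform) (x : Pt) (b : Fin 4) : ℂ :=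
  ∑ c, ∑ a, (((g x)⁻¹ c a : ℝ) : ℂ) * covDerivBiform g B x c a b

/-- The 1-forms `λ_i = - 𝒰_i(∇·𝒰_i)`. -/
def lambdaForm (g : MetricField) (e : FrameField) (i : Fin 3) (x : Pt) : Fin 4 → ℂ :=
  fun a => - applyForm g x (frameBivector g e i x) (divBiform g (frameBivector g e i) x) a

/-- The differential of a complex function. -/
def gradForm (f : Pt → ℂ) (x : Pt) : Fin 4 → ℂ := fun a => pd a f x

/-- The 1-forms `𝒰_i(dα_1)`; the eigenvalue `α_1` is `α 0`. -/
def orbitForm (g : MetricField) (e : FrameField) (α : Fin 3 → Pt → ℂ) (i : Fin 3) (x : Pt) :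
    Fin 4 → ℂ :=
  applyForm g x (frameBivector g e i x) (gradForm (α 0) x)

/-- Integrability `w ∧ dw = 0` of a (complex) 1-form. -/
def IsIntegrableForm (U : Set Pt) (w : Pt → Fin 4 → ℂ) : Prop :=
  ∀ x ∈ U, ∀ a b c,
    w x a * (pd b (fun y => w y c) x - pd c (fun y => w y b) x)
    + w x b * (pd c (fun y => w y a) x - pd a (fun y => w y c) x)
    + w x c * (pd a (fun y => w y b) x - pd b (fun y => w y a) x) = 0

/-- Collinearity `u ∧ v = 0` of two 1-forms at a point. -/
def CollinearForms (u v : Fin 4 → ℂ) : Prop := ∀ a b, u a * v b = u b * v a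

/-- Class I₁: the 1-forms `λ_i` generate a space of dimension one. -/
def IsClassI1 (g : MetricField) (U : Set Pt) (e : FrameField) : Prop :=
  ∀ x ∈ U, Module.finrank ℂ (Submodule.span ℂ (Set.range fun i : Fin 3 => lambdaForm g e i x)) = 1

/-- Class I₁₃: class I₁ with `dα_1 ≠ 0` and all three 1-forms `𝒰_i(dα_1)` integrable. -/
structure IsClassI13 (g : MetricField) (U : Set Pt) (e : FrameField) (α : Fin 3 → Pt → ℂ) :
    Prop where
  classI1 : IsClassI1 g U e
  grad_ne_zero : ∀ x ∈ U, gradForm (α 0) x ≠ 0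
  integrable : ∀ i, IsIntegrableForm U (orbitForm g e α i)

/-- The gradient of `α_1` is a Weyl principal direction: `dα_1 ∧ θ^a = 0` for one of the principal
1-forms `θ^a` (which is `± e_a` with the index lowered). -/
def GradientIsPrincipal (g : MetricField) (U : Set Pt) (e : FrameField) (α : Fin 3 → Pt → ℂ) :
    Prop :=
  ∃ a : Fin 4, ∀ x ∈ U,
    CollinearForms (gradForm (α 0) x) (fun b => (lowerVec g x (e a x) b : ℂ))

/-- `g` is a vacuum solution of Petrov type I₁₃ on `U`, with Weyl principal frame `e` and Weyl
eigenvalues `α`, in which the gradient of `α_1` is a Weyl principal direction. -/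
structure IsPrincipalI13Vacuum (g : MetricField) (U : Set Pt) (e : FrameField)
    (α : Fin 3 → Pt → ℂ) : Prop where
  lorentz : IsLorentzMetric g U
  vacuum : IsVacuum g U
  typeI : IsPetrovTypeI g U
  frame : IsWeylPrincipalFrame g U e α
  classI13 : IsClassI13 g U e α
  gradient : GradientIsPrincipal g U e α

/-! ### Killing fields and Papapetrou fields -/

/-- The covariant derivative `∇_a ξ_b`; for a Killing field it is its Papapetrou field. -/
def papapetrou (g : MetricField) (ξ : Pt → Fin 4 → ℝ) (x : Pt) (a b : Fin 4) : ℝ :=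
  pd a (fun y => lowerVec g y (ξ y) b) x - ∑ c, christoffel g x c a b * lowerVec g x (ξ x) c

/-- A smooth vector field with `∇_a ξ_b + ∇_b ξ_a = 0`. -/
structure IsKilling (g : MetricField) (U : Set Pt) (ξ : Pt → Fin 4 → ℝ) : Prop where
  smooth : ∀ a, ContDiffOn ℝ ∞ (fun x => ξ x a) U
  killing : ∀ x ∈ U, ∀ a b, papapetrou g ξ x a b + papapetrou g ξ x b a = 0

/-- At `x`, the 2-form `F` is aligned with the bivector `B`: `F = Ω B + conj (Ω B)`, where `Ω ≠ 0`,
so that `F` has the principal planes of `B`. -/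
def IsAlignedWith (F : Fin 4 → Fin 4 → ℝ) (B : Biform) : Prop :=
  ∃ Ω : ℂ, Ω ≠ 0 ∧ ∀ a b, (F a b : ℂ) = Ω * B a b + (starRingEnd ℂ) (Ω * B a b)

/-! ### The Kasner metrics -/

/-- The admissible values of the parameter. -/
def Admissible (k : ℝ) : Prop := k ≠ 0 ∧ k ≠ -1 ∧ k ≠ 1 ∧ k ≠ -2 ∧ k ≠ -(1 / 2)

def kasnerBeta (k : ℝ) : ℝ := 1 + k + k ^ 2

/-- The Kasner metric, in coordinates `(τ, x¹, x², x³)`. -/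
def kasner (k : ℝ) : MetricField := fun x => Matrix.diagonal
  ![-Real.exp (-2 * x 0),
    Real.exp (2 * (1 / kasnerBeta k - 1) * x 0),
    Real.exp (2 * (k ^ 2 / kasnerBeta k - 1) * x 0),
    Real.exp (2 * ((1 + k) ^ 2 / kasnerBeta k - 1) * x 0)]

/-- The static Kasner metric, in coordinates `(τ, x¹, y², y³)`. -/
def staticKasner (k : ℝ) : MetricField := fun x => Matrix.diagonal
  ![Real.exp (-2 * x 0),
    -Real.exp (2 * (1 / kasnerBeta k - 1) * x 0),
    Real.exp (2 * (k ^ 2 / kasnerBeta k - 1) * x 0),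
    Real.exp (2 * ((1 + k) ^ 2 / kasnerBeta k - 1) * x 0)]

/-- On a neighbourhood of `p` contained in `U` there are smooth coordinates in which `g` takes the
form `h`. -/
def HasFormNear (g : MetricField) (U : Set Pt) (p : Pt) (h : MetricField) : Prop :=
  ∃ φ : OpenPartialHomeomorph Pt Pt, p ∈ φ.source ∧ φ.source ⊆ U ∧
    ContDiffOn ℝ ∞ φ φ.source ∧ ContDiffOn ℝ ∞ φ.symm φ.target ∧
    ∀ x ∈ φ.source, ∀ a b, g x a b =
      ∑ c, ∑ d, pd a (fun y => φ y c) x * pd b (fun y => φ y d) x * h (φ x) c d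

end Spacetime

end

/-! The proof is Cartan's moving-frame calculus in complex form. For an orthonormal frame with
connection forms ω_ab = g(∇e_a, e_b), put σ_i = ω_jk + J ω_0i, where (0,i,j,k) is an even
permutation and J = ±i is fixed by the orientation of the frame. The Lorentz connection becomes an
so(3,ℂ) connection: ∇𝒰_i = σ_{i+2} 𝒰_{i+1} − σ_{i+1} 𝒰_{i+2} (`covDeriv_frameBivector`), and in a
principal frame of a vacuum metric dσ_i + σ_{i+1} ∧ σ_{i+2} = −√2 J α_i 𝒰_i (`structure_eq`).

Let V_i be the image of σ_i under 𝒰_i, up to a constant (`dualForm`). Then λ_i = (V_{i+1} +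
V_{i+2})/2 (`formF_lambdaForm`), and d²σ_0 = 0 gives the Bianchi identity dα_0 = (α_1 − α_0) V_2 +
(α_2 − α_0) V_1 (`bianchi_frame`; indices start at 0). In class I₁ every V_i is therefore a multiple
of dα_0. If dα_0 points along e_n, then σ_i has a component only along the index that 𝒰_i pairs with
n (`connF_support`). The forms 𝒰_i(dα_0) are multiples of the other three coframe directions, and
their integrability removes the last unwanted coefficients. What remains is g(∇e_a, e_b) = 0 and
g(∇e_n, e_a) = r_a e_a for a, b ≠ n (`IsPrincipalI13Vacuum.warped`).

Relabel so that n becomes 0. The Weyl eigenvalues are now −ε_0 r_i r_j, so Petrov type I makes the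
rates r_i nonzero and distinct. With S = r_1 + r_2 + r_3, the equations Ric = 0 read e_0(r_i) = −r_i
S and r_1 r_2 + r_1 r_3 + r_2 r_3 = 0. The vanishing off-diagonal curvature, together with the
derivative of the quadratic relation, shows that the r_i vary only along e_0. Consequently r_i/S is
locally constant and d log|S| = −ε_0 S e_0. Everything integrates: with L_i = −(r_i/S) log|S|, the
forms exp(−L_i) e_i are closed and, with τ = log|S|, provide the Kasner coordinates
(`IsKasnerFrame.exists_hasFormNear`). The fields exp(L_i) e_i are Killing, and their covariant
derivatives are multiples of e_0 ∧ e_i, a principal plane of one of the bivectors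
(`IsPrincipalI13Vacuum.exists_killing`). A timelike gradient gives the Kasner metric, a spacelike
one the static Kasner metric.

Conversely, a metric ∑ ε_a exp(2 q_a x⁰)(dx^a)² with q_0 = −1 has a frame of this warped kind with
r_i = q_i exp(x⁰), and every condition becomes an algebraic condition on the exponents
(`isPrincipalI13Vacuum_diagMetric`). -/

open scoped ContDiff

noncomputable section

namespace Spacetime

/-! ### Partial derivatives -/

section PartialDerivatives

variable {F : Type*} [NormedAddCommGroup F] [NormedSpace ℝ F]
variable {A : Type*} [NormedRing A] [NormedAlgebra ℝ A]

lemma differentiableAt_of_smooth {U : Set Pt} (hU : IsOpen U) {f : Pt → F}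
    (hf : ContDiffOn ℝ ∞ f U) {x : Pt} (hx : x ∈ U) : DifferentiableAt ℝ f x :=
  (hf.contDiffAt (hU.mem_nhds hx)).differentiableAt (by simp)

lemma pd_congr_of_eqOn {U : Set Pt} (hU : IsOpen U) {f h : Pt → F} (H : ∀ y ∈ U, f y = h y)
    {x : Pt} (hx : x ∈ U) (c : Fin 4) : pd c f x = pd c h x := by
  unfold pd
  rw [Filter.EventuallyEq.fderiv_eq (Filter.eventually_of_mem (hU.mem_nhds hx) H)]

lemma pd_const (c : Fin 4) (k : F) (x : Pt) : pd c (fun _ => k) x = 0 := by simp [pd]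

lemma pd_add {f h : Pt → F} {x : Pt} (hf : DifferentiableAt ℝ f x) (hh : DifferentiableAt ℝ h x)
    (c : Fin 4) : pd c (fun y => f y + h y) x = pd c f x + pd c h x := by
  simp [pd, fderiv_fun_add hf hh]

lemma pd_sub {f h : Pt → F} {x : Pt} (hf : DifferentiableAt ℝ f x) (hh : DifferentiableAt ℝ h x)
    (c : Fin 4) : pd c (fun y => f y - h y) x = pd c f x - pd c h x := by
  simp [pd, fderiv_fun_sub hf hh]

lemma pd_neg (f : Pt → F) (x : Pt) (c : Fin 4) : pd c (fun y => - f y) x = - pd c f x := by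
  simp [pd, fderiv_fun_neg]

lemma pd_mul {f h : Pt → A} {x : Pt} (hf : DifferentiableAt ℝ f x) (hh : DifferentiableAt ℝ h x)
    (c : Fin 4) : pd c (fun y => f y * h y) x = pd c f x * h x + f x * pd c h x := by
  simp [pd, fderiv_fun_mul' hf hh, add_comm]

lemma pd_const_mul (k : A) {h : Pt → A} {x : Pt} (hh : DifferentiableAt ℝ h x)
    (c : Fin 4) : pd c (fun y => k * h y) x = k * pd c h x := by
  rw [pd_mul (differentiableAt_const _) hh, pd_const]; simp

lemma pd_sum {ι : Type*} (s : Finset ι) {f : ι → Pt → F} {x : Pt}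
    (hf : ∀ i ∈ s, DifferentiableAt ℝ (f i) x) (c : Fin 4) :
    pd c (fun y => ∑ i ∈ s, f i y) x = ∑ i ∈ s, pd c (f i) x := by
  simp [pd, fderiv_fun_sum hf]

lemma pd_ofReal {f : Pt → ℝ} {x : Pt} (hf : DifferentiableAt ℝ f x) (c : Fin 4) :
    pd c (fun y => (f y : ℂ)) x = ((pd c f x : ℝ) : ℂ) := by
  have h := (Complex.ofRealCLM.hasFDerivAt (x := f x)).comp x hf.hasFDerivAt
  have h2 : fderiv ℝ (fun y => (f y : ℂ)) x = Complex.ofRealCLM ∘L fderiv ℝ f x := h.fderiv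
  simp [pd, h2]

lemma fderiv_apply_eq_sum_pd (f : Pt → F) (x v : Pt) :
    fderiv ℝ f x v = ∑ c, v c • pd c f x := by
  have hv : v = ∑ c, v c • (Pi.single c (1 : ℝ) : Pt) := by
    ext i
    simp [Finset.sum_apply, Pi.single_apply]
  conv_lhs => rw [hv]
  simp only [map_sum, map_smul, pd]

lemma contDiffOn_pd {U : Set Pt} (hU : IsOpen U) {f : Pt → F} (hf : ContDiffOn ℝ ∞ f U)
    (c : Fin 4) : ContDiffOn ℝ ∞ (fun y => pd c f y) U :=
  (hf.fderiv_of_isOpen hU (m := ∞) (by simp)).clm_apply contDiffOn_const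

lemma pd_comm {U : Set Pt} (hU : IsOpen U) {f : Pt → F} (hf : ContDiffOn ℝ ∞ f U)
    {x : Pt} (hx : x ∈ U) (c d : Fin 4) :
    pd c (fun y => pd d f y) x = pd d (fun y => pd c f y) x := by
  have hs : IsSymmSndFDerivAt ℝ f x :=
    (hf.contDiffAt (hU.mem_nhds hx)).isSymmSndFDerivAt
      (by rw [minSmoothness_of_isRCLikeNormedField]; exact WithTop.coe_le_coe.2 le_top)
  have hd : DifferentiableAt ℝ (fderiv ℝ f) x :=
    differentiableAt_of_smooth hU (hf.fderiv_of_isOpen hU (m := ∞) (by simp)) hx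
  have key : ∀ a b : Fin 4, pd a (fun y => pd b f y) x
      = fderiv ℝ (fderiv ℝ f) x (Pi.single a 1) (Pi.single b 1) := by
    intro a b
    simp only [pd]
    rw [fderiv_clm_apply hd (differentiableAt_const _)]
    simp
  rw [key, key]
  exact hs _ _

/-- This is d² = 0 on 1-forms; applied to the connection form σ_0 it produces the Bianchi identity.
-/
lemma pd_cyclic_exterior {U : Set Pt} (hU : IsOpen U) {u : Fin 4 → Pt → F}
    (hu : ∀ a, ContDiffOn ℝ ∞ (u a) U) {x : Pt} (hx : x ∈ U) (a b c : Fin 4) :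
    pd a (fun y => pd b (u c) y - pd c (u b) y) x + pd b (fun y => pd c (u a) y - pd a (u c) y) x
      + pd c (fun y => pd a (u b) y - pd b (u a) y) x = 0 := by
  have hd : ∀ p q, DifferentiableAt ℝ (fun y => pd p (u q) y) x := fun p q =>
    differentiableAt_of_smooth hU (contDiffOn_pd hU (hu q) p) hx
  rw [pd_sub (hd _ _) (hd _ _), pd_sub (hd _ _) (hd _ _), pd_sub (hd _ _) (hd _ _),
    pd_comm hU (hu c) hx a b, pd_comm hU (hu a) hx b c, pd_comm hU (hu b) hx a c]
  abel

end PartialDerivatives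

/-! ### Matrix-valued functions -/

/-- The partial derivative of a matrix-valued function, entry by entry. -/
def pdMat {m n : Type*} (c : Fin 4) (M : Pt → Matrix m n ℝ) (x : Pt) : Matrix m n ℝ :=
  Matrix.of fun a b => pd c (fun y => M y a b) x

/-- Smoothness of a matrix-valued function, entry by entry. -/
def SmoothMat {m n : Type*} (U : Set Pt) (M : Pt → Matrix m n ℝ) : Prop :=
  ∀ a b, ContDiffOn ℝ ∞ (fun x => M x a b) U

section MatrixCalculus

variable {U : Set Pt} {M N : Pt → Matrix (Fin 4) (Fin 4) ℝ} {x : Pt}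

lemma SmoothMat.mul (hM : SmoothMat U M) (hN : SmoothMat U N) :
    SmoothMat U (fun y => M y * N y) := by
  intro a b
  simp only [Matrix.mul_apply]
  exact ContDiffOn.sum fun i _ => (hM a i).mul (hN i b)

lemma SmoothMat.sub (hM : SmoothMat U M) (hN : SmoothMat U N) :
    SmoothMat U (fun y => M y - N y) := fun a b => (hM a b).sub (hN a b)

lemma SmoothMat.transpose (hM : SmoothMat U M) : SmoothMat U (fun y => (M y).transpose) :=
  fun a b => hM b a

lemma SmoothMat.const (K : Matrix (Fin 4) (Fin 4) ℝ) : SmoothMat U (fun _ => K) :=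
  fun _ _ => contDiffOn_const

lemma SmoothMat.pdMat (hU : IsOpen U) (hM : SmoothMat U M) (c : Fin 4) :
    SmoothMat U (fun y => pdMat c M y) := fun a b => contDiffOn_pd hU (hM a b) c

lemma pdMat_mul (hU : IsOpen U) (hM : SmoothMat U M) (hN : SmoothMat U N) (hx : x ∈ U)
    (c : Fin 4) :
    pdMat c (fun y => M y * N y) x = pdMat c M x * N x + M x * pdMat c N x := by
  ext a b
  have hM' := fun i j => differentiableAt_of_smooth hU (hM i j) hx
  have hN' := fun i j => differentiableAt_of_smooth hU (hN i j) hx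
  simp only [pdMat, Matrix.of_apply, Matrix.mul_apply, Matrix.add_apply]
  rw [pd_sum _ (fun i _ => (hM' a i).fun_mul (hN' i b)), ← Finset.sum_add_distrib]
  exact Finset.sum_congr rfl fun i _ => pd_mul (hM' a i) (hN' i b) c

lemma pdMat_add (hU : IsOpen U) (hM : SmoothMat U M) (hN : SmoothMat U N) (hx : x ∈ U)
    (c : Fin 4) : pdMat c (fun y => M y + N y) x = pdMat c M x + pdMat c N x := by
  ext a b
  exact pd_add (differentiableAt_of_smooth hU (hM a b) hx)
    (differentiableAt_of_smooth hU (hN a b) hx) c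

lemma pdMat_congr (hU : IsOpen U) (H : ∀ y ∈ U, M y = N y) (hx : x ∈ U) (c : Fin 4) :
    pdMat c M x = pdMat c N x := by
  ext a b
  exact pd_congr_of_eqOn hU (fun y hy => by rw [H y hy]) hx c

lemma pdMat_const (K : Matrix (Fin 4) (Fin 4) ℝ) (c : Fin 4) : pdMat c (fun _ => K) x = 0 := by
  ext a b
  exact pd_const c _ x

lemma pdMat_transpose (c : Fin 4) :
    pdMat c (fun y => (M y).transpose) x = (pdMat c M x).transpose := rfl

lemma pdMat_comm (hU : IsOpen U) (hM : SmoothMat U M) (hx : x ∈ U) (c d : Fin 4) :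
    pdMat c (fun y => pdMat d M y) x = pdMat d (fun y => pdMat c M y) x := by
  ext a b
  exact pd_comm hU (hM a b) hx c d

end MatrixCalculus

/-! ### Orthonormal frames -/

/-- `e` is a smooth frame on `U`, orthonormal for `g` with signs `ε`. -/
structure IsOrthoFrame (g : MetricField) (U : Set Pt) (e : FrameField) (ε : Fin 4 → ℝ) :
    Prop where
  smooth_metric : SmoothMat U g
  symm : ∀ x ∈ U, (g x).IsSymm
  smooth_frame : ∀ a b, ContDiffOn ℝ ∞ (fun x => e a x b) U
  sign : ∀ a, ε a * ε a = 1
  ortho : ∀ x ∈ U, ∀ a b, ∑ c, e a x c * lowerVec g x (e b x) c = Matrix.diagonal ε a b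

/-- The matrix whose rows are the frame vectors. -/
def frameMat (e : FrameField) (x : Pt) : Matrix (Fin 4) (Fin 4) ℝ := Matrix.of fun a b => e a x b

/-- The matrix whose rows are the frame vectors with lowered index. -/
def coframeMat (g : MetricField) (e : FrameField) (x : Pt) : Matrix (Fin 4) (Fin 4) ℝ :=
  Matrix.of fun a b => lowerVec g x (e a x) b

/-- The matrix `(Γ_c)^a_b`. -/
def chrMat (g : MetricField) (c : Fin 4) (x : Pt) : Matrix (Fin 4) (Fin 4) ℝ :=
  Matrix.of fun a b => christoffel g x a c b

/-- The matrix `(R_{cd})^a_b`. -/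
def riemannMat (g : MetricField) (c d : Fin 4) (x : Pt) : Matrix (Fin 4) (Fin 4) ℝ :=
  Matrix.of fun a b => riemannUp g x a b c d

/-- The connection 1-forms `g(∇_c e_a, e_b)`. -/
def connMat (g : MetricField) (e : FrameField) (c : Fin 4) (x : Pt) : Matrix (Fin 4) (Fin 4) ℝ :=
  (pdMat c (coframeMat g e) x - coframeMat g e x * chrMat g c x) * (frameMat e x).transpose

namespace IsOrthoFrame

variable {g : MetricField} {U : Set Pt} {e : FrameField} {ε : Fin 4 → ℝ} {x : Pt}

lemma sign_sq (h : IsOrthoFrame g U e ε) : Matrix.diagonal ε * Matrix.diagonal ε = 1 := by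
  rw [Matrix.diagonal_mul_diagonal, ← Matrix.diagonal_one]
  congr 1
  exact funext h.sign

lemma coframe_eq (h : IsOrthoFrame g U e ε) (hx : x ∈ U) :
    coframeMat g e x = frameMat e x * g x := by
  ext a b
  simp only [coframeMat, frameMat, Matrix.of_apply, Matrix.mul_apply, lowerVec]
  exact Finset.sum_congr rfl fun c _ => by rw [(h.symm x hx).apply c b]; ring

lemma frame_mul_coframe (h : IsOrthoFrame g U e ε) (hx : x ∈ U) :
    frameMat e x * (coframeMat g e x).transpose = Matrix.diagonal ε := by
  ext a b
  simpa [Matrix.mul_apply, frameMat, coframeMat] using h.ortho x hx a b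

lemma coframe_mul_frame (h : IsOrthoFrame g U e ε) (hx : x ∈ U) :
    coframeMat g e x * (frameMat e x).transpose = Matrix.diagonal ε := by
  have := congrArg Matrix.transpose (h.frame_mul_coframe hx)
  simpa [Matrix.transpose_mul] using this

/-- Orthonormality supplies a one-sided inverse of the frame matrix; for square matrices it is
two-sided, so the frame resolves the identity. -/
lemma resolution (h : IsOrthoFrame g U e ε) (hx : x ∈ U) :
    (frameMat e x).transpose * (Matrix.diagonal ε * coframeMat g e x) = 1 := by
  rw [mul_eq_one_comm, Matrix.mul_assoc, h.coframe_mul_frame hx, h.sign_sq]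

lemma resolution' (h : IsOrthoFrame g U e ε) (hx : x ∈ U) :
    (coframeMat g e x).transpose * (Matrix.diagonal ε * frameMat e x) = 1 := by
  rw [mul_eq_one_comm, Matrix.mul_assoc, h.frame_mul_coframe hx, h.sign_sq]

lemma inv_eq (h : IsOrthoFrame g U e ε) (hx : x ∈ U) :
    (g x)⁻¹ = (frameMat e x).transpose * Matrix.diagonal ε * frameMat e x := by
  apply Matrix.inv_eq_right_inv
  have h1 : g x * (frameMat e x).transpose = (coframeMat g e x).transpose := by
    rw [h.coframe_eq hx, Matrix.transpose_mul, (h.symm x hx).eq]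
  rw [← Matrix.mul_assoc, ← Matrix.mul_assoc, h1, Matrix.mul_assoc, h.resolution' hx]

lemma inv_apply (h : IsOrthoFrame g U e ε) (hx : x ∈ U) (c d : Fin 4) :
    (g x)⁻¹ c d = ∑ a, ε a * e a x c * e a x d := by
  rw [h.inv_eq hx]
  rw [Matrix.mul_apply]
  simp only [Matrix.mul_diagonal, Matrix.transpose_apply, frameMat, Matrix.of_apply]
  exact Finset.sum_congr rfl fun a _ => by ring

lemma mul_inv (h : IsOrthoFrame g U e ε) (hx : x ∈ U) : g x * (g x)⁻¹ = 1 := by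
  have h1 : g x * (frameMat e x).transpose = (coframeMat g e x).transpose := by
    rw [h.coframe_eq hx, Matrix.transpose_mul, (h.symm x hx).eq]
  rw [h.inv_eq hx, ← Matrix.mul_assoc, ← Matrix.mul_assoc, h1, Matrix.mul_assoc, h.resolution' hx]

lemma metric_apply (h : IsOrthoFrame g U e ε) (hx : x ∈ U) (c d : Fin 4) :
    g x c d = ∑ a, ε a * lowerVec g x (e a x) c * lowerVec g x (e a x) d := by
  have h1 : g x = (coframeMat g e x).transpose * (Matrix.diagonal ε * coframeMat g e x) := by
    conv_rhs => rw [h.coframe_eq hx]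
    rw [← Matrix.mul_assoc (Matrix.diagonal ε), ← Matrix.mul_assoc, ← h.coframe_eq hx,
      h.resolution' hx, Matrix.one_mul]
  conv_lhs => rw [h1]
  rw [Matrix.mul_apply]
  simp only [Matrix.diagonal_mul, Matrix.transpose_apply, coframeMat, Matrix.of_apply]
  exact Finset.sum_congr rfl fun a _ => by ring

lemma smooth_frameMat (h : IsOrthoFrame g U e ε) : SmoothMat U (frameMat e) := h.smooth_frame

lemma smooth_coframe (h : IsOrthoFrame g U e ε) : SmoothMat U (coframeMat g e) := by
  intro a b
  simp only [coframeMat, Matrix.of_apply, lowerVec]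
  exact ContDiffOn.sum fun c _ => (h.smooth_metric b c).mul (h.smooth_frame a c)

/-- The frame expression ∑ ε_a e_a ⊗ e_a of the inverse metric is polynomial in the frame, so no
matrix inverse has to be differentiated. -/
lemma smooth_inv (h : IsOrthoFrame g U e ε) (c d : Fin 4) :
    ContDiffOn ℝ ∞ (fun y => (g y)⁻¹ c d) U := by
  refine ContDiffOn.congr (f := fun y => ∑ a, ε a * e a y c * e a y d) ?_
    fun y hy => h.inv_apply hy c d
  exact ContDiffOn.sum fun a _ => (contDiffOn_const.mul (h.smooth_frame a c)).mul
    (h.smooth_frame a d)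

lemma smooth_chr (h : IsOrthoFrame g U e ε) (hU : IsOpen U) (c : Fin 4) :
    SmoothMat U (chrMat g c) := by
  intro a b
  simp only [chrMat, Matrix.of_apply, christoffel]
  have hp := fun p q r => contDiffOn_pd hU (h.smooth_metric p q) r
  exact contDiffOn_const.mul (ContDiffOn.sum fun d _ => (h.smooth_inv a d).mul
    (((hp _ _ _).add (hp _ _ _)).sub (hp _ _ _)))

lemma smooth_conn (h : IsOrthoFrame g U e ε) (hU : IsOpen U) (c : Fin 4) :
    SmoothMat U (connMat g e c) :=
  ((h.smooth_coframe.pdMat hU c).sub (h.smooth_coframe.mul (h.smooth_chr hU c))).mul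
    h.smooth_frameMat.transpose

lemma pd_metric_symm (h : IsOrthoFrame g U e ε) (hU : IsOpen U) (hx : x ∈ U) (a b c : Fin 4) :
    pd c (fun y => g y a b) x = pd c (fun y => g y b a) x :=
  pd_congr_of_eqOn hU (fun y hy => (h.symm y hy).apply b a) hx c

lemma christoffel_symm (h : IsOrthoFrame g U e ε) (hU : IsOpen U) (hx : x ∈ U) (a b c : Fin 4) :
    christoffel g x c a b = christoffel g x c b a := by
  unfold christoffel
  congr 1
  refine Finset.sum_congr rfl fun d _ => ?_
  rw [h.pd_metric_symm hU hx a b d]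
  ring

lemma metric_mul_chr (h : IsOrthoFrame g U e ε) (hx : x ∈ U) (a b c : Fin 4) :
    (g x * chrMat g c x) a b = (1 / 2) *
      (pd c (fun y => g y b a) x + pd b (fun y => g y c a) x - pd a (fun y => g y c b) x) := by
  have h1 : (chrMat g c x) = (g x)⁻¹ * Matrix.of fun d b => (1 / 2) *
      (pd c (fun y => g y b d) x + pd b (fun y => g y c d) x - pd d (fun y => g y c b) x) := by
    ext p q
    simp only [chrMat, christoffel, Matrix.of_apply, Matrix.mul_apply, Finset.mul_sum]
    exact Finset.sum_congr rfl fun d _ => by ring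
  rw [h1, ← Matrix.mul_assoc, h.mul_inv hx, Matrix.one_mul]
  rfl

lemma metric_compatible (h : IsOrthoFrame g U e ε) (hU : IsOpen U) (hx : x ∈ U) (c : Fin 4) :
    g x * chrMat g c x + (g x * chrMat g c x).transpose = pdMat c g x := by
  ext a b
  rw [Matrix.add_apply, Matrix.transpose_apply, h.metric_mul_chr hx, h.metric_mul_chr hx]
  simp only [pdMat, Matrix.of_apply]
  rw [h.pd_metric_symm hU hx b a c]
  ring

/-- Differentiate the orthonormality relation and use ∇g = 0: the connection matrix lies in the Lie
algebra of the orthogonal group. -/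
lemma conn_add_transpose (h : IsOrthoFrame g U e ε) (hU : IsOpen U) (hx : x ∈ U) (c : Fin 4) :
    connMat g e c x + (connMat g e c x).transpose = 0 := by
  have h1 : pdMat c (coframeMat g e) x = pdMat c (frameMat e) x * g x
      + frameMat e x * pdMat c g x := by
    rw [pdMat_congr hU (fun y hy => h.coframe_eq hy) hx,
      pdMat_mul hU h.smooth_frameMat h.smooth_metric hx]
  have h2 : pdMat c (frameMat e) x * (coframeMat g e x).transpose
      + frameMat e x * (pdMat c (coframeMat g e) x).transpose = 0 := by
    rw [← pdMat_transpose, ← pdMat_mul hU h.smooth_frameMat h.smooth_coframe.transpose hx,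
      pdMat_congr hU (fun y hy => h.frame_mul_coframe hy) hx, pdMat_const]
  have h3 : (coframeMat g e x).transpose = g x * (frameMat e x).transpose := by
    rw [h.coframe_eq hx, Matrix.transpose_mul, (h.symm x hx).eq]
  have h4 : frameMat e x * (pdMat c (coframeMat g e) x).transpose
      = - (pdMat c (frameMat e) x * (g x * (frameMat e x).transpose)) := by
    rw [← h3]; exact eq_neg_of_add_eq_zero_right h2
  have h5 := h.metric_compatible hU hx c
  rw [connMat, Matrix.transpose_mul, Matrix.transpose_transpose, Matrix.transpose_sub,
    Matrix.sub_mul, Matrix.mul_sub, h4, h1, h.coframe_eq hx, ← h5]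
  simp only [Matrix.transpose_mul, (h.symm x hx).eq]
  noncomm_ring

lemma conn_antisymm (h : IsOrthoFrame g U e ε) (hU : IsOpen U) (hx : x ∈ U) (c a b : Fin 4) :
    connMat g e c x a b = - connMat g e c x b a :=
  eq_neg_of_add_eq_zero_left (congrFun (congrFun (h.conn_add_transpose hU hx c) a) b)

lemma conn_diag (h : IsOrthoFrame g U e ε) (hU : IsOpen U) (hx : x ∈ U) (c a : Fin 4) :
    connMat g e c x a a = 0 := by
  linarith [h.conn_antisymm hU hx c a a]

/-- A linear system ∂_c θ = θ Γ_c + ω_c ε θ for the lowered frame. Its antisymmetric part is the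
first structure equation, its compatibility condition the second. -/
lemma pd_coframe (h : IsOrthoFrame g U e ε) (hx : x ∈ U) (c : Fin 4) :
    pdMat c (coframeMat g e) x
      = coframeMat g e x * chrMat g c x
        + connMat g e c x * (Matrix.diagonal ε * coframeMat g e x) := by
  rw [connMat, Matrix.mul_assoc, h.resolution hx]
  simp

lemma papapetrou_frame (h : IsOrthoFrame g U e ε) (hx : x ∈ U) (a b c : Fin 4) :
    papapetrou g (e a) x c b = ∑ d, connMat g e c x a d * ε d * lowerVec g x (e d x) b := by
  have h1 := congrFun (congrFun (h.pd_coframe hx c) a) b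
  simp only [Matrix.add_apply, Matrix.mul_apply (N := Matrix.diagonal ε * _),
    Matrix.diagonal_mul] at h1
  rw [papapetrou, show pd c (fun y => lowerVec g y (e a y) b) x
    = pdMat c (coframeMat g e) x a b from rfl, h1]
  simp only [Matrix.mul_apply, coframeMat, chrMat, Matrix.of_apply]
  rw [add_sub_assoc, add_comm, sub_add_eq_add_sub, add_sub_assoc]
  rw [show ∑ j, lowerVec g x (e a x) j * christoffel g x j c b
    = ∑ j, christoffel g x j c b * lowerVec g x (e a x) j from
    Finset.sum_congr rfl fun _ _ => mul_comm _ _]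
  rw [sub_self, add_zero]
  exact Finset.sum_congr rfl fun _ _ => by ring

lemma torsion_free (h : IsOrthoFrame g U e ε) (hU : IsOpen U) (hx : x ∈ U) (a b c : Fin 4) :
    pd c (fun y => lowerVec g y (e a y) b) x - pd b (fun y => lowerVec g y (e a y) c) x
      = ∑ d, ε d * (connMat g e c x a d * lowerVec g x (e d x) b
        - connMat g e b x a d * lowerVec g x (e d x) c) := by
  have h1 := h.papapetrou_frame hx a b c
  have h2 := h.papapetrou_frame hx a c b
  rw [papapetrou] at h1 h2
  have h3 : ∑ m, christoffel g x m c b * lowerVec g x (e a x) m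
      = ∑ m, christoffel g x m b c * lowerVec g x (e a x) m :=
    Finset.sum_congr rfl fun m _ => by rw [h.christoffel_symm hU hx c b m]
  have h4 : ∑ d, ε d * (connMat g e c x a d * lowerVec g x (e d x) b
        - connMat g e b x a d * lowerVec g x (e d x) c)
      = ∑ d, connMat g e c x a d * ε d * lowerVec g x (e d x) b
        - ∑ d, connMat g e b x a d * ε d * lowerVec g x (e d x) c := by
    rw [← Finset.sum_sub_distrib]
    exact Finset.sum_congr rfl fun _ _ => by ring
  linarith

lemma riemannMat_eq (c d : Fin 4) :
    riemannMat g c d x = pdMat c (chrMat g d) x - pdMat d (chrMat g c) x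
      + (chrMat g c x * chrMat g d x - chrMat g d x * chrMat g c x) := by
  ext a b
  simp only [riemannMat, riemannUp, pdMat, chrMat, Matrix.of_apply, Matrix.add_apply,
    Matrix.sub_apply, Matrix.mul_apply, Finset.sum_sub_distrib]

/-- Compatibility ∂_c ∂_d θ = ∂_d ∂_c θ of the system in `pd_coframe`: the Γ-terms assemble into the
coordinate curvature, the ω-terms into −(dω) plus the quadratic term, and the mixed terms cancel. -/
lemma coframe_mul_riemann (h : IsOrthoFrame g U e ε) (hU : IsOpen U) (hx : x ∈ U) (c d : Fin 4) :
    coframeMat g e x * riemannMat g c d x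
      = (pdMat d (connMat g e c) x - pdMat c (connMat g e d) x
        + (connMat g e c x * Matrix.diagonal ε * connMat g e d x
          - connMat g e d x * Matrix.diagonal ε * connMat g e c x))
        * (Matrix.diagonal ε * coframeMat g e x) := by
  have hS : SmoothMat U (fun y => Matrix.diagonal ε * coframeMat g e y) :=
    (SmoothMat.const _).mul h.smooth_coframe
  have key : ∀ p q, pdMat p (fun y => pdMat q (coframeMat g e) y) x
      = (coframeMat g e x * chrMat g p x
        + connMat g e p x * (Matrix.diagonal ε * coframeMat g e x)) * chrMat g q x
        + coframeMat g e x * pdMat p (chrMat g q) x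
        + pdMat p (connMat g e q) x * (Matrix.diagonal ε * coframeMat g e x)
        + connMat g e q x * (Matrix.diagonal ε * (coframeMat g e x * chrMat g p x
        + connMat g e p x * (Matrix.diagonal ε * coframeMat g e x))) := by
    intro p q
    rw [pdMat_congr hU (fun y hy => h.pd_coframe hy q) hx,
      pdMat_add hU (h.smooth_coframe.mul (h.smooth_chr hU q)) ((h.smooth_conn hU q).mul hS) hx,
      pdMat_mul hU h.smooth_coframe (h.smooth_chr hU q) hx,
      pdMat_mul hU (h.smooth_conn hU q) hS hx,
      pdMat_mul hU (SmoothMat.const _) h.smooth_coframe hx, pdMat_const, h.pd_coframe hx]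
    noncomm_ring
  have hc := pdMat_comm hU h.smooth_coframe hx c d
  rw [key, key] at hc
  rw [riemannMat_eq, ← sub_eq_zero]
  rw [← sub_eq_zero] at hc
  rw [← hc]
  noncomm_ring

end IsOrthoFrame

/-! ### Frame components of the connection and of the curvature -/

/-- The connection coefficients `g(∇_{e_c} e_a, e_b)`. -/
def connF (g : MetricField) (e : FrameField) (x : Pt) (c a b : Fin 4) : ℝ :=
  ∑ p, e c x p * connMat g e p x a b

/-- The frame components of the exterior derivative of the connection 1-forms. -/
def dconnF (g : MetricField) (e : FrameField) (x : Pt) (a b c d : Fin 4) : ℝ :=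
  ∑ p, ∑ q, e c x p * e d x q *
    (pd p (fun y => connMat g e q y a b) x - pd q (fun y => connMat g e p y a b) x)

/-- The frame components `R_{abcd}` of the Riemann tensor. -/
def riemF (g : MetricField) (e : FrameField) (x : Pt) (a b c d : Fin 4) : ℝ :=
  ∑ p, ∑ q, e c x p * e d x q *
    (coframeMat g e x * riemannMat g p q x * (frameMat e x).transpose) a b

/-- A four-index tensor with the algebraic symmetries of a Riemann tensor is symmetric under
exchange of the pairs. -/
lemma pair_symm_of_cyclic {R : Fin 4 → Fin 4 → Fin 4 → Fin 4 → ℝ}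
    (h1 : ∀ a b c d, R a b c d = - R b a c d) (h2 : ∀ a b c d, R a b c d = - R a b d c)
    (h3 : ∀ a b c d, R a b c d + R a c d b + R a d b c = 0) (a b c d : Fin 4) :
    R a b c d = R c d a b := by
  linarith [h1 a b c d, h1 a c d b, h1 a d b c, h1 b c d a, h1 b d a c, h1 c d a b,
    h2 a b c d, h2 a c d b, h2 a d b c, h2 b c d a, h2 b d a c, h2 c d a b,
    h2 b a c d, h2 c a d b, h2 d a b c, h2 c b d a, h2 d b a c, h2 d c a b,
    h3 a b c d, h3 b c d a, h3 c d a b, h3 d a b c]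

namespace IsOrthoFrame

variable {g : MetricField} {U : Set Pt} {e : FrameField} {ε : Fin 4 → ℝ} {x : Pt}

lemma connF_antisymm (h : IsOrthoFrame g U e ε) (hU : IsOpen U) (hx : x ∈ U) (c a b : Fin 4) :
    connF g e x c a b = - connF g e x c b a := by
  simp only [connF, ← Finset.sum_neg_distrib]
  exact Finset.sum_congr rfl fun p _ => by rw [h.conn_antisymm hU hx p a b]; ring

lemma connF_diag (h : IsOrthoFrame g U e ε) (hU : IsOpen U) (hx : x ∈ U) (c a : Fin 4) :
    connF g e x c a a = 0 := by
  linarith [h.connF_antisymm hU hx c a a]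

lemma sum_frame_coframe (h : IsOrthoFrame g U e ε) (hx : x ∈ U) (a b : Fin 4) :
    ∑ p, e a x p * lowerVec g x (e b x) p = if a = b then ε a else 0 := by
  rw [h.ortho x hx, Matrix.diagonal_apply]

lemma sum_coframe_frame (h : IsOrthoFrame g U e ε) (hx : x ∈ U) (p q : Fin 4) :
    ∑ a, ε a * lowerVec g x (e a x) p * e a x q = if p = q then 1 else 0 := by
  have h1 := congrFun (congrFun (h.resolution' hx) p) q
  rw [Matrix.mul_apply, Matrix.one_apply] at h1
  rw [← h1]
  simp only [Matrix.diagonal_mul, Matrix.transpose_apply, coframeMat, frameMat, Matrix.of_apply]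
  exact Finset.sum_congr rfl fun a _ => by ring

lemma conn_eq_sum (h : IsOrthoFrame g U e ε) (hx : x ∈ U) (p a b : Fin 4) :
    connMat g e p x a b = ∑ c, ε c * lowerVec g x (e c x) p * connF g e x c a b := by
  simp only [connF, Finset.mul_sum]
  rw [Finset.sum_comm]
  have h1 : ∀ q, ∑ c, ε c * lowerVec g x (e c x) p * (e c x q * connMat g e q x a b)
      = (if p = q then 1 else 0) * connMat g e q x a b := by
    intro q
    rw [← h.sum_coframe_frame hx p q, Finset.sum_mul]
    exact Finset.sum_congr rfl fun c _ => by ring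
  simp [h1]

/-- First structure equation, in the frame. -/
lemma torsion_frame (h : IsOrthoFrame g U e ε) (hU : IsOpen U) (hx : x ∈ U) (a c d : Fin 4) :
    ∑ p, ∑ q, e c x p * e d x q *
      (pd p (fun y => lowerVec g y (e a y) q) x - pd q (fun y => lowerVec g y (e a y) p) x)
      = connF g e x c a d - connF g e x d a c := by
  have h1 : ∀ c d : Fin 4, ∑ p, ∑ q, e c x p * e d x q *
      (∑ m, ε m * (connMat g e p x a m * lowerVec g x (e m x) q)) = connF g e x c a d := by
    intro c d
    have h2 : ∀ p, ∑ q, e c x p * e d x q *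
        (∑ m, ε m * (connMat g e p x a m * lowerVec g x (e m x) q))
        = e c x p * connMat g e p x a d := by
      intro p
      have : ∀ m, ∑ q, e c x p * e d x q *
          (ε m * (connMat g e p x a m * lowerVec g x (e m x) q))
          = e c x p * connMat g e p x a m * (ε m * if d = m then ε d else 0) := by
        intro m
        rw [← h.sum_frame_coframe hx d m, Finset.mul_sum, Finset.mul_sum]
        exact Finset.sum_congr rfl fun q _ => by ring
      simp only [Finset.mul_sum]
      rw [Finset.sum_comm]
      simp only [this]
      simp [h.sign]
    simp only [h2, connF]
  rw [← h1 c d, ← h1 d c]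
  rw [Finset.sum_comm (f := fun p q => e d x p * e c x q * _), ← Finset.sum_sub_distrib]
  refine Finset.sum_congr rfl fun p _ => ?_
  rw [← Finset.sum_sub_distrib]
  refine Finset.sum_congr rfl fun q _ => ?_
  rw [h.torsion_free hU hx, mul_comm (e d x q), ← mul_sub, ← Finset.sum_sub_distrib]
  congr 1
  exact Finset.sum_congr rfl fun _ _ => by ring

lemma coframe_riemann_frame (h : IsOrthoFrame g U e ε) (hU : IsOpen U) (hx : x ∈ U)
    (p q a b : Fin 4) :
    (coframeMat g e x * riemannMat g p q x * (frameMat e x).transpose) a b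
      = -(pd p (fun y => connMat g e q y a b) x - pd q (fun y => connMat g e p y a b) x)
        + ∑ m, ε m * (connMat g e p x a m * connMat g e q x m b
          - connMat g e q x a m * connMat g e p x m b) := by
  rw [h.coframe_mul_riemann hU hx, Matrix.mul_assoc, Matrix.mul_assoc (Matrix.diagonal ε),
    h.coframe_mul_frame hx, h.sign_sq, Matrix.mul_one, Matrix.add_apply, Matrix.sub_apply, Matrix.sub_apply,
    Matrix.mul_apply, Matrix.mul_apply, ← Finset.sum_sub_distrib]
  simp only [pdMat, Matrix.of_apply, Matrix.mul_diagonal, neg_sub]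
  congr 1
  exact Finset.sum_congr rfl fun _ _ => by ring

/-- Second structure equation, in the frame. -/
lemma riemF_eq (h : IsOrthoFrame g U e ε) (hU : IsOpen U) (hx : x ∈ U) (a b c d : Fin 4) :
    riemF g e x a b c d = - dconnF g e x a b c d
      + ∑ m, ε m * (connF g e x c a m * connF g e x d m b
        - connF g e x d a m * connF g e x c m b) := by
  simp only [riemF, dconnF, connF, h.coframe_riemann_frame hU hx, Fin.sum_univ_four]
  ring

lemma riemF_antisymm_right (a b c d : Fin 4) : riemF g e x a b c d = - riemF g e x a b d c := by
  have h1 : ∀ p q, riemannMat g p q x = - riemannMat g q p x := by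
    intro p q
    rw [riemannMat_eq, riemannMat_eq]
    abel
  simp only [riemF, ← Finset.sum_neg_distrib]
  rw [Finset.sum_comm]
  refine Finset.sum_congr rfl fun p _ => Finset.sum_congr rfl fun q _ => ?_
  rw [h1 q p, Matrix.mul_neg, Matrix.neg_mul, Matrix.neg_apply]
  ring

lemma riemF_antisymm_left (h : IsOrthoFrame g U e ε) (hU : IsOpen U) (hx : x ∈ U)
    (a b c d : Fin 4) : riemF g e x a b c d = - riemF g e x b a c d := by
  have h1 : ∀ p q, pd p (fun y => connMat g e q y a b) x
      = - pd p (fun y => connMat g e q y b a) x := by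
    intro p q
    rw [← pd_neg]
    exact pd_congr_of_eqOn hU (fun y hy => h.conn_antisymm hU hy q a b) hx p
  simp only [riemF, ← Finset.sum_neg_distrib]
  refine Finset.sum_congr rfl fun p _ => Finset.sum_congr rfl fun q _ => ?_
  rw [h.coframe_riemann_frame hU hx, h.coframe_riemann_frame hU hx, h1, h1]
  have h2 : ∑ m, ε m * (connMat g e p x a m * connMat g e q x m b
      - connMat g e q x a m * connMat g e p x m b)
      = - ∑ m, ε m * (connMat g e p x b m * connMat g e q x m a
      - connMat g e q x b m * connMat g e p x m a) := by
    rw [← Finset.sum_neg_distrib]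
    refine Finset.sum_congr rfl fun m _ => ?_
    rw [h.conn_antisymm hU hx p a m, h.conn_antisymm hU hx q m b,
      h.conn_antisymm hU hx q a m, h.conn_antisymm hU hx p m b]
    ring
  rw [h2]
  ring

lemma riemannUp_cyclic (h : IsOrthoFrame g U e ε) (hU : IsOpen U) (hx : x ∈ U)
    (a b c d : Fin 4) :
    riemannUp g x a b c d + riemannUp g x a c d b + riemannUp g x a d b c = 0 := by
  have h1 : ∀ p q r s, pd s (fun y => christoffel g y p q r) x
      = pd s (fun y => christoffel g y p r q) x := fun p q r s =>
    pd_congr_of_eqOn hU (fun y hy => h.christoffel_symm hU hy q r p) hx s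
  simp only [riemannUp]
  rw [h1 a d b c, h1 a c b d, h1 a d c b]
  have h2 : (∑ m, (christoffel g x a c m * christoffel g x m d b
      - christoffel g x a d m * christoffel g x m c b))
      + (∑ m, (christoffel g x a d m * christoffel g x m b c
      - christoffel g x a b m * christoffel g x m d c))
      + (∑ m, (christoffel g x a b m * christoffel g x m c d
      - christoffel g x a c m * christoffel g x m b d)) = 0 := by
    rw [← Finset.sum_add_distrib, ← Finset.sum_add_distrib]
    refine Finset.sum_eq_zero fun m _ => ?_
    rw [h.christoffel_symm hU hx d b m, h.christoffel_symm hU hx c b m,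
      h.christoffel_symm hU hx d c m]
    ring
  linear_combination h2

lemma riemF_cyclic (h : IsOrthoFrame g U e ε) (hU : IsOpen U) (hx : x ∈ U) (a b c d : Fin 4) :
    riemF g e x a b c d + riemF g e x a c d b + riemF g e x a d b c = 0 := by
  have h1 : ∀ b c d, riemF g e x a b c d = ∑ p, ∑ q, ∑ r, ∑ s,
      e b x r * e c x p * e d x q * lowerVec g x (e a x) s * riemannUp g x s r p q := by
    intro b c d
    simp only [riemF, Matrix.mul_apply, coframeMat, riemannMat, frameMat, Matrix.of_apply,
      Matrix.transpose_apply, Finset.mul_sum, Finset.sum_mul]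
    refine Finset.sum_congr rfl fun p _ => Finset.sum_congr rfl fun q _ =>
      Finset.sum_congr rfl fun r _ => Finset.sum_congr rfl fun s _ => by ring
  have h2 : riemF g e x a c d b = ∑ p, ∑ q, ∑ r, ∑ s,
      e b x r * e c x p * e d x q * lowerVec g x (e a x) s * riemannUp g x s p q r := by
    rw [h1]
    rw [Finset.sum_comm_cycle]
    refine Finset.sum_congr rfl fun p _ => Finset.sum_congr rfl fun q _ =>
      Finset.sum_congr rfl fun r _ => Finset.sum_congr rfl fun s _ => by ring
  have h3 : riemF g e x a d b c = ∑ p, ∑ q, ∑ r, ∑ s,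
      e b x r * e c x p * e d x q * lowerVec g x (e a x) s * riemannUp g x s q r p := by
    rw [h1]
    rw [← Finset.sum_comm_cycle]
    refine Finset.sum_congr rfl fun p _ => Finset.sum_congr rfl fun q _ =>
      Finset.sum_congr rfl fun r _ => Finset.sum_congr rfl fun s _ => by ring
  rw [h1, h2, h3]
  simp only [← Finset.sum_add_distrib, ← mul_add]
  refine Finset.sum_eq_zero fun p _ => Finset.sum_eq_zero fun q _ =>
    Finset.sum_eq_zero fun r _ => Finset.sum_eq_zero fun s _ => ?_
  rw [h.riemannUp_cyclic hU hx, mul_zero]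

lemma riemF_pair_symm (h : IsOrthoFrame g U e ε) (hU : IsOpen U) (hx : x ∈ U) (a b c d : Fin 4) :
    riemF g e x a b c d = riemF g e x c d a b :=
  pair_symm_of_cyclic (h.riemF_antisymm_left hU hx) riemF_antisymm_right
    (h.riemF_cyclic hU hx) a b c d

lemma ricci_frame (h : IsOrthoFrame g U e ε) (hx : x ∈ U) (b d : Fin 4) :
    ∑ a, ε a * riemF g e x a b a d = ∑ r, ∑ q, e b x r * e d x q * ricci g x r q := by
  have h1 : ∀ a, ε a * riemF g e x a b a d = ∑ p, ∑ q, ∑ r, ∑ s,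
      (ε a * lowerVec g x (e a x) s * e a x p) * (e b x r * e d x q * riemannUp g x s r p q) := by
    intro a
    simp only [riemF, Matrix.mul_apply, coframeMat, riemannMat, frameMat, Matrix.of_apply,
      Matrix.transpose_apply, Finset.mul_sum, Finset.sum_mul]
    refine Finset.sum_congr rfl fun p _ => Finset.sum_congr rfl fun q _ =>
      Finset.sum_congr rfl fun r _ => Finset.sum_congr rfl fun s _ => by ring
  simp only [h1]
  rw [Finset.sum_comm]
  have h2 : ∀ p, ∑ a, ∑ q, ∑ r, ∑ s,
      (ε a * lowerVec g x (e a x) s * e a x p) * (e b x r * e d x q * riemannUp g x s r p q)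
      = ∑ q, ∑ r, e b x r * e d x q * riemannUp g x p r p q := by
    intro p
    rw [Finset.sum_comm]
    refine Finset.sum_congr rfl fun q _ => ?_
    rw [Finset.sum_comm]
    refine Finset.sum_congr rfl fun r _ => ?_
    rw [Finset.sum_comm]
    simp only [← Finset.sum_mul, h.sum_coframe_frame hx]
    simp
  simp only [h2, ricci, Finset.mul_sum]
  rw [Finset.sum_comm, Finset.sum_comm_cycle]

lemma ricci_eq_zero_iff (h : IsOrthoFrame g U e ε) (hx : x ∈ U) :
    (∀ b d, ricci g x b d = 0) ↔ ∀ b d, ∑ a, ε a * riemF g e x a b a d = 0 := by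
  constructor
  · intro H b d
    rw [h.ricci_frame hx]
    simp [H]
  · intro H b d
    have h1 : ricci g x b d = ∑ p, ∑ q, (ε p * lowerVec g x (e p x) b)
        * (ε q * lowerVec g x (e q x) d) * (∑ r, ∑ s, e p x r * e q x s * ricci g x r s) := by
      have h2 : ∀ p q, (ε p * lowerVec g x (e p x) b)
          * (ε q * lowerVec g x (e q x) d) * (∑ r, ∑ s, e p x r * e q x s * ricci g x r s)
          = ∑ r, (ε p * lowerVec g x (e p x) b * e p x r) *
            ∑ s, (ε q * lowerVec g x (e q x) d * e q x s) * ricci g x r s := by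
        intro p q
        simp only [Finset.mul_sum]
        exact Finset.sum_congr rfl fun r _ => Finset.sum_congr rfl fun s _ => by ring
      simp only [h2]
      have h3 : ∀ p, ∑ q, ∑ r, (ε p * lowerVec g x (e p x) b * e p x r) *
            ∑ s, (ε q * lowerVec g x (e q x) d * e q x s) * ricci g x r s
          = ∑ r, (ε p * lowerVec g x (e p x) b * e p x r) * ricci g x r d := by
        intro p
        rw [Finset.sum_comm]
        refine Finset.sum_congr rfl fun r _ => ?_
        rw [← Finset.mul_sum, Finset.sum_comm]
        simp only [← Finset.sum_mul, h.sum_coframe_frame hx]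
        simp
      simp only [h3]
      rw [Finset.sum_comm]
      simp only [← Finset.sum_mul, h.sum_coframe_frame hx]
      simp
    rw [h1]
    simp only [← h.ricci_frame hx, H]
    simp

lemma riemann_frame (h : IsOrthoFrame g U e ε) (hx : x ∈ U) (a b c d : Fin 4) :
    riemF g e x a b c d = ∑ r, ∑ s, e a x r * e b x s *
      ∑ p, ∑ q, e c x p * e d x q * riemann g x r s p q := by
  have h1 : ∀ s, lowerVec g x (e a x) s = ∑ r, e a x r * g x r s := by
    intro s
    have := congrFun (congrFun (h.coframe_eq hx) a) s
    simpa [Matrix.mul_apply, coframeMat, frameMat] using this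
  have h2 : ∀ p q, (coframeMat g e x * riemannMat g p q x * (frameMat e x).transpose) a b
      = ∑ r, ∑ s, e a x r * e b x s * riemann g x r s p q := by
    intro p q
    simp only [Matrix.mul_apply, coframeMat, riemannMat, frameMat, Matrix.of_apply,
      Matrix.transpose_apply, riemann, h1, Finset.mul_sum, Finset.sum_mul]
    rw [Finset.sum_comm_cycle, Finset.sum_comm_cycle, Finset.sum_comm]
    refine Finset.sum_congr rfl fun r _ => ?_
    rw [Finset.sum_comm]
    exact Finset.sum_congr rfl fun s _ => Finset.sum_congr rfl fun m _ => by ring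
  simp only [riemF, h2, Finset.mul_sum]
  rw [Finset.sum_congr rfl fun p _ => Finset.sum_comm_cycle, Finset.sum_comm, eq_comm,
    Finset.sum_comm, eq_comm]
  refine Finset.sum_congr rfl fun r _ => ?_
  rw [Finset.sum_congr rfl fun p _ => Finset.sum_comm, Finset.sum_comm]
  refine Finset.sum_congr rfl fun s _ => Finset.sum_congr rfl fun p _ =>
      Finset.sum_congr rfl fun q _ => by ring

end IsOrthoFrame

/-! ### The Levi-Civita symbol -/

lemma det_fin_four {R : Type*} [CommRing R] (A : Matrix (Fin 4) (Fin 4) R) :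
    A.det = A 0 0 * (A 1 1 * A 2 2 * A 3 3 - A 1 1 * A 2 3 * A 3 2 - A 1 2 * A 2 1 * A 3 3
        + A 1 2 * A 2 3 * A 3 1 + A 1 3 * A 2 1 * A 3 2 - A 1 3 * A 2 2 * A 3 1)
      - A 0 1 * (A 1 0 * A 2 2 * A 3 3 - A 1 0 * A 2 3 * A 3 2 - A 1 2 * A 2 0 * A 3 3
        + A 1 2 * A 2 3 * A 3 0 + A 1 3 * A 2 0 * A 3 2 - A 1 3 * A 2 2 * A 3 0)
      + A 0 2 * (A 1 0 * A 2 1 * A 3 3 - A 1 0 * A 2 3 * A 3 1 - A 1 1 * A 2 0 * A 3 3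
        + A 1 1 * A 2 3 * A 3 0 + A 1 3 * A 2 0 * A 3 1 - A 1 3 * A 2 1 * A 3 0)
      - A 0 3 * (A 1 0 * A 2 1 * A 3 2 - A 1 0 * A 2 2 * A 3 1 - A 1 1 * A 2 0 * A 3 2
        + A 1 1 * A 2 2 * A 3 0 + A 1 2 * A 2 0 * A 3 1 - A 1 2 * A 2 1 * A 3 0) := by
  rw [Matrix.det_succ_row_zero, Fin.sum_univ_four]
  simp only [Matrix.det_fin_three, Matrix.submatrix_apply]
  have e1 : (Fin.succAbove 1 : Fin 3 → Fin 4) = ![0, 2, 3] := by decide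
  have e2 : (Fin.succAbove 2 : Fin 3 → Fin 4) = ![0, 1, 3] := by decide
  have e3 : (Fin.succAbove 3 : Fin 3 → Fin 4) = ![0, 1, 2] := by decide
  have e0 : (Fin.succAbove 0 : Fin 3 → Fin 4) = ![1, 2, 3] := by decide
  have e4 : (Fin.succ : Fin 3 → Fin 4) = ![1, 2, 3] := by decide
  rw [e0, e1, e2, e3, e4]
  simp
  ring

/-- The integer-valued Levi-Civita symbol, as a Vandermonde product. -/
def leviZ (a b c d : Fin 4) : ℤ :=
  (((b : ℕ) : ℤ) - (a : ℕ)) * (((c : ℕ) : ℤ) - (a : ℕ)) * (((d : ℕ) : ℤ) - (a : ℕ))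
    * (((c : ℕ) : ℤ) - (b : ℕ)) * (((d : ℕ) : ℤ) - (b : ℕ)) * (((d : ℕ) : ℤ) - (c : ℕ)) / 12

/-- For distinct indices the Vandermonde product is ±12, with the sign of the permutation; a
repeated index makes it zero. Over ℤ all index choices can be decided. -/
lemma levi_eq (a b c d : Fin 4) : levi a b c d = (leviZ a b c d : ℝ) := by
  have h : levi a b c d = ((Matrix.det (Matrix.of fun i j : Fin 4 =>
      if (![a, b, c, d] : Fin 4 → Fin 4) i = j then (1 : ℤ) else 0) : ℤ) : ℝ) := by
    rw [levi, Int.cast_det]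
    congr 1
    ext i j
    simp
  rw [h]
  congr 1
  rw [det_fin_four]
  simp only [Matrix.of_apply]
  clear h
  revert a b c d
  decide

lemma sum_fun_succ {n : ℕ} (F : (Fin (n + 1) → Fin 4) → ℝ) :
    ∑ r, F r = ∑ a, ∑ r : Fin n → Fin 4, F (Matrix.vecCons a r) := by
  rw [← (Fin.consEquiv fun _ => Fin 4).sum_comp, Fintype.sum_prod_type]
  rfl

lemma sum_fun_zero (F : (Fin 0 → Fin 4) → ℝ) : ∑ r, F r = F ![] :=
  (Fintype.sum_unique F).trans (congrArg F (Subsingleton.elim _ _))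

/-- Both sides are the determinant with rows E_a, E_b, E_c, E_d: multiplicativity gives the right
side, multilinear expansion over all maps of the rows gives the left. -/
lemma levi_contract (E : Matrix (Fin 4) (Fin 4) ℝ) (a b c d : Fin 4) :
    ∑ p, ∑ q, ∑ r, ∑ s, levi p q r s * (E a p * E b q * E c r * E d s)
      = E.det * levi a b c d := by
  have h1 : E.det * levi a b c d
      = Matrix.det (Matrix.of fun i j => E ((![a, b, c, d] : Fin 4 → Fin 4) i) j) := by
    rw [levi, mul_comm, ← Matrix.det_mul]
    congr 1
    ext i j
    simp [Matrix.mul_apply]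
  have h2 : (Matrix.of fun i j => E ((![a, b, c, d] : Fin 4 → Fin 4) i) j)
      = fun i => ∑ p, E ((![a, b, c, d] : Fin 4 → Fin 4) i) p • (Pi.single p (1 : ℝ)) := by
    ext i j
    simp [Finset.sum_apply, Pi.single_apply]
  have h3 := (Matrix.detRowAlternating (n := Fin 4) (R := ℝ)).toMultilinearMap.map_sum
    (fun i p => E ((![a, b, c, d] : Fin 4 → Fin 4) i) p • (Pi.single p (1 : ℝ) : Fin 4 → ℝ))
  have h4 : ∀ r : Fin 4 → Fin 4,
      (Matrix.detRowAlternating (n := Fin 4) (R := ℝ)).toMultilinearMap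
        (fun i => E ((![a, b, c, d] : Fin 4 → Fin 4) i) (r i)
          • (Pi.single (r i) (1 : ℝ) : Fin 4 → ℝ))
      = (∏ i, E ((![a, b, c, d] : Fin 4 → Fin 4) i) (r i))
        * Matrix.det (Matrix.of fun i j => if r i = j then (1 : ℝ) else 0) := by
    intro r
    rw [MultilinearMap.map_smul_univ, smul_eq_mul]
    congr 1
    change Matrix.det _ = _
    congr 1
    ext i j
    simp [Pi.single_apply, eq_comm]
  rw [h1, h2]
  refine Eq.trans ?_ h3.symm
  simp only [h4]
  rw [sum_fun_succ]
  simp only [sum_fun_succ, sum_fun_zero, Fin.prod_univ_four]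
  refine Finset.sum_congr rfl fun p _ => Finset.sum_congr rfl fun q _ =>
    Finset.sum_congr rfl fun r _ => Finset.sum_congr rfl fun s _ => ?_
  rw [mul_comm, levi]
  rfl

/-! ### Frame components of 2-forms -/

/-- Frame components of a two-index tensor. -/
def biF (e : FrameField) (x : Pt) (B : Biform) (a b : Fin 4) : ℂ :=
  ∑ p, ∑ q, (e a x p : ℂ) * (e b x q : ℂ) * B p q

/-- The 2-form `e_a ∧ e_b` (indices lowered). -/
def wedgeL (g : MetricField) (e : FrameField) (x : Pt) (a b : Fin 4) : Biform :=
  Matrix.of fun p q => ((lowerVec g x (e a x) p * lowerVec g x (e b x) q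
      - lowerVec g x (e b x) p * lowerVec g x (e a x) q : ℝ) : ℂ)

/-- The orientation of the frame, `√|det g| det e`. -/
def orient (g : MetricField) (e : FrameField) (x : Pt) : ℝ :=
  Real.sqrt |(g x).det| * (frameMat e x).det

/-- Frame components of the Weyl tensor. -/
def weylF (g : MetricField) (e : FrameField) (x : Pt) (a b c d : Fin 4) : ℝ :=
  ∑ r, ∑ s, e a x r * e b x s * ∑ p, ∑ q, e c x p * e d x q * weyl g x r s p q

lemma sum_comm_pairs {M : Type*} [AddCommMonoid M] (f : Fin 4 → Fin 4 → Fin 4 → Fin 4 → M) :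
    ∑ a, ∑ b, ∑ c, ∑ d, f a b c d = ∑ c, ∑ d, ∑ a, ∑ b, f a b c d := by
  rw [Finset.sum_congr rfl fun a _ => Finset.sum_comm, Finset.sum_comm]
  refine Finset.sum_congr rfl fun c _ => ?_
  rw [Finset.sum_congr rfl fun a _ => Finset.sum_comm, Finset.sum_comm]

lemma biF_add (e : FrameField) (x : Pt) (B C : Biform) (a b : Fin 4) :
    biF e x (B + C) a b = biF e x B a b + biF e x C a b := by
  simp only [biF, ← Finset.sum_add_distrib, Matrix.add_apply, mul_add]

lemma biF_smul (e : FrameField) (x : Pt) (z : ℂ) (B : Biform) (a b : Fin 4) :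
    biF e x (z • B) a b = z * biF e x B a b := by
  simp only [biF, Finset.mul_sum, Matrix.smul_apply, smul_eq_mul]
  exact Finset.sum_congr rfl fun p _ => Finset.sum_congr rfl fun q _ => by ring

lemma biF_sub (e : FrameField) (x : Pt) (B C : Biform) (a b : Fin 4) :
    biF e x (B - C) a b = biF e x B a b - biF e x C a b := by
  simp only [biF, ← Finset.sum_sub_distrib, Matrix.sub_apply, mul_sub]

lemma biF_antisymm {e : FrameField} {x : Pt} {B : Biform} (hB : ∀ p q, B p q = - B q p)
    (a b : Fin 4) : biF e x B a b = - biF e x B b a := by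
  simp only [biF, ← Finset.sum_neg_distrib]
  rw [Finset.sum_comm]
  refine Finset.sum_congr rfl fun p _ => Finset.sum_congr rfl fun q _ => ?_
  rw [hB q p]
  ring

namespace IsOrthoFrame

variable {g : MetricField} {U : Set Pt} {e : FrameField} {ε : Fin 4 → ℝ} {x : Pt}

lemma biform_eq_sum (h : IsOrthoFrame g U e ε) (hx : x ∈ U) (B : Biform) (p q : Fin 4) :
    B p q = ∑ a, ∑ b, ((ε a * lowerVec g x (e a x) p : ℝ) : ℂ)
      * ((ε b * lowerVec g x (e b x) q : ℝ) : ℂ) * biF e x B a b := by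
  have hC : ∀ p q, ∑ a, ((ε a * lowerVec g x (e a x) p : ℝ) : ℂ) * (e a x q : ℂ)
      = if p = q then 1 else 0 := by
    intro p q
    have := congrArg (fun r : ℝ => (r : ℂ)) (h.sum_coframe_frame hx p q)
    push_cast at this ⊢
    rw [this]
    split_ifs <;> simp
  have h1 : ∀ a b, ((ε a * lowerVec g x (e a x) p : ℝ) : ℂ)
      * ((ε b * lowerVec g x (e b x) q : ℝ) : ℂ) * biF e x B a b
      = ∑ r, (((ε a * lowerVec g x (e a x) p : ℝ) : ℂ) * (e a x r : ℂ)) *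
        ∑ s, (((ε b * lowerVec g x (e b x) q : ℝ) : ℂ) * (e b x s : ℂ)) * B r s := by
    intro a b
    simp only [biF, Finset.mul_sum]
    exact Finset.sum_congr rfl fun r _ => Finset.sum_congr rfl fun s _ => by ring
  have h2 : ∀ a, ∑ b, ∑ r, (((ε a * lowerVec g x (e a x) p : ℝ) : ℂ) * (e a x r : ℂ)) *
        ∑ s, (((ε b * lowerVec g x (e b x) q : ℝ) : ℂ) * (e b x s : ℂ)) * B r s
      = ∑ r, (((ε a * lowerVec g x (e a x) p : ℝ) : ℂ) * (e a x r : ℂ)) * B r q := by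
    intro a
    rw [Finset.sum_comm]
    refine Finset.sum_congr rfl fun r _ => ?_
    rw [← Finset.mul_sum, Finset.sum_comm]
    simp only [← Finset.sum_mul, hC]
    simp
  simp only [h1, h2]
  rw [Finset.sum_comm]
  simp only [← Finset.sum_mul, hC]
  simp

lemma biform_ext (h : IsOrthoFrame g U e ε) (hx : x ∈ U) {B C : Biform}
    (H : ∀ a b, biF e x B a b = biF e x C a b) : B = C := by
  ext p q
  rw [h.biform_eq_sum hx B, h.biform_eq_sum hx C]
  simp only [H]

lemma raiseBoth_eq (h : IsOrthoFrame g U e ε) (hx : x ∈ U) (B : Biform) (p q : Fin 4) :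
    raiseBoth g x B p q = ∑ a, ∑ b, (ε a : ℂ) * (ε b : ℂ) * (e a x p : ℂ) * (e b x q : ℂ)
      * biF e x B a b := by
  simp only [raiseBoth, h.inv_apply hx, biF, Finset.mul_sum]
  rw [sum_comm_pairs]
  push_cast
  simp only [Finset.sum_mul_sum]
  refine Finset.sum_congr rfl fun r _ => Finset.sum_congr rfl fun s _ => ?_
  simp only [Finset.sum_mul]
  exact Finset.sum_congr rfl fun a _ => Finset.sum_congr rfl fun b _ => by ring

lemma biF_hodge (h : IsOrthoFrame g U e ε) (hx : x ∈ U) (B : Biform) (a b : Fin 4) :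
    biF e x (hodge g x B) a b = (1 / 2) * (orient g e x : ℂ) *
      ∑ c, ∑ d, (levi a b c d : ℂ) * ((ε c : ℂ) * (ε d : ℂ)) * biF e x B c d := by
  have h1 : ∀ c d, (orient g e x : ℂ) * (levi a b c d : ℂ)
      = (Real.sqrt |(g x).det| : ℂ) * ∑ p, ∑ q, ∑ r, ∑ s, (levi p q r s : ℂ)
        * ((e a x p : ℂ) * (e b x q : ℂ) * (e c x r : ℂ) * (e d x s : ℂ)) := by
    intro c d
    have := congrArg (fun r : ℝ => (r : ℂ)) (levi_contract (frameMat e x) a b c d)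
    simp only [frameMat, Matrix.of_apply] at this
    push_cast at this
    rw [this, orient]
    push_cast
    simp only [frameMat]
    ring
  have h2 : ∀ p q, (e a x p : ℂ) * (e b x q : ℂ) * hodge g x B p q
      = ∑ c, ∑ d, (1 / 2) * ((ε c : ℂ) * (ε d : ℂ)) * biF e x B c d
        * ((Real.sqrt |(g x).det| : ℂ) * ∑ r, ∑ s, (levi p q r s : ℂ)
        * ((e a x p : ℂ) * (e b x q : ℂ) * (e c x r : ℂ) * (e d x s : ℂ))) := by
    intro p q
    simp only [hodge, Matrix.of_apply, h.raiseBoth_eq hx, Finset.mul_sum]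
    rw [sum_comm_pairs]
    refine Finset.sum_congr rfl fun c _ => Finset.sum_congr rfl fun d _ =>
      Finset.sum_congr rfl fun r _ => Finset.sum_congr rfl fun s _ => ?_
    rw [volumeElement]
    push_cast
    ring
  rw [biF]
  simp only [h2]
  rw [sum_comm_pairs, Finset.mul_sum]
  refine Finset.sum_congr rfl fun c _ => ?_
  rw [Finset.mul_sum]
  refine Finset.sum_congr rfl fun d _ => ?_
  have h3 : (1 / 2) * (orient g e x : ℂ) * ((levi a b c d : ℂ) * ((ε c : ℂ) * (ε d : ℂ))
        * biF e x B c d) = (1 / 2) * ((ε c : ℂ) * (ε d : ℂ)) * biF e x B c d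
        * ((orient g e x : ℂ) * (levi a b c d : ℂ)) := by ring
  rw [h3, h1]
  simp only [Finset.mul_sum]

lemma biF_wedgeL (h : IsOrthoFrame g U e ε) (hx : x ∈ U) (c d a b : Fin 4) :
    biF e x (wedgeL g e x c d) a b = (if a = c then (ε a : ℂ) else 0) * (if b = d then (ε b : ℂ) else 0)
      - (if a = d then (ε a : ℂ) else 0) * (if b = c then (ε b : ℂ) else 0) := by
  have h1 : ∀ a c, ∑ p, (e a x p : ℂ) * (lowerVec g x (e c x) p : ℂ)
      = if a = c then (ε a : ℂ) else 0 := by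
    intro a c
    have := congrArg (fun r : ℝ => (r : ℂ)) (h.sum_frame_coframe hx a c)
    push_cast at this
    rw [this]
    split_ifs <;> simp
  rw [← h1, ← h1, ← h1, ← h1, Finset.sum_mul_sum, Finset.sum_mul_sum, biF,
    ← Finset.sum_sub_distrib]
  refine Finset.sum_congr rfl fun p _ => ?_
  rw [← Finset.sum_sub_distrib]
  refine Finset.sum_congr rfl fun q _ => ?_
  simp only [wedgeL, Matrix.of_apply]
  push_cast
  ring

/-- Taking determinants in the orthonormality relation gives (det e)² det g = −1, so the orientation
is ±1. -/
lemma orient_sq (h : IsOrthoFrame g U e ![-1, 1, 1, 1]) (hx : x ∈ U) :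
    orient g e x * orient g e x = 1 := by
  have h1 : (frameMat e x).det * ((g x).det * (frameMat e x).det) = -1 := by
    have := congrArg Matrix.det (h.frame_mul_coframe hx)
    rw [h.coframe_eq hx, Matrix.det_mul, Matrix.det_transpose, Matrix.det_mul,
      Matrix.det_diagonal] at this
    simp [Fin.prod_univ_four] at this
    linarith
  have hneg : (g x).det < 0 := by
    by_contra hc
    push Not at hc
    nlinarith [mul_nonneg hc (mul_self_nonneg (frameMat e x).det)]
  rw [orient]
  calc _ = (Real.sqrt |(g x).det| * Real.sqrt |(g x).det|)
        * ((frameMat e x).det * (frameMat e x).det) := by ring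
    _ = 1 := by
      rw [Real.mul_self_sqrt (abs_nonneg _), abs_of_neg hneg]
      linarith

end IsOrthoFrame

/-! ### Self-dual bivectors of a Lorentzian frame -/

/-- The signs of a Lorentzian frame. -/
abbrev lorentzSign : Fin 4 → ℝ := ![-1, 1, 1, 1]

/-- For the spatial index `i`, the pair `(fstIdx i, sndIdx i)` completes `(0, i)` to an even
permutation of the four frame indices. -/
def fstIdx (i : Fin 3) : Fin 4 := (i + 1).succ

/-- See `fstIdx`. -/
def sndIdx (i : Fin 3) : Fin 4 := (i + 2).succ

/-- The imaginary unit adapted to the orientation of the frame. -/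
def unitJ (g : MetricField) (e : FrameField) (x : Pt) : ℂ := (orient g e x : ℂ) * Complex.I

/-- The Hodge dual as a linear map. -/
def hodgeLin (g : MetricField) (x : Pt) : Biform →ₗ[ℂ] Biform where
  toFun := hodge g x
  map_add' B C := by
    ext a b
    simp only [hodge, raiseBoth, Matrix.of_apply, Matrix.add_apply, mul_add,
      Finset.sum_add_distrib]
  map_smul' z B := by
    ext a b
    simp only [hodge, raiseBoth, Matrix.of_apply, Matrix.smul_apply, smul_eq_mul, Finset.mul_sum,
      RingHom.id_apply]
    refine Finset.sum_congr rfl fun c _ => Finset.sum_congr rfl fun d _ =>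
      Finset.sum_congr rfl fun p _ => Finset.sum_congr rfl fun q _ => by ring

/-- The 2-form `(1/2) W_{abcd} B^{cd}`. -/
def weylContract (g : MetricField) (x : Pt) (B : Biform) : Biform :=
  Matrix.of fun a b => (1 / 2) * ∑ c, ∑ d, (weyl g x a b c d : ℂ) * raiseBoth g x B c d

/-- The dual acts linearly on the first index pair of W, so it can be taken after the contraction
with B: 𝒲(B) is the self-dual half of W(B). -/
lemma weylMap_eq (g : MetricField) (x : Pt) (B : Biform) :
    weylMap g x B = (1 / 2 : ℂ) • (weylContract g x B
      - Complex.I • hodge g x (weylContract g x B)) := by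
  have h1 : weylContract g x B = ∑ c, ∑ d, ((1 / 2) * raiseBoth g x B c d) •
      (Matrix.of fun p q => (weyl g x p q c d : ℂ) : Biform) := by
    ext a b
    simp only [weylContract, Matrix.of_apply, Matrix.sum_apply, Matrix.smul_apply, smul_eq_mul,
      Finset.mul_sum]
    exact Finset.sum_congr rfl fun c _ => Finset.sum_congr rfl fun d _ => by ring
  have h2 : hodge g x (weylContract g x B) = ∑ c, ∑ d, ((1 / 2) * raiseBoth g x B c d) •
      hodge g x (Matrix.of fun p q => (weyl g x p q c d : ℂ)) := by
    rw [h1]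
    change hodgeLin g x _ = _
    simp only [map_sum, map_smul]
    rfl
  rw [h2]
  ext a b
  simp only [weylMap, selfDualWeyl, weylContract, Matrix.of_apply, Matrix.sum_apply,
    Matrix.smul_apply, Matrix.sub_apply, smul_eq_mul, Finset.mul_sum,
    ← Finset.sum_sub_distrib]
  exact Finset.sum_congr rfl fun c _ => Finset.sum_congr rfl fun d _ => by ring

lemma leviZ_antisymm : ∀ a b c d : Fin 4, leviZ a b c d = - leviZ b a c d := by decide

namespace IsOrthoFrame

variable {g : MetricField} {U : Set Pt} {e : FrameField} {ε : Fin 4 → ℝ} {x : Pt}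

lemma biF_hodge_antisymm (h : IsOrthoFrame g U e ε) (hx : x ∈ U) (B : Biform) (a b : Fin 4) :
    biF e x (hodge g x B) a b = - biF e x (hodge g x B) b a := by
  rw [h.biF_hodge hx, h.biF_hodge hx, ← mul_neg, ← Finset.sum_neg_distrib]
  congr 1
  refine Finset.sum_congr rfl fun c _ => ?_
  rw [← Finset.sum_neg_distrib]
  refine Finset.sum_congr rfl fun d _ => ?_
  rw [levi_eq, levi_eq, leviZ_antisymm]
  push_cast
  ring

lemma biF_weylContract (h : IsOrthoFrame g U e ε) (hx : x ∈ U) (B : Biform) (a b : Fin 4) :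
    biF e x (weylContract g x B) a b = (1 / 2) * ∑ c, ∑ d, ((ε c : ℂ) * (ε d : ℂ))
      * (weylF g e x a b c d : ℂ) * biF e x B c d := by
  have h1 : ∀ p q, (e a x p : ℂ) * (e b x q : ℂ) * weylContract g x B p q
      = ∑ c, ∑ d, ((1 / 2) * ((ε c : ℂ) * (ε d : ℂ)) * biF e x B c d)
        * ((e a x p : ℂ) * (e b x q : ℂ) * ∑ r, ∑ s, (e c x r : ℂ) * (e d x s : ℂ)
          * (weyl g x p q r s : ℂ)) := by
    intro p q
    simp only [weylContract, Matrix.of_apply, h.raiseBoth_eq hx, Finset.mul_sum]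
    rw [sum_comm_pairs]
    refine Finset.sum_congr rfl fun c _ => Finset.sum_congr rfl fun d _ =>
      Finset.sum_congr rfl fun r _ => Finset.sum_congr rfl fun s _ => by ring
  rw [biF]
  simp only [h1]
  rw [sum_comm_pairs, Finset.mul_sum]
  refine Finset.sum_congr rfl fun c _ => ?_
  rw [Finset.mul_sum]
  refine Finset.sum_congr rfl fun d _ => ?_
  simp only [← Finset.mul_sum]
  rw [weylF]
  push_cast
  ring

lemma weylF_eq_riemF (h : IsOrthoFrame g U e ε) (hx : x ∈ U)
    (hv : ∀ a b, ricci g x a b = 0) (a b c d : Fin 4) :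
    weylF g e x a b c d = riemF g e x a b c d := by
  rw [h.riemann_frame hx, weylF]
  simp [weyl, hv, scalarCurvature]

end IsOrthoFrame

section Lorentz

variable {g : MetricField} {U : Set Pt} {e : FrameField} {x : Pt}

lemma unitJ_sq (h : IsOrthoFrame g U e lorentzSign) (hx : x ∈ U) :
    unitJ g e x * unitJ g e x = -1 := by
  have := congrArg (fun r : ℝ => (r : ℂ)) (h.orient_sq hx)
  push_cast at this
  rw [unitJ]
  linear_combination (Complex.I * Complex.I) * this + Complex.I_mul_I

/-- A 2-form is determined by its three electric components (0,i) and its three magnetic ones,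
indexed by the complementary pairs. -/
lemma biform_ext_lorentz (h : IsOrthoFrame g U e lorentzSign) (hx : x ∈ U) {B C : Biform}
    (hB : ∀ a b, biF e x B a b = - biF e x B b a) (hC : ∀ a b, biF e x C a b = - biF e x C b a)
    (H : ∀ i : Fin 3, biF e x B 0 i.succ = biF e x C 0 i.succ)
    (H' : ∀ i : Fin 3, biF e x B (fstIdx i) (sndIdx i) = biF e x C (fstIdx i) (sndIdx i)) :
    B = C := by
  apply h.biform_ext hx
  have z : ∀ a, biF e x B a a = biF e x C a a := fun a =>
    (self_eq_neg.mp (hB a a)).trans (self_eq_neg.mp (hC a a)).symm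
  have n : ∀ a b, biF e x B a b = biF e x C a b → biF e x B b a = biF e x C b a := fun a b hab => by
    rw [hB, hC, hab]
  intro a b
  fin_cases a <;> fin_cases b
  exacts [z 0, H 0, H 1, H 2, n _ _ (H 0), z 1, H' 2, n _ _ (H' 1), n _ _ (H 1), n _ _ (H' 2), z 2,
    H' 0, n _ _ (H 2), H' 1, n _ _ (H' 0), z 3]

lemma biF_hodge_zero (h : IsOrthoFrame g U e lorentzSign) (hx : x ∈ U) {B : Biform}
    (hB : ∀ a b, biF e x B a b = - biF e x B b a) (i : Fin 3) :
    biF e x (hodge g x B) 0 i.succ = (orient g e x : ℂ) * biF e x B (fstIdx i) (sndIdx i) := by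
  rw [h.biF_hodge hx]
  fin_cases i <;> simp [Fin.sum_univ_four, levi_eq, leviZ, fstIdx, sndIdx]
  · rw [hB 3 2]; ring
  · rw [hB 1 3]; ring
  · rw [hB 2 1]; ring

lemma biF_hodge_spatial (h : IsOrthoFrame g U e lorentzSign) (hx : x ∈ U) {B : Biform}
    (hB : ∀ a b, biF e x B a b = - biF e x B b a) (i : Fin 3) :
    biF e x (hodge g x B) (fstIdx i) (sndIdx i) = - (orient g e x : ℂ) * biF e x B 0 i.succ := by
  rw [h.biF_hodge hx]
  fin_cases i <;> simp [Fin.sum_univ_four, levi_eq, leviZ, fstIdx, sndIdx]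
  · rw [hB 1 0]; ring
  · rw [hB 2 0]; ring
  · rw [hB 3 0]; ring

lemma biF_wedgeL_antisymm (h : IsOrthoFrame g U e lorentzSign) (hx : x ∈ U) (c d a b : Fin 4) :
    biF e x (wedgeL g e x c d) a b = - biF e x (wedgeL g e x c d) b a := by
  rw [h.biF_wedgeL hx, h.biF_wedgeL hx]
  ring

lemma biF_smul_antisymm {B : Biform} (hB : ∀ a b, biF e x B a b = - biF e x B b a) (z : ℂ)
    (a b : Fin 4) : biF e x (z • B) a b = - biF e x (z • B) b a := by
  rw [biF_smul, biF_smul, hB]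
  ring

lemma biF_sub_antisymm {B C : Biform} (hB : ∀ a b, biF e x B a b = - biF e x B b a)
    (hC : ∀ a b, biF e x C a b = - biF e x C b a)
    (a b : Fin 4) : biF e x (B - C) a b = - biF e x (B - C) b a := by
  rw [biF_sub, biF_sub, hB, hC]
  ring

lemma hodge_wedgeL (h : IsOrthoFrame g U e lorentzSign) (hx : x ∈ U) (i : Fin 3) :
    hodge g x (wedgeL g e x 0 i.succ)
      = (orient g e x : ℂ) • wedgeL g e x (fstIdx i) (sndIdx i) := by
  have hw := biF_wedgeL_antisymm h hx
  refine biform_ext_lorentz h hx (h.biF_hodge_antisymm hx _) (biF_smul_antisymm (hw _ _) _) ?_ ?_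
  · intro j
    rw [biF_hodge_zero h hx (hw _ _), biF_smul, h.biF_wedgeL hx, h.biF_wedgeL hx]
    fin_cases i <;> fin_cases j <;> simp [fstIdx, sndIdx]
  · intro j
    rw [biF_hodge_spatial h hx (hw _ _), biF_smul, h.biF_wedgeL hx, h.biF_wedgeL hx]
    fin_cases i <;> fin_cases j <;> simp [fstIdx, sndIdx]

/-- The principal bivectors in terms of the coframe. -/
lemma frameBivector_eq (h : IsOrthoFrame g U e lorentzSign) (hx : x ∈ U) (i : Fin 3) :
    frameBivector g e i x = ((Real.sqrt 2 : ℝ) : ℂ)⁻¹ • (wedgeL g e x 0 i.succ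
      - unitJ g e x • wedgeL g e x (fstIdx i) (sndIdx i)) := by
  change ((Real.sqrt 2 : ℝ) : ℂ)⁻¹ • (wedgeL g e x 0 i.succ
    - Complex.I • hodge g x (wedgeL g e x 0 i.succ)) = _
  rw [hodge_wedgeL h hx, smul_smul, unitJ, mul_comm]

lemma biF_frameBivector_antisymm (h : IsOrthoFrame g U e lorentzSign) (hx : x ∈ U) (i : Fin 3)
    (a b : Fin 4) :
    biF e x (frameBivector g e i x) a b = - biF e x (frameBivector g e i x) b a := by
  have hw := biF_wedgeL_antisymm h hx
  rw [frameBivector_eq h hx]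
  exact biF_smul_antisymm (biF_sub_antisymm (hw _ _) (biF_smul_antisymm (hw _ _) _)) _ a b

lemma biF_frameBivector_zero (h : IsOrthoFrame g U e lorentzSign) (hx : x ∈ U) (i j : Fin 3) :
    biF e x (frameBivector g e i x) 0 j.succ
      = if i = j then - ((Real.sqrt 2 : ℝ) : ℂ)⁻¹ else 0 := by
  rw [frameBivector_eq h hx, biF_smul, biF_sub, biF_smul, h.biF_wedgeL hx, h.biF_wedgeL hx]
  fin_cases i <;> fin_cases j <;> simp [fstIdx, sndIdx]

lemma biF_frameBivector_spatial (h : IsOrthoFrame g U e lorentzSign) (hx : x ∈ U) (i j : Fin 3) :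
    biF e x (frameBivector g e i x) (fstIdx j) (sndIdx j)
      = if i = j then - (unitJ g e x * ((Real.sqrt 2 : ℝ) : ℂ)⁻¹) else 0 := by
  rw [frameBivector_eq h hx, biF_smul, biF_sub, biF_smul, h.biF_wedgeL hx, h.biF_wedgeL hx]
  fin_cases i <;> fin_cases j <;> simp [fstIdx, sndIdx] <;> ring

lemma inv_sqrt_two_sq : ((Real.sqrt 2 : ℝ) : ℂ)⁻¹ * ((Real.sqrt 2 : ℝ) : ℂ)⁻¹ = 1 / 2 := by
  rw [← mul_inv, ← Complex.ofReal_mul, Real.mul_self_sqrt (by norm_num)]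
  norm_num

lemma inv_sqrt_two_ne : ((Real.sqrt 2 : ℝ) : ℂ)⁻¹ ≠ 0 := by
  intro h0
  have := inv_sqrt_two_sq
  rw [h0] at this
  norm_num at this

lemma biF_sum (e : FrameField) (x : Pt) (f : Fin 3 → Biform) (a b : Fin 4) :
    biF e x (∑ i, f i) a b = ∑ i, biF e x (f i) a b := by
  simp [Fin.sum_univ_three, biF_add]

lemma biF_combination_antisymm (h : IsOrthoFrame g U e lorentzSign) (hx : x ∈ U) (z : Fin 3 → ℂ)
    (a b : Fin 4) : biF e x (∑ j, z j • frameBivector g e j x) a b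
      = - biF e x (∑ j, z j • frameBivector g e j x) b a := by
  rw [biF_sum, biF_sum, ← Finset.sum_neg_distrib]
  exact Finset.sum_congr rfl fun j _ =>
    biF_smul_antisymm (biF_frameBivector_antisymm h hx j) (z j) a b

/-- The self-dual part of a 2-form, in the basis of the principal bivectors. -/
lemma selfDual_part (h : IsOrthoFrame g U e lorentzSign) (hx : x ∈ U) {B : Biform}
    (hB : ∀ a b, biF e x B a b = - biF e x B b a) :
    (1 / 2 : ℂ) • (B - Complex.I • hodge g x B) = ∑ j, (((Real.sqrt 2 : ℝ) : ℂ)⁻¹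
      * (- biF e x B 0 j.succ + unitJ g e x * biF e x B (fstIdx j) (sndIdx j)))
        • frameBivector g e j x := by
  have hJ := unitJ_sq h hx
  have h2 := inv_sqrt_two_sq
  refine biform_ext_lorentz h hx (biF_smul_antisymm (biF_sub_antisymm hB
    (biF_smul_antisymm (h.biF_hodge_antisymm hx _) _)) _)
    (biF_combination_antisymm h hx _) ?_ ?_
  · intro i
    simp only [biF_smul, biF_sub, biF_sum, biF_frameBivector_zero h hx,
      biF_hodge_zero h hx hB]
    simp only [mul_ite, mul_zero, Finset.sum_ite_eq', Finset.mem_univ, if_true]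
    rw [unitJ]
    linear_combination (-(biF e x B 0 i.succ) + (orient g e x : ℂ) * Complex.I
      * biF e x B (fstIdx i) (sndIdx i)) * h2
  · intro i
    simp only [biF_smul, biF_sub, biF_sum, biF_frameBivector_spatial h hx,
      biF_hodge_spatial h hx hB]
    simp only [mul_ite, mul_zero, Finset.sum_ite_eq', Finset.mem_univ, if_true]
    have hI : Complex.I * (orient g e x : ℂ) = unitJ g e x := by rw [unitJ, mul_comm]
    linear_combination (-(biF e x B 0 i.succ) + unitJ g e x * biF e x B (fstIdx i) (sndIdx i))
      * unitJ g e x * h2 + (1 / 2) * biF e x B 0 i.succ * hI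
      + (1 / 2) * biF e x B (fstIdx i) (sndIdx i) * hJ

/-- The matrix of the self-dual curvature in the basis of the principal bivectors. -/
def sdCurv (g : MetricField) (e : FrameField) (x : Pt) (j i : Fin 3) : ℂ :=
  (1 / 2) * (-(riemF g e x 0 j.succ 0 i.succ : ℂ)
    + unitJ g e x * (riemF g e x 0 j.succ (fstIdx i) (sndIdx i) : ℂ)
    + unitJ g e x * (riemF g e x (fstIdx j) (sndIdx j) 0 i.succ : ℂ)
    + (riemF g e x (fstIdx j) (sndIdx j) (fstIdx i) (sndIdx i) : ℂ))

lemma biF_weylContract_frameBivector (h : IsOrthoFrame g U e lorentzSign) (hx : x ∈ U)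
    (hv : ∀ a b, ricci g x a b = 0) (i : Fin 3) (a b : Fin 4) :
    biF e x (weylContract g x (frameBivector g e i x)) a b = ((Real.sqrt 2 : ℝ) : ℂ)⁻¹
      * ((riemF g e x a b 0 i.succ : ℂ)
        - unitJ g e x * (riemF g e x a b (fstIdx i) (sndIdx i) : ℂ)) := by
  rw [h.biF_weylContract hx]
  simp only [h.weylF_eq_riemF hx hv]
  rw [frameBivector_eq h hx]
  simp only [biF_smul, biF_sub, h.biF_wedgeL hx, Fin.sum_univ_four]
  have hr := fun c d => (IsOrthoFrame.riemF_antisymm_right (g := g) (e := e) (x := x) a b c d)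
  fin_cases i <;> simp [fstIdx, sndIdx]
  · rw [hr 1 0, hr 3 2]; push_cast; ring
  · rw [hr 2 0, hr 1 3]; push_cast; ring
  · rw [hr 3 0, hr 2 1]; push_cast; ring

lemma weylMap_frameBivector (h : IsOrthoFrame g U e lorentzSign) (hU : IsOpen U) (hx : x ∈ U)
    (hv : ∀ a b, ricci g x a b = 0) (i : Fin 3) :
    weylMap g x (frameBivector g e i x) = ∑ j, sdCurv g e x j i • frameBivector g e j x := by
  have hJ := unitJ_sq h hx
  have h2 := inv_sqrt_two_sq
  rw [weylMap_eq, selfDual_part h hx]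
  · refine Finset.sum_congr rfl fun j _ => ?_
    congr 1
    rw [biF_weylContract_frameBivector h hx hv, biF_weylContract_frameBivector h hx hv, sdCurv]
    linear_combination
      (-((riemF g e x 0 j.succ 0 i.succ : ℂ)
        - unitJ g e x * (riemF g e x 0 j.succ (fstIdx i) (sndIdx i) : ℂ))
      + unitJ g e x * ((riemF g e x (fstIdx j) (sndIdx j) 0 i.succ : ℂ)
        - unitJ g e x * (riemF g e x (fstIdx j) (sndIdx j) (fstIdx i) (sndIdx i) : ℂ))) * h2
      - (1 / 2) * (riemF g e x (fstIdx j) (sndIdx j) (fstIdx i) (sndIdx i) : ℂ) * hJ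
  · intro a b
    rw [biF_weylContract_frameBivector h hx hv, biF_weylContract_frameBivector h hx hv,
      h.riemF_antisymm_left hU hx, h.riemF_antisymm_left hU hx a b]
    push_cast
    ring

lemma combination_eq_iff (h : IsOrthoFrame g U e lorentzSign) (hx : x ∈ U) (z w : Fin 3 → ℂ) :
    ∑ j, z j • frameBivector g e j x = ∑ j, w j • frameBivector g e j x ↔ z = w := by
  refine ⟨fun H => ?_, fun H => by rw [H]⟩
  ext i
  have := congrArg (fun B => biF e x B 0 i.succ) H
  simp only [biF_sum, biF_smul, biF_frameBivector_zero h hx] at this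
  simp only [mul_ite, mul_zero, Finset.sum_ite_eq', Finset.mem_univ, if_true] at this
  exact mul_right_cancel₀ (neg_ne_zero.mpr inv_sqrt_two_ne) this

lemma frameBivector_eq_sum (i : Fin 3) (z : ℂ) :
    z • frameBivector g e i x = ∑ j, (if j = i then z else 0) • frameBivector g e j x := by
  simp [ite_smul]

/-- The 𝒰_j are linearly independent, so the eigenvector equation says that the i-th column of the
self-dual curvature matrix is diagonal. -/
lemma eigen_iff (h : IsOrthoFrame g U e lorentzSign) (hU : IsOpen U) (hx : x ∈ U)
    (hv : ∀ a b, ricci g x a b = 0) (i : Fin 3) (z : ℂ) :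
    weylMap g x (frameBivector g e i x) = z • frameBivector g e i x ↔
      ∀ j, sdCurv g e x j i = if j = i then z else 0 := by
  rw [weylMap_frameBivector h hU hx hv, frameBivector_eq_sum, combination_eq_iff h hx,
    funext_iff]

end Lorentz

/-! ### Curvature of a vacuum metric in a principal frame -/

/-- In vacuum the double dual of R is −R, equivalently its left and right duals agree. In components
these are linear consequences of the ten Ricci equations and the pair symmetries. -/
lemma vacuum_duality {R : Fin 4 → Fin 4 → Fin 4 → Fin 4 → ℝ}
    (h1 : ∀ a b c d, R a b c d = - R b a c d) (h2 : ∀ a b c d, R a b c d = - R a b d c)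
    (h3 : ∀ a b c d, R a b c d = R c d a b)
    (h4 : ∀ b d, ∑ a, lorentzSign a * R a b a d = 0) (j i : Fin 3) :
    R (fstIdx j) (sndIdx j) (fstIdx i) (sndIdx i) = - R 0 j.succ 0 i.succ ∧
      R (fstIdx j) (sndIdx j) 0 i.succ = R 0 j.succ (fstIdx i) (sndIdx i) := by
  have hz : ∀ a c d, R a a c d = 0 := fun a c d => by linarith [h1 a a c d]
  have hz' : ∀ a b c, R a b c c = 0 := fun a b c => by linarith [h2 a b c c]
  simp only [Fin.sum_univ_four, lorentzSign] at h4
  have h00 := h4 0 0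
  have h11 := h4 1 1
  have h22 := h4 2 2
  have h33 := h4 3 3
  have h01 := h4 0 1
  have h02 := h4 0 2
  have h03 := h4 0 3
  have h12 := h4 1 2
  have h13 := h4 1 3
  have h23 := h4 2 3
  simp [hz, hz'] at h00 h11 h22 h33 h01 h02 h03 h12 h13 h23
  clear h4
  fin_cases j <;> fin_cases i <;> simp [fstIdx, sndIdx] <;> constructor <;> grind

/-- The complex connection 1-forms `σ_i`, for a constant imaginary unit `J`. -/
def sigma (g : MetricField) (e : FrameField) (J : ℂ) (i : Fin 3) (q : Fin 4) (y : Pt) : ℂ :=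
  (connMat g e q y (fstIdx i) (sndIdx i) : ℂ) + J * (connMat g e q y 0 i.succ : ℂ)

lemma covDeriv_congr {g : MetricField} {U : Set Pt} (hU : IsOpen U) {B C : Pt → Biform}
    (H : ∀ y ∈ U, B y = C y) {x : Pt} (hx : x ∈ U) (c p q : Fin 4) :
    covDerivBiform g B x c p q = covDerivBiform g C x c p q := by
  rw [covDerivBiform, covDerivBiform, H x hx,
    pd_congr_of_eqOn hU (fun y hy => by rw [H y hy]) hx]

/-- By symmetry of the Christoffel symbols the connection terms cancel in pairs: antisymmetrizing ∇B
gives dB. -/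
lemma sum_cyclic_covDeriv {g : MetricField} {x : Pt}
    (hΓ : ∀ a b c, christoffel g x c a b = christoffel g x c b a)
    {B : Pt → Biform} (hB : ∀ p q, B x p q = - B x q p) (r p q : Fin 4) :
    covDerivBiform g B x r p q + covDerivBiform g B x p q r + covDerivBiform g B x q r p
      = pd r (fun y => B y p q) x + pd p (fun y => B y q r) x + pd q (fun y => B y r p) x := by
  have h1 : (∑ m, ((christoffel g x m r p : ℂ) * B x m q + (christoffel g x m r q : ℂ) * B x p m))
      + (∑ m, ((christoffel g x m p q : ℂ) * B x m r + (christoffel g x m p r : ℂ) * B x q m))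
      + (∑ m, ((christoffel g x m q r : ℂ) * B x m p + (christoffel g x m q p : ℂ) * B x r m))
      = 0 := by
    rw [← Finset.sum_add_distrib, ← Finset.sum_add_distrib]
    refine Finset.sum_eq_zero fun m _ => ?_
    rw [hΓ p r m, hΓ q p m, hΓ r q m, hB p m, hB q m, hB r m]
    ring
  simp only [covDerivBiform]
  linear_combination -h1

/-! ### Covariant derivatives of the principal bivectors. -/

section Connection

variable {g : MetricField} {U : Set Pt} {e : FrameField} {ε : Fin 4 → ℝ} {x : Pt}

lemma wedgeL_antisymm (a b p q : Fin 4) : wedgeL g e x a b p q = - wedgeL g e x a b q p := by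
  simp only [wedgeL, Matrix.of_apply]
  push_cast
  ring

lemma frameBivector_antisymm (h : IsOrthoFrame g U e lorentzSign) (hx : x ∈ U) (i : Fin 3)
    (p q : Fin 4) : frameBivector g e i x p q = - frameBivector g e i x q p := by
  rw [frameBivector_eq h hx]
  simp only [Matrix.smul_apply, Matrix.sub_apply, smul_eq_mul]
  rw [wedgeL_antisymm, wedgeL_antisymm _ _ p q]
  ring

lemma differentiableAt_lowerVec (h : IsOrthoFrame g U e ε) (hU : IsOpen U) (hx : x ∈ U)
    (a p : Fin 4) : DifferentiableAt ℝ (fun y => lowerVec g y (e a y) p) x :=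
  differentiableAt_of_smooth hU (h.smooth_coframe a p) hx

lemma differentiableAt_wedgeL (h : IsOrthoFrame g U e ε) (hU : IsOpen U) (hx : x ∈ U)
    (a b p q : Fin 4) : DifferentiableAt ℝ (fun y => wedgeL g e y a b p q) x := by
  have hd := differentiableAt_lowerVec h hU hx
  have h1 : DifferentiableAt ℝ (fun y => lowerVec g y (e a y) p * lowerVec g y (e b y) q
      - lowerVec g y (e b y) p * lowerVec g y (e a y) q) x :=
    ((hd a p).fun_mul (hd b q)).fun_sub ((hd b p).fun_mul (hd a q))
  exact Complex.ofRealCLM.differentiableAt.comp x h1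

lemma covDeriv_wedgeL (h : IsOrthoFrame g U e ε) (hU : IsOpen U) (hx : x ∈ U)
    (a b c p q : Fin 4) :
    covDerivBiform g (fun y => wedgeL g e y a b) x c p q
      = ∑ d, (ε d : ℂ) * ((connMat g e c x a d : ℂ) * wedgeL g e x d b p q
        + (connMat g e c x b d : ℂ) * wedgeL g e x a d p q) := by
  have hd := differentiableAt_lowerVec h hU hx
  have h1 : covDerivBiform g (fun y => wedgeL g e y a b) x c p q
      = (papapetrou g (e a) x c p : ℂ) * (lowerVec g x (e b x) q : ℂ)
        + (lowerVec g x (e a x) p : ℂ) * (papapetrou g (e b) x c q : ℂ)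
        - (papapetrou g (e b) x c p : ℂ) * (lowerVec g x (e a x) q : ℂ)
        - (lowerVec g x (e b x) p : ℂ) * (papapetrou g (e a) x c q : ℂ) := by
    have h2 : pd c (fun y => wedgeL g e y a b p q) x
        = (((pd c (fun y => lowerVec g y (e a y) p) x * lowerVec g x (e b x) q
          + lowerVec g x (e a x) p * pd c (fun y => lowerVec g y (e b y) q) x)
          - (pd c (fun y => lowerVec g y (e b y) p) x * lowerVec g x (e a x) q
          + lowerVec g x (e b x) p * pd c (fun y => lowerVec g y (e a y) q) x) : ℝ) : ℂ) := by
      rw [← pd_mul (hd a p) (hd b q), ← pd_mul (hd b p) (hd a q),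
        ← pd_sub ((hd a p).fun_mul (hd b q)) ((hd b p).fun_mul (hd a q)),
        ← pd_ofReal (((hd a p).fun_mul (hd b q)).fun_sub ((hd b p).fun_mul (hd a q)))]
      rfl
    rw [covDerivBiform, h2]
    simp only [wedgeL, papapetrou, Matrix.of_apply, Fin.sum_univ_four]
    push_cast
    ring
  rw [h1]
  simp only [h.papapetrou_frame hx, wedgeL, Matrix.of_apply, Fin.sum_univ_four]
  push_cast
  ring

/-- The combination ω_jk + J ω_0i identifies the Lorentz algebra with so(3,ℂ), under which the 𝒰_i
form an orthogonal triad; hence the cross-product form. Constancy of J on U lets it pass through the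
derivative. -/
lemma covDeriv_frameBivector (h : IsOrthoFrame g U e lorentzSign) (hU : IsOpen U) {J : ℂ}
    (hJ : ∀ y ∈ U, unitJ g e y = J) (hx : x ∈ U) (i : Fin 3) (c p q : Fin 4) :
    covDerivBiform g (frameBivector g e i) x c p q
      = sigma g e J (i + 2) c x * frameBivector g e (i + 1) x p q
        - sigma g e J (i + 1) c x * frameBivector g e (i + 2) x p q := by
  have hJ2 : J * J = -1 := by rw [← hJ x hx]; exact unitJ_sq h hx
  have h1 : covDerivBiform g (frameBivector g e i) x c p q
      = ((Real.sqrt 2 : ℝ) : ℂ)⁻¹ *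
        (covDerivBiform g (fun y => wedgeL g e y 0 i.succ) x c p q
        - J * covDerivBiform g (fun y => wedgeL g e y (fstIdx i) (sndIdx i)) x c p q) := by
    rw [covDeriv_congr (C := fun y => ((Real.sqrt 2 : ℝ) : ℂ)⁻¹ • (wedgeL g e y 0 i.succ
      - J • wedgeL g e y (fstIdx i) (sndIdx i))) hU
      (fun y hy => by rw [frameBivector_eq h hy, hJ y hy]) hx]
    have hd := differentiableAt_wedgeL h hU hx
    have h2 : pd c (fun y => (((Real.sqrt 2 : ℝ) : ℂ)⁻¹ • (wedgeL g e y 0 i.succ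
        - J • wedgeL g e y (fstIdx i) (sndIdx i))) p q) x
        = ((Real.sqrt 2 : ℝ) : ℂ)⁻¹ * (pd c (fun y => wedgeL g e y 0 i.succ p q) x
        - J * pd c (fun y => wedgeL g e y (fstIdx i) (sndIdx i) p q) x) := by
      rw [← pd_const_mul J (hd _ _ p q), ← pd_sub (hd _ _ _ _) ((hd _ _ _ _).const_mul J),
        ← pd_const_mul _ ((hd _ _ _ _).fun_sub ((hd _ _ _ _).const_mul J))]
      rfl
    rw [covDerivBiform, h2]
    simp only [covDerivBiform, Matrix.smul_apply, Matrix.sub_apply, smul_eq_mul,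
      Fin.sum_univ_four]
    ring
  have h10 := h.conn_antisymm hU hx c 1 0
  have h20 := h.conn_antisymm hU hx c 2 0
  have h30 := h.conn_antisymm hU hx c 3 0
  have h21 := h.conn_antisymm hU hx c 2 1
  have h13 := h.conn_antisymm hU hx c 1 3
  have h32 := h.conn_antisymm hU hx c 3 2
  have hz := h.conn_diag hU hx c
  rw [h1, covDeriv_wedgeL h hU hx, covDeriv_wedgeL h hU hx, frameBivector_eq h hx,
    frameBivector_eq h hx, hJ x hx]
  simp only [Matrix.smul_apply, Matrix.sub_apply, smul_eq_mul, Fin.sum_univ_four, sigma]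
  fin_cases i <;> simp [fstIdx, sndIdx, h10, h20, h30, h21, h13, h32, hz, wedgeL]
  -- The two sides differ only in boost terms multiplied by J², so J² = −1 closes each of the three
  -- cases.
  · linear_combination ((Real.sqrt 2 : ℝ) : ℂ)⁻¹ * ((connMat g e c x 0 2 : ℂ) * ((lowerVec g x (e 2 x) p : ℂ) * (lowerVec g x (e 1 x) q : ℂ)
      - (lowerVec g x (e 1 x) p : ℂ) * (lowerVec g x (e 2 x) q : ℂ))
      + (connMat g e c x 0 3 : ℂ) * ((lowerVec g x (e 3 x) p : ℂ) * (lowerVec g x (e 1 x) q : ℂ)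
      - (lowerVec g x (e 1 x) p : ℂ) * (lowerVec g x (e 3 x) q : ℂ))) * hJ2
  · linear_combination ((Real.sqrt 2 : ℝ) : ℂ)⁻¹ * ((connMat g e c x 0 1 : ℂ) * ((lowerVec g x (e 1 x) p : ℂ) * (lowerVec g x (e 2 x) q : ℂ)
      - (lowerVec g x (e 2 x) p : ℂ) * (lowerVec g x (e 1 x) q : ℂ))
      + (connMat g e c x 0 3 : ℂ) * ((lowerVec g x (e 3 x) p : ℂ) * (lowerVec g x (e 2 x) q : ℂ)
      - (lowerVec g x (e 2 x) p : ℂ) * (lowerVec g x (e 3 x) q : ℂ))) * hJ2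
  · linear_combination ((Real.sqrt 2 : ℝ) : ℂ)⁻¹ * ((connMat g e c x 0 1 : ℂ) * ((lowerVec g x (e 1 x) p : ℂ) * (lowerVec g x (e 3 x) q : ℂ)
      - (lowerVec g x (e 3 x) p : ℂ) * (lowerVec g x (e 1 x) q : ℂ))
      + (connMat g e c x 0 2 : ℂ) * ((lowerVec g x (e 2 x) p : ℂ) * (lowerVec g x (e 3 x) q : ℂ)
      - (lowerVec g x (e 3 x) p : ℂ) * (lowerVec g x (e 2 x) q : ℂ))) * hJ2

end Connection

lemma sqrt_two_ne : ((Real.sqrt 2 : ℝ) : ℂ) ≠ 0 := fun h => inv_sqrt_two_ne (by rw [h, inv_zero])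

/-! ### Complex structure equations and the Bianchi identity. -/

section Structure

variable {g : MetricField} {U : Set Pt} {e : FrameField} {x : Pt} {J : ℂ} {α : Fin 3 → Pt → ℂ}

/-- Double duality makes the four terms of `sdCurv` agree in pairs, leaving the electric and
magnetic parts of the curvature. -/
lemma sdCurv_vacuum (h : IsOrthoFrame g U e lorentzSign) (hU : IsOpen U) (hx : x ∈ U)
    (hv : ∀ a b, ricci g x a b = 0) (j i : Fin 3) :
    sdCurv g e x j i = -(riemF g e x 0 j.succ 0 i.succ : ℂ)
      + unitJ g e x * (riemF g e x 0 j.succ (fstIdx i) (sndIdx i) : ℂ) := by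
  obtain ⟨h1, h2⟩ := vacuum_duality (h.riemF_antisymm_left hU hx)
    IsOrthoFrame.riemF_antisymm_right (h.riemF_pair_symm hU hx)
    ((h.ricci_eq_zero_iff hx).mp hv) j i
  rw [sdCurv, h1, h2]
  push_cast
  ring

lemma differentiableAt_sigma (h : IsOrthoFrame g U e lorentzSign) (hU : IsOpen U) (hx : x ∈ U)
    (i : Fin 3) (q : Fin 4) : DifferentiableAt ℝ (sigma g e J i q) x := by
  have hd := fun a b => differentiableAt_of_smooth hU (h.smooth_conn hU q a b) hx
  exact (Complex.ofRealCLM.differentiableAt.comp x (hd _ _)).add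
    ((Complex.ofRealCLM.differentiableAt.comp x (hd _ _)).const_mul J)

lemma contDiffOn_sigma (h : IsOrthoFrame g U e lorentzSign) (hU : IsOpen U)
    (i : Fin 3) (q : Fin 4) : ContDiffOn ℝ ∞ (sigma g e J i q) U := by
  have hd := fun a b => h.smooth_conn hU q a b
  exact (Complex.ofRealCLM.contDiff.comp_contDiffOn (hd _ _)).add
    (contDiffOn_const.mul (Complex.ofRealCLM.contDiff.comp_contDiffOn (hd _ _)))

lemma pd_sigma (h : IsOrthoFrame g U e lorentzSign) (hU : IsOpen U) (hx : x ∈ U)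
    (i : Fin 3) (p q : Fin 4) : pd p (sigma g e J i q) x
      = (pd p (fun y => connMat g e q y (fstIdx i) (sndIdx i)) x : ℝ)
        + J * (pd p (fun y => connMat g e q y 0 i.succ) x : ℝ) := by
  have hd := fun a b => differentiableAt_of_smooth hU (h.smooth_conn hU q a b) hx
  have hc : ∀ a b, DifferentiableAt ℝ (fun y => (connMat g e q y a b : ℂ)) x := fun a b =>
    Complex.ofRealCLM.differentiableAt.comp x (hd a b)
  rw [← pd_ofReal (hd _ _), ← pd_ofReal (hd _ _), ← pd_const_mul J (hc _ _),
    ← pd_add (hc _ _) ((hc _ _).const_mul J)]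
  rfl

/-- The curvature 2-forms `R_{jk} + J R_{0i}`, with coordinate form indices. -/
def sdRiemann (g : MetricField) (e : FrameField) (J : ℂ) (i : Fin 3) (x : Pt) : Biform :=
  Matrix.of fun p q =>
    ((coframeMat g e x * riemannMat g p q x * (frameMat e x).transpose) (fstIdx i) (sndIdx i) : ℂ)
    + J * ((coframeMat g e x * riemannMat g p q x * (frameMat e x).transpose) 0 i.succ : ℂ)

lemma biF_sdRiemann (i : Fin 3) (a b : Fin 4) : biF e x (sdRiemann g e J i x) a b
    = (riemF g e x (fstIdx i) (sndIdx i) a b : ℂ) + J * (riemF g e x 0 i.succ a b : ℂ) := by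
  simp only [biF, sdRiemann, riemF, Matrix.of_apply]
  push_cast
  simp only [Finset.mul_sum, ← Finset.sum_add_distrib]
  exact Finset.sum_congr rfl fun p _ => Finset.sum_congr rfl fun q _ => by ring

/-- The real structure equations combine into those of an so(3,ℂ) connection: the products ω_0j ∧
ω_0k enter with the sign supplied by J² = −1. -/
lemma sdRiemann_eq_structure (h : IsOrthoFrame g U e lorentzSign) (hU : IsOpen U)
    (hJ : ∀ y ∈ U, unitJ g e y = J) (hx : x ∈ U) (i : Fin 3) (p q : Fin 4) :
    sdRiemann g e J i x p q = -(pd p (sigma g e J i q) x - pd q (sigma g e J i p) x)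
      - (sigma g e J (i + 1) p x * sigma g e J (i + 2) q x
        - sigma g e J (i + 1) q x * sigma g e J (i + 2) p x) := by
  have hJ2 : J * J = -1 := by rw [← hJ x hx]; exact unitJ_sq h hx
  have h10 := fun c => h.conn_antisymm hU hx c 1 0
  have h20 := fun c => h.conn_antisymm hU hx c 2 0
  have h30 := fun c => h.conn_antisymm hU hx c 3 0
  have h21 := fun c => h.conn_antisymm hU hx c 2 1
  have h13 := fun c => h.conn_antisymm hU hx c 1 3
  have h32 := fun c => h.conn_antisymm hU hx c 3 2
  have hz := fun c => h.conn_diag hU hx c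
  simp only [sdRiemann, Matrix.of_apply, h.coframe_riemann_frame hU hx, pd_sigma h hU hx,
    Fin.sum_univ_four, sigma]
  fin_cases i <;> simp [fstIdx, sndIdx, h10, h20, h30, h21, h13, h32, hz]
  · linear_combination ((connMat g e p x 0 2 : ℂ) * (connMat g e q x 0 3 : ℂ)
      - (connMat g e q x 0 2 : ℂ) * (connMat g e p x 0 3 : ℂ)) * hJ2
  · linear_combination ((connMat g e p x 0 3 : ℂ) * (connMat g e q x 0 1 : ℂ)
      - (connMat g e q x 0 3 : ℂ) * (connMat g e p x 0 1 : ℂ)) * hJ2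
  · linear_combination ((connMat g e p x 0 1 : ℂ) * (connMat g e q x 0 2 : ℂ)
      - (connMat g e q x 0 1 : ℂ) * (connMat g e p x 0 2 : ℂ)) * hJ2

/-- By pair symmetry the electric components of the i-th curvature form are −J times the i-th column
of `sdCurv`, which is diagonal, and vacuum duality fixes the magnetic components. The factor √2
undoes the normalization of 𝒰_i. -/
lemma sdRiemann_eq_eigen (h : IsOrthoFrame g U e lorentzSign) (hU : IsOpen U)
    (hJ : ∀ y ∈ U, unitJ g e y = J) (hx : x ∈ U) (hv : ∀ a b, ricci g x a b = 0) (i : Fin 3)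
    {z : ℂ} (heig : weylMap g x (frameBivector g e i x) = z • frameBivector g e i x) :
    sdRiemann g e J i x = (((Real.sqrt 2 : ℝ) : ℂ) * J * z) • frameBivector g e i x := by
  have hJx := hJ x hx
  have hJ2 : J * J = -1 := by rw [← hJx]; exact unitJ_sq h hx
  have hs : ((Real.sqrt 2 : ℝ) : ℂ) * ((Real.sqrt 2 : ℝ) : ℂ)⁻¹ = 1 :=
    mul_inv_cancel₀ sqrt_two_ne
  have hsd := (eigen_iff h hU hx hv i z).mp heig
  have hps := h.riemF_pair_symm hU hx
  refine biform_ext_lorentz h hx ?_ (biF_smul_antisymm (biF_frameBivector_antisymm h hx i) _) ?_ ?_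
  · intro a b
    rw [biF_sdRiemann, biF_sdRiemann, IsOrthoFrame.riemF_antisymm_right,
      IsOrthoFrame.riemF_antisymm_right 0]
    push_cast
    ring
  · intro j
    have hj := hsd j
    rw [sdCurv_vacuum h hU hx hv, hJx] at hj
    rw [biF_sdRiemann, biF_smul, biF_frameBivector_zero h hx, hps (fstIdx i), hps 0 i.succ]
    by_cases hij : j = i
    · subst hij
      simp only [if_true] at hj ⊢
      linear_combination (-J) * hj + (riemF g e x 0 j.succ (fstIdx j) (sndIdx j) : ℂ) * hJ2
        + J * z * hs
    · rw [if_neg hij] at hj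
      rw [if_neg (Ne.symm hij)]
      linear_combination (-J) * hj + (riemF g e x 0 j.succ (fstIdx i) (sndIdx i) : ℂ) * hJ2
  · intro j
    have hj := hsd j
    rw [sdCurv_vacuum h hU hx hv, hJx] at hj
    obtain ⟨h1, h2⟩ := vacuum_duality (h.riemF_antisymm_left hU hx)
      IsOrthoFrame.riemF_antisymm_right hps ((h.ricci_eq_zero_iff hx).mp hv) i j
    rw [biF_sdRiemann, biF_smul, biF_frameBivector_spatial h hx, h1, ← h2, hps (fstIdx i),
      hps 0 i.succ, hJx]
    push_cast
    by_cases hij : j = i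
    · subst hij
      simp only [if_true] at hj ⊢
      linear_combination hj + J * J * z * hs + z * hJ2
    · rw [if_neg hij] at hj
      rw [if_neg (Ne.symm hij)]
      linear_combination hj

lemma structure_eq (h : IsOrthoFrame g U e lorentzSign) (hU : IsOpen U)
    (hJ : ∀ y ∈ U, unitJ g e y = J) (hv : IsVacuum g U)
    (heig : ∀ y ∈ U, ∀ i, weylMap g y (frameBivector g e i y) = α i y • frameBivector g e i y)
    (hx : x ∈ U) (i : Fin 3) (p q : Fin 4) :
    pd p (sigma g e J i q) x - pd q (sigma g e J i p) x
      = -(((Real.sqrt 2 : ℝ) : ℂ) * J) * (α i x * frameBivector g e i x p q)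
      - (sigma g e J (i + 1) p x * sigma g e J (i + 2) q x
        - sigma g e J (i + 1) q x * sigma g e J (i + 2) p x) := by
  have h1 := sdRiemann_eq_structure h hU hJ hx i p q
  rw [sdRiemann_eq_eigen h hU hJ hx (hv x hx) i (heig x hx i)] at h1
  simp only [Matrix.smul_apply, smul_eq_mul] at h1
  linear_combination h1

lemma differentiableAt_frameBivector (h : IsOrthoFrame g U e lorentzSign) (hU : IsOpen U)
    (hJ : ∀ y ∈ U, unitJ g e y = J) (hx : x ∈ U) (i : Fin 3) (p q : Fin 4) :
    DifferentiableAt ℝ (fun y => frameBivector g e i y p q) x := by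
  have hd := differentiableAt_wedgeL h hU hx
  have h1 : DifferentiableAt ℝ (fun y => ((Real.sqrt 2 : ℝ) : ℂ)⁻¹ * (wedgeL g e y 0 i.succ p q
      - J * wedgeL g e y (fstIdx i) (sndIdx i) p q)) x :=
    ((hd _ _ p q).fun_sub ((hd _ _ p q).const_mul J)).const_mul _
  refine h1.congr_of_eventuallyEq (Filter.eventually_of_mem (hU.mem_nhds hx) fun y hy => ?_)
  change frameBivector g e i y p q = _
  rw [frameBivector_eq h hy, hJ y hy]
  rfl

/-- The Bianchi identity for the first eigenvalue. -/
lemma bianchi (h : IsOrthoFrame g U e lorentzSign) (hU : IsOpen U)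
    (hJ : ∀ y ∈ U, unitJ g e y = J) (hv : IsVacuum g U)
    (hα : ∀ i, ContDiffOn ℝ ∞ (α i) U)
    (heig : ∀ y ∈ U, ∀ i, weylMap g y (frameBivector g e i y) = α i y • frameBivector g e i y)
    (hx : x ∈ U) (r p q : Fin 4) :
    (pd r (α 0) x * frameBivector g e 0 x p q + pd p (α 0) x * frameBivector g e 0 x q r
      + pd q (α 0) x * frameBivector g e 0 x r p)
    = (α 1 x - α 0 x) * (sigma g e J 2 r x * frameBivector g e 1 x p q
        + sigma g e J 2 p x * frameBivector g e 1 x q r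
        + sigma g e J 2 q x * frameBivector g e 1 x r p)
      - (α 2 x - α 0 x) * (sigma g e J 1 r x * frameBivector g e 2 x p q
        + sigma g e J 1 p x * frameBivector g e 2 x q r
        + sigma g e J 1 q x * frameBivector g e 2 x r p) := by
  have hJ2 : J * J = -1 := by rw [← hJ x hx]; exact unitJ_sq h hx
  have hJ0 : J ≠ 0 := by
    rintro rfl
    norm_num at hJ2
  have hst := fun (i : Fin 3) (p q : Fin 4) => structure_eq h hU hJ hv heig hx i p q
  have hds := fun i q => differentiableAt_sigma (J := J) h hU hx i q
  have hdb := fun i p q => differentiableAt_frameBivector h hU hJ hx i p q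
  have hda := fun i => differentiableAt_of_smooth hU (hα i) hx
  have hpd : ∀ r p q, pd r (fun y => pd p (sigma g e J 0 q) y - pd q (sigma g e J 0 p) y) x
      = -(((Real.sqrt 2 : ℝ) : ℂ) * J) * (pd r (α 0) x * frameBivector g e 0 x p q
          + α 0 x * pd r (fun y => frameBivector g e 0 y p q) x)
        - ((pd r (sigma g e J 1 p) x * sigma g e J 2 q x
          + sigma g e J 1 p x * pd r (sigma g e J 2 q) x)
          - (pd r (sigma g e J 1 q) x * sigma g e J 2 p x
          + sigma g e J 1 q x * pd r (sigma g e J 2 p) x)) := by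
    intro r p q
    rw [pd_congr_of_eqOn hU (fun y hy => structure_eq h hU hJ hv heig hy 0 p q) hx]
    simp only [zero_add]
    rw [pd_sub ((((hda 0).fun_mul (hdb 0 p q)).const_mul _))
        (((hds 1 p).fun_mul (hds 2 q)).fun_sub ((hds 1 q).fun_mul (hds 2 p))),
      pd_const_mul _ ((hda 0).fun_mul (hdb 0 p q)), pd_mul (hda 0) (hdb 0 p q),
      pd_sub ((hds 1 p).fun_mul (hds 2 q)) ((hds 1 q).fun_mul (hds 2 p)),
      pd_mul (hds 1 p) (hds 2 q), pd_mul (hds 1 q) (hds 2 p)]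
  have hcyc := pd_cyclic_exterior hU (fun a => contDiffOn_sigma (J := J) h hU 0 a) hx r p q
  rw [hpd, hpd, hpd] at hcyc
  have hdU := sum_cyclic_covDeriv (B := frameBivector g e 0)
    (fun a b c => h.christoffel_symm hU hx a b c) (frameBivector_antisymm h hx 0) r p q
  rw [covDeriv_frameBivector h hU hJ hx, covDeriv_frameBivector h hU hJ hx,
    covDeriv_frameBivector h hU hJ hx] at hdU
  simp only [zero_add] at hdU
  have s1 := fun p q => hst 1 p q
  have s2 := fun p q => hst 2 p q
  simp only [show (1 : Fin 3) + 1 = 2 from rfl, show (1 : Fin 3) + 2 = 0 from rfl] at s1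
  simp only [show (2 : Fin 3) + 1 = 0 from rfl, show (2 : Fin 3) + 2 = 1 from rfl] at s2
  apply mul_left_cancel₀ (mul_ne_zero sqrt_two_ne hJ0)
  -- In d²σ_0 = 0 substitute dσ_1 and dσ_2 from the structure equations and d𝒰_0 from the covariant
  -- derivative. The terms cubic in σ cancel, and the eigenvalues survive only through the
  -- differences α_1 − α_0 and α_2 − α_0.
  linear_combination -hcyc + ((Real.sqrt 2 : ℝ) : ℂ) * J * α 0 x * hdU
    - sigma g e J 2 q x * s1 r p - sigma g e J 2 r x * s1 p q - sigma g e J 2 p x * s1 q r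
    + sigma g e J 1 q x * s2 r p + sigma g e J 1 r x * s2 p q + sigma g e J 1 p x * s2 q r

end Structure

/-! ### Frame components of 1-forms -/

/-- Frame components of a complex 1-form. -/
def formF (e : FrameField) (x : Pt) (u : Fin 4 → ℂ) (a : Fin 4) : ℂ := ∑ p, (e a x p : ℂ) * u p

/-- The frame components of `J`-complexified connection 1-forms. -/
def sigmaF (g : MetricField) (e : FrameField) (J : ℂ) (x : Pt) (i : Fin 3) (a : Fin 4) : ℂ :=
  (connF g e x a (fstIdx i) (sndIdx i) : ℂ) + J * (connF g e x a 0 i.succ : ℂ)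

/-- The image of a 1-form with frame components `S` under the `i`-th principal bivector,
up to a constant factor. -/
def dualForm (J : ℂ) (i : Fin 3) (S : Fin 4 → ℂ) : Fin 4 → ℂ := fun a =>
  if a = 0 then - J * S i.succ else if a = i.succ then - J * S 0
    else if a = fstIdx i then S (sndIdx i) else - S (fstIdx i)

lemma formF_sigma (g : MetricField) (e : FrameField) (J : ℂ) (x : Pt) (i : Fin 3) (a : Fin 4) :
    formF e x (fun q => sigma g e J i q x) a = sigmaF g e J x i a := by
  simp only [formF, sigma, sigmaF, connF, mul_add, Finset.sum_add_distrib]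
  push_cast
  rw [Finset.mul_sum]
  congr 1
  exact Finset.sum_congr rfl fun p _ => by ring

lemma wedge_contract (e : FrameField) (x : Pt) (u : Fin 4 → ℂ) (B : Biform) (a b c : Fin 4) :
    ∑ r, ∑ p, ∑ q, (e a x r : ℂ) * (e b x p : ℂ) * (e c x q : ℂ)
      * (u r * B p q + u p * B q r + u q * B r p)
      = formF e x u a * biF e x B b c + formF e x u b * biF e x B c a
        + formF e x u c * biF e x B a b := by
  have h1 : ∀ a b c : Fin 4, formF e x u a * biF e x B b c
      = ∑ r, ∑ p, ∑ q, (e a x r : ℂ) * u r * ((e b x p : ℂ) * (e c x q : ℂ) * B p q) := by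
    intro a b c
    simp only [formF, biF, Finset.sum_mul, Finset.mul_sum]
    rw [Finset.sum_comm_cycle]
  have h2 : formF e x u b * biF e x B c a
      = ∑ r, ∑ p, ∑ q, (e b x p : ℂ) * u p * ((e c x q : ℂ) * (e a x r : ℂ) * B q r) := by
    rw [h1, Finset.sum_comm_cycle]
  have h3 : formF e x u c * biF e x B a b
      = ∑ r, ∑ p, ∑ q, (e c x q : ℂ) * u q * ((e a x r : ℂ) * (e b x p : ℂ) * B r p) := by
    rw [h1, ← Finset.sum_comm_cycle]
  rw [h1, h2, h3]
  simp only [← Finset.sum_add_distrib]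
  refine Finset.sum_congr rfl fun r _ => Finset.sum_congr rfl fun p _ =>
    Finset.sum_congr rfl fun q _ => by ring

/-! ### The forms λ_i in terms of the connection. -/

section Frame

variable {g : MetricField} {U : Set Pt} {e : FrameField} {x : Pt} {J : ℂ} {α : Fin 3 → Pt → ℂ}
  {ε : Fin 4 → ℝ}

lemma formF_applyForm (h : IsOrthoFrame g U e ε) (hx : x ∈ U) (B : Biform) (w : Fin 4 → ℂ)
    (a : Fin 4) : formF e x (applyForm g x B w) a
      = ∑ b, (ε b : ℂ) * biF e x B a b * formF e x w b := by
  have h1 : ∀ b, (ε b : ℂ) * biF e x B a b * formF e x w b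
      = ∑ p, ∑ q, ∑ r, (ε b : ℂ) * (e a x p : ℂ) * (e b x q : ℂ) * (e b x r : ℂ)
        * B p q * w r := by
    intro b
    simp only [formF, biF, Finset.mul_sum, Finset.sum_mul]
    rw [Finset.sum_comm]
    refine Finset.sum_congr rfl fun p _ => ?_
    rw [Finset.sum_comm]
    exact Finset.sum_congr rfl fun q _ => Finset.sum_congr rfl fun r _ => by ring
  rw [Finset.sum_congr rfl fun b _ => h1 b]
  simp only [formF, applyForm, h.inv_apply hx]
  push_cast
  simp only [Finset.mul_sum, Finset.sum_mul]
  symm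
  rw [Finset.sum_comm]
  refine Finset.sum_congr rfl fun p _ => ?_
  rw [Finset.sum_comm]
  refine Finset.sum_congr rfl fun q _ => ?_
  rw [Finset.sum_comm]
  exact Finset.sum_congr rfl fun r _ => Finset.sum_congr rfl fun b _ => by ring

lemma formF_divBiform (h : IsOrthoFrame g U e ε) (hx : x ∈ U) (B : Pt → Biform) (b : Fin 4) :
    formF e x (divBiform g B x) b = ∑ a, (ε a : ℂ) * ∑ c, (e a x c : ℂ) *
      biF e x (Matrix.of fun p q => covDerivBiform g B x c p q) a b := by
  simp only [formF, divBiform, h.inv_apply hx, biF, Matrix.of_apply]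
  push_cast
  simp only [Finset.mul_sum, Finset.sum_mul]
  symm
  rw [Finset.sum_congr rfl fun a _ => Finset.sum_comm_cycle, Finset.sum_comm]
  refine Finset.sum_congr rfl fun q _ => ?_
  rw [Finset.sum_comm]
  refine Finset.sum_congr rfl fun c _ => ?_
  rw [Finset.sum_comm]
  exact Finset.sum_congr rfl fun p _ => Finset.sum_congr rfl fun a _ => by ring

lemma formF_div_frameBivector (h : IsOrthoFrame g U e lorentzSign) (hU : IsOpen U)
    (hJ : ∀ y ∈ U, unitJ g e y = J) (hx : x ∈ U) (i : Fin 3) (b : Fin 4) :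
    formF e x (divBiform g (frameBivector g e i) x) b = ∑ a, (lorentzSign a : ℂ) *
      (sigmaF g e J x (i + 2) a * biF e x (frameBivector g e (i + 1) x) a b
        - sigmaF g e J x (i + 1) a * biF e x (frameBivector g e (i + 2) x) a b) := by
  rw [formF_divBiform h hx]
  refine Finset.sum_congr rfl fun a _ => ?_
  congr 1
  have h1 : ∀ c, (Matrix.of fun p q => covDerivBiform g (frameBivector g e i) x c p q)
      = sigma g e J (i + 2) c x • frameBivector g e (i + 1) x
        - sigma g e J (i + 1) c x • frameBivector g e (i + 2) x := by
    intro c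
    ext p q
    simp [covDeriv_frameBivector h hU hJ hx]
  simp only [h1, biF_sub, biF_smul, ← formF_sigma, formF, Finset.sum_mul]
  rw [← Finset.sum_sub_distrib]
  exact Finset.sum_congr rfl fun c _ => by ring

/-- The divergence of 𝒰_i is a combination of 𝒰_{i+1}(σ_{i+2}) and 𝒰_{i+2}(σ_{i+1}). The bivectors
multiply like quaternions, so applying 𝒰_i leaves 𝒰_{i+2}(σ_{i+2}) and 𝒰_{i+1}(σ_{i+1}). -/
lemma formF_lambdaForm (h : IsOrthoFrame g U e lorentzSign) (hU : IsOpen U)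
    (hJ : ∀ y ∈ U, unitJ g e y = J) (hx : x ∈ U) (i : Fin 3) (a : Fin 4) :
    formF e x (lambdaForm g e i x) a = (1 / 2) *
      (dualForm J (i + 1) (sigmaF g e J x (i + 1)) a
        + dualForm J (i + 2) (sigmaF g e J x (i + 2)) a) := by
  have hJ2 : J * J = -1 := by rw [← hJ x hx]; exact unitJ_sq h hx
  have h2 := inv_sqrt_two_sq
  have h0 : formF e x (lambdaForm g e i x) a
      = - formF e x (applyForm g x (frameBivector g e i x)
        (divBiform g (frameBivector g e i) x)) a := by
    simp only [formF, lambdaForm, mul_neg, Finset.sum_neg_distrib]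
  rw [h0, formF_applyForm h hx]
  simp only [formF_div_frameBivector h hU hJ hx, frameBivector_eq h hx, biF_smul, biF_sub,
    h.biF_wedgeL hx, Fin.sum_univ_four, hJ x hx]
  set S1 := sigmaF g e J x (i + 1)
  set S2 := sigmaF g e J x (i + 2)
  set w : ℂ := ((Real.sqrt 2 : ℝ) : ℂ)⁻¹
  fin_cases i <;> fin_cases a <;> simp [fstIdx, sndIdx, dualForm]
  all_goals grind

end Frame

/-- The involution of the frame indices induced by the `i`-th principal bivector. -/
def muIdx (i : Fin 3) (a : Fin 4) : Fin 4 :=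
  if a = 0 then i.succ else if a = i.succ then 0 else if a = fstIdx i then sndIdx i else fstIdx i

lemma muIdx_muIdx : ∀ (i : Fin 3) (a : Fin 4), muIdx i (muIdx i a) = a := by decide

/-- `dualForm J i` permutes the components by `muIdx i`, up to the nonzero factors ±1 and −J. -/
lemma dualForm_eq_zero {J : ℂ} (hJ : J ≠ 0) {i : Fin 3} {S : Fin 4 → ℂ} {a : Fin 4}
    (h : dualForm J i S a = 0) : S (muIdx i a) = 0 := by
  unfold dualForm at h
  unfold muIdx
  split_ifs at h ⊢ <;> simp_all

/-- The pair `a, b` is one of the two complementary index pairs of the `i`-th principal bivector. -/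
abbrev InPair (i : Fin 3) (a b : Fin 4) : Prop :=
  (a = 0 ∧ b = i.succ) ∨ (b = 0 ∧ a = i.succ) ∨
    (a = fstIdx i ∧ b = sndIdx i) ∨ (b = fstIdx i ∧ a = sndIdx i)

lemma eq_zero_of_inPair {f : Fin 4 → Fin 4 → ℝ} (hf : ∀ a b, f a b = - f b a) {i : Fin 3}
    (h0 : f 0 i.succ = 0) (h1 : f (fstIdx i) (sndIdx i) = 0) {a b : Fin 4} (hab : InPair i a b) :
    f a b = 0 := by
  rcases hab with ⟨ha, hb⟩ | ⟨hb, ha⟩ | ⟨ha, hb⟩ | ⟨hb, ha⟩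
  · rw [ha, hb, h0]
  · rw [hf, ha, hb, h0, neg_zero]
  · rw [ha, hb, h1]
  · rw [hf, ha, hb, h1, neg_zero]

/-- Connection coefficients supported as in class I₁ with principal gradient, and with integrable
orbit forms, are those of a warped product over the gradient direction. -/
lemma warped_of_support {w : Fin 4 → Fin 4 → Fin 4 → ℝ} {n : Fin 4}
    (ha : ∀ c a b, w c a b = - w c b a)
    (hs : ∀ i c, c ≠ muIdx i n → w c (fstIdx i) (sndIdx i) = 0 ∧ w c 0 i.succ = 0)
    (hi : ∀ m c d, m ≠ n → c ≠ m → d ≠ m → w c m d = w d m c) :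
    (∀ a b c, a ≠ n → b ≠ n → w c a b = 0) ∧ ∀ a c, c ≠ a → w c n a = 0 := by
  have hz : ∀ c a, w c a a = 0 := fun c a => by linarith [ha c a a]
  have key : ∀ i c a b, c ≠ muIdx i n → InPair i a b → w c a b = 0 := by
    intro i c a b hc hab
    obtain ⟨h1, h2⟩ := hs i c hc
    exact eq_zero_of_inPair (ha c) h2 h1 hab
  constructor
  · intro a b c han hbn
    by_cases hab : a = b
    · rw [hab, hz]
    -- If m is the fourth index besides n, a and b, then the bivector pairing a with b also pairs n
    -- with m. The support condition therefore kills every c except m.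
    by_cases hc : c = n ∨ c = a ∨ c = b
    · have hfin : ∀ n a b c : Fin 4, a ≠ n → b ≠ n → a ≠ b → (c = n ∨ c = a ∨ c = b) →
          ∃ i : Fin 3, c ≠ muIdx i n ∧ InPair i a b := by decide
      obtain ⟨i, h1, h2⟩ := hfin n a b c han hbn hab hc
      exact key i c a b h1 h2
    · push Not at hc
      obtain ⟨hcn, hca, hcb⟩ := hc
      -- Here a, b, c are the three indices other than n. The coefficient is antisymmetric in its
      -- last two slots and, by integrability, symmetric in its outer two, so it vanishes.
      have e1 := hi a c b han hca (Ne.symm hab)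
      have e2 := hi b c a hbn hcb hab
      have e3 := hi c a b hcn (Ne.symm hca) (Ne.symm hcb)
      linarith [ha c b a, ha b a c, ha a b c]
  · intro a c hca
    by_cases han : a = n
    · rw [han, hz]
    -- The bivector pairing n with a has a as the image of n, so the support condition applies to
    -- every c ≠ a.
    have hfin : ∀ n a c : Fin 4, a ≠ n → c ≠ a →
        ∃ i : Fin 3, c ≠ muIdx i n ∧ InPair i n a := by decide
    obtain ⟨i, h1, h2⟩ := hfin n a c han hca
    exact key i c n a h1 h2

/-! ### Class I₁ with principal gradient: support of the connection. -/

section Frame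

variable {g : MetricField} {U : Set Pt} {e : FrameField} {x : Pt} {J : ℂ} {α : Fin 3 → Pt → ℂ}
  {ε : Fin 4 → ℝ} {n : Fin 4}

lemma form_eq_sum (h : IsOrthoFrame g U e ε) (hx : x ∈ U) (u : Fin 4 → ℂ) (p : Fin 4) :
    u p = ∑ a, ((ε a * lowerVec g x (e a x) p : ℝ) : ℂ) * formF e x u a := by
  have hC : ∀ q, ∑ a, ((ε a * lowerVec g x (e a x) p : ℝ) : ℂ) * (e a x q : ℂ)
      = if p = q then 1 else 0 := by
    intro q
    have := congrArg (fun r : ℝ => (r : ℂ)) (h.sum_coframe_frame hx p q)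
    push_cast at this ⊢
    rw [this]
    split_ifs <;> simp
  simp only [formF, Finset.mul_sum]
  rw [Finset.sum_comm]
  simp only [← mul_assoc, ← Finset.sum_mul, hC]
  simp

/-- The 3-form identity `bianchi` is dualized into a vector equation: its four components 012, 013,
023, 123 determine the four components of dα_0. -/
lemma bianchi_frame (h : IsOrthoFrame g U e lorentzSign) (hU : IsOpen U)
    (hJ : ∀ y ∈ U, unitJ g e y = J) (hv : IsVacuum g U)
    (hα : ∀ i, ContDiffOn ℝ ∞ (α i) U)
    (heig : ∀ y ∈ U, ∀ i, weylMap g y (frameBivector g e i y) = α i y • frameBivector g e i y)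
    (hx : x ∈ U) (a : Fin 4) :
    formF e x (gradForm (α 0) x) a
      = (α 1 x - α 0 x) * dualForm J 2 (sigmaF g e J x 2) a
        + (α 2 x - α 0 x) * dualForm J 1 (sigmaF g e J x 1) a := by
  have hJ2 : J * J = -1 := by rw [← hJ x hx]; exact unitJ_sq h hx
  have hw := inv_sqrt_two_sq
  have key : ∀ a b c, formF e x (gradForm (α 0) x) a * biF e x (frameBivector g e 0 x) b c
      + formF e x (gradForm (α 0) x) b * biF e x (frameBivector g e 0 x) c a
      + formF e x (gradForm (α 0) x) c * biF e x (frameBivector g e 0 x) a b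
      = (α 1 x - α 0 x) * (sigmaF g e J x 2 a * biF e x (frameBivector g e 1 x) b c
        + sigmaF g e J x 2 b * biF e x (frameBivector g e 1 x) c a
        + sigmaF g e J x 2 c * biF e x (frameBivector g e 1 x) a b)
      - (α 2 x - α 0 x) * (sigmaF g e J x 1 a * biF e x (frameBivector g e 2 x) b c
        + sigmaF g e J x 1 b * biF e x (frameBivector g e 2 x) c a
        + sigmaF g e J x 1 c * biF e x (frameBivector g e 2 x) a b) := by
    intro a b c
    simp only [← formF_sigma, ← wedge_contract, Finset.mul_sum, ← Finset.sum_sub_distrib]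
    refine Finset.sum_congr rfl fun r _ => Finset.sum_congr rfl fun p _ =>
      Finset.sum_congr rfl fun q _ => ?_
    have := bianchi h hU hJ hv hα heig hx r p q
    simp only [gradForm]
    rw [this]
    ring
  have k012 := key 0 1 2
  have k013 := key 0 1 3
  have k023 := key 0 2 3
  have k123 := key 1 2 3
  simp only [frameBivector_eq h hx, biF_smul, biF_sub, h.biF_wedgeL hx, hJ x hx]
    at k012 k013 k023 k123
  simp [fstIdx, sndIdx] at k012 k013 k023 k123
  fin_cases a <;> simp [dualForm, fstIdx, sndIdx]
  all_goals
    generalize ((Real.sqrt 2 : ℝ) : ℂ)⁻¹ = w at *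
    clear key
    grind

lemma formF_smul (e : FrameField) (x : Pt) (z : ℂ) (u : Fin 4 → ℂ) (a : Fin 4) :
    formF e x (z • u) a = z * formF e x u a := by
  simp only [formF, Finset.mul_sum, Pi.smul_apply, smul_eq_mul]
  exact Finset.sum_congr rfl fun p _ => by ring

/-- In class I₁, the images of the connection forms are collinear with the gradient. -/
lemma dualForm_collinear (h : IsOrthoFrame g U e lorentzSign) (hU : IsOpen U)
    (hJ : ∀ y ∈ U, unitJ g e y = J) (hv : IsVacuum g U)
    (hα : ∀ i, ContDiffOn ℝ ∞ (α i) U)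
    (heig : ∀ y ∈ U, ∀ i, weylMap g y (frameBivector g e i y) = α i y • frameBivector g e i y)
    (hc : IsClassI1 g U e) (hx : x ∈ U) (hd : gradForm (α 0) x ≠ 0) (i : Fin 3) :
    ∃ t : ℂ, ∀ a, dualForm J i (sigmaF g e J x i) a
      = t * formF e x (gradForm (α 0) x) a := by
  obtain ⟨⟨v, hvm⟩, -, hv1⟩ := finrank_eq_one_iff'.mp (hc x hx)
  have hz : ∀ i, ∃ z : ℂ, lambdaForm g e i x = z • v := by
    intro i
    obtain ⟨z, hz⟩ := hv1 ⟨lambdaForm g e i x, Submodule.subset_span ⟨i, rfl⟩⟩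
    exact ⟨z, (congrArg Subtype.val hz).symm⟩
  choose z hz using hz
  have hl : ∀ i a, z i * formF e x v a = (1 / 2) *
      (dualForm J (i + 1) (sigmaF g e J x (i + 1)) a
        + dualForm J (i + 2) (sigmaF g e J x (i + 2)) a) := by
    intro i a
    rw [← formF_lambdaForm h hU hJ hx, hz, formF_smul]
  -- This inverts λ_i = (V_{i+1} + V_{i+2})/2 as V_i = λ_{i+1} + λ_{i+2} − λ_i, so each V_i lies on
  -- the line spanned by v.
  have hV : ∀ i a, dualForm J i (sigmaF g e J x i) a
      = (z (i + 1) + z (i + 2) - z i) * formF e x v a := by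
    intro i a
    have e0 := hl i a
    have e1 := hl (i + 1) a
    have e2 := hl (i + 2) a
    rw [show i + 1 + 1 = i + 2 by omega, show i + 1 + 2 = i by omega] at e1
    rw [show i + 2 + 1 = i by omega, show i + 2 + 2 = i + 1 by omega] at e2
    linear_combination e0 - e1 - e2
  have hD := fun a => bianchi_frame h hU hJ hv hα heig hx a
  simp only [hV] at hD ⊢
  generalize z (i + 1) + z (i + 2) - z i = ti
  obtain ⟨k, hk⟩ : ∃ k : ℂ, ∀ a, formF e x (gradForm (α 0) x) a = k * formF e x v a :=
    ⟨_, fun a => by rw [hD, ← mul_assoc, ← mul_assoc, ← add_mul]⟩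
  -- The Bianchi identity places dα_0 on the same line; since dα_0 ≠ 0, it can serve as a generator
  -- instead of v.
  have hk0 : k ≠ 0 := by
    rintro rfl
    apply hd
    ext p
    rw [form_eq_sum h hx (gradForm (α 0) x) p]
    simp [hk]
  exact ⟨ti / k, fun a => by rw [hk]; field_simp⟩

lemma formF_ofReal_lowerVec (h : IsOrthoFrame g U e ε) (hx : x ∈ U) (a b : Fin 4) :
    formF e x (fun p => (lowerVec g x (e b x) p : ℂ)) a = if a = b then (ε a : ℂ) else 0 := by
  have := congrArg (fun r : ℝ => (r : ℂ)) (h.sum_frame_coframe hx a b)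
  push_cast at this
  rw [formF, this]
  split_ifs <;> simp

lemma formF_eq_zero_of_collinear (h : IsOrthoFrame g U e ε) (hx : x ∈ U) {u : Fin 4 → ℂ}
    (hu : CollinearForms u (fun b => (lowerVec g x (e n x) b : ℂ))) {a : Fin 4} (ha : a ≠ n) :
    formF e x u a = 0 := by
  have h1 : formF e x u a * formF e x (fun p => (lowerVec g x (e n x) p : ℂ)) n
      = formF e x u n * formF e x (fun p => (lowerVec g x (e n x) p : ℂ)) a := by
    simp only [formF, Finset.sum_mul_sum]
    rw [Finset.sum_comm]
    refine Finset.sum_congr rfl fun p _ => Finset.sum_congr rfl fun q _ => ?_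
    linear_combination (e a x q : ℂ) * (e n x p : ℂ) * hu q p
  rw [formF_ofReal_lowerVec h hx, formF_ofReal_lowerVec h hx, if_pos rfl, if_neg ha, mul_zero] at h1
  have h2 : (ε n : ℂ) ≠ 0 := by
    intro h0
    have := h.sign n
    rw [Complex.ofReal_eq_zero.mp h0] at this
    norm_num at this
  exact (mul_eq_zero.mp h1).resolve_right h2

/-- J is a nonzero imaginary number, so the real and imaginary parts of σ_i separate the rotation
and boost coefficients. -/
lemma sigmaF_eq_zero (h : IsOrthoFrame g U e lorentzSign) (hx : x ∈ U)
    (hJ : unitJ g e x = J) {i : Fin 3} {c : Fin 4} (h0 : sigmaF g e J x i c = 0) :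
    connF g e x c (fstIdx i) (sndIdx i) = 0 ∧ connF g e x c 0 i.succ = 0 := by
  rw [sigmaF, ← hJ, unitJ] at h0
  have hre := congrArg Complex.re h0
  have him := congrArg Complex.im h0
  simp at hre him
  refine ⟨hre, him.resolve_left fun ho => ?_⟩
  have := h.orient_sq hx
  rw [ho] at this
  norm_num at this

/-- V_i is a multiple of dα_0, hence has only an n-component; undoing the index involution of 𝒰_i,
σ_i has only a component along `muIdx i n`. -/
lemma connF_support (h : IsOrthoFrame g U e lorentzSign) (hU : IsOpen U)
    (hJ : ∀ y ∈ U, unitJ g e y = J) (hv : IsVacuum g U)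
    (hα : ∀ i, ContDiffOn ℝ ∞ (α i) U)
    (heig : ∀ y ∈ U, ∀ i, weylMap g y (frameBivector g e i y) = α i y • frameBivector g e i y)
    (hc : IsClassI1 g U e) (hx : x ∈ U) (hd : gradForm (α 0) x ≠ 0)
    (hn : CollinearForms (gradForm (α 0) x) (fun b => (lowerVec g x (e n x) b : ℂ)))
    (i : Fin 3) (c : Fin 4) (hcn : c ≠ muIdx i n) :
    connF g e x c (fstIdx i) (sndIdx i) = 0 ∧ connF g e x c 0 i.succ = 0 := by
  have hJ0 : J ≠ 0 := by
    rintro rfl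
    have := unitJ_sq h hx
    rw [hJ x hx] at this
    norm_num at this
  obtain ⟨t, ht⟩ := dualForm_collinear h hU hJ hv hα heig hc hx hd i
  have h1 : muIdx i c ≠ n := fun h0 => hcn (by rw [← h0, muIdx_muIdx])
  have h2 := ht (muIdx i c)
  rw [formF_eq_zero_of_collinear h hx hn h1, mul_zero] at h2
  have h3 := dualForm_eq_zero hJ0 h2
  rw [muIdx_muIdx] at h3
  exact sigmaF_eq_zero h hx (hJ x hx) h3

end Frame

lemma IsOrthoFrame.mono {g : MetricField} {U V : Set Pt} {e : FrameField} {ε : Fin 4 → ℝ}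
    (h : IsOrthoFrame g U e ε) (hVU : V ⊆ U) : IsOrthoFrame g V e ε where
  smooth_metric a b := (h.smooth_metric a b).mono hVU
  symm x hx := h.symm x (hVU hx)
  smooth_frame a b := (h.smooth_frame a b).mono hVU
  sign := h.sign
  ortho x hx := h.ortho x (hVU hx)

/-! ### Orbit forms and their integrability. -/

section Frame

variable {g : MetricField} {U : Set Pt} {e : FrameField} {x : Pt} {J : ℂ} {α : Fin 3 → Pt → ℂ}
  {ε : Fin 4 → ℝ} {n : Fin 4}

/-- 𝒰_i is built from one index pair and its complement, so each of its columns has exactly one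
nonzero entry. -/
lemma biF_frameBivector_muIdx (h : IsOrthoFrame g U e lorentzSign) (hx : x ∈ U) (i : Fin 3)
    (a n : Fin 4) :
    (a ≠ muIdx i n → biF e x (frameBivector g e i x) a n = 0) ∧
      biF e x (frameBivector g e i x) (muIdx i n) n ≠ 0 := by
  have hJ0 : unitJ g e x ≠ 0 := by
    intro h0
    have := unitJ_sq h hx
    rw [h0] at this
    norm_num at this
  simp only [frameBivector_eq h hx, biF_smul, biF_sub, h.biF_wedgeL hx]
  have hw := sqrt_two_ne
  constructor
  · intro han
    fin_cases i <;> fin_cases n <;> fin_cases a <;>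
      simp [muIdx, fstIdx, sndIdx] at han ⊢
  · fin_cases i <;> fin_cases n <;> simp [muIdx, fstIdx, sndIdx, hJ0, hw]

lemma formF_orbitForm (h : IsOrthoFrame g U e lorentzSign) (hx : x ∈ U)
    (hn : CollinearForms (gradForm (α 0) x) (fun b => (lowerVec g x (e n x) b : ℂ)))
    (i : Fin 3) (a : Fin 4) : formF e x (orbitForm g e α i x) a
      = (lorentzSign n : ℂ) * biF e x (frameBivector g e i x) a n
        * formF e x (gradForm (α 0) x) n := by
  rw [orbitForm, formF_applyForm h hx]
  refine Finset.sum_eq_single n (fun b _ hb => ?_) (by simp)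
  rw [formF_eq_zero_of_collinear h hx hn hb, mul_zero]

/-- Each orbit form is thus proportional to one coframe direction, and as i varies all three
directions other than n occur. Integrability of the orbit forms becomes hypersurface-orthogonality
of these frame vectors. -/
lemma orbitForm_eq (h : IsOrthoFrame g U e lorentzSign) (hx : x ∈ U)
    (hn : CollinearForms (gradForm (α 0) x) (fun b => (lowerVec g x (e n x) b : ℂ)))
    (i : Fin 3) (p : Fin 4) : orbitForm g e α i x p
      = ((lorentzSign (muIdx i n) : ℂ) * formF e x (orbitForm g e α i x) (muIdx i n))
        * (lowerVec g x (e (muIdx i n) x) p : ℂ) := by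
  rw [form_eq_sum h hx (orbitForm g e α i x) p]
  rw [Finset.sum_eq_single (muIdx i n) (fun b _ hb => ?_) (by simp)]
  · push_cast
    ring
  · rw [formF_orbitForm h hx hn, (biF_frameBivector_muIdx h hx i b n).1 hb]
    ring

lemma formF_orbitForm_ne_zero (h : IsOrthoFrame g U e lorentzSign) (hx : x ∈ U)
    (hd : gradForm (α 0) x ≠ 0)
    (hn : CollinearForms (gradForm (α 0) x) (fun b => (lowerVec g x (e n x) b : ℂ)))
    (i : Fin 3) : formF e x (orbitForm g e α i x) (muIdx i n) ≠ 0 := by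
  rw [formF_orbitForm h hx hn]
  have h1 : (lorentzSign n : ℂ) ≠ 0 := by
    fin_cases n <;> simp
  refine mul_ne_zero (mul_ne_zero h1 (biF_frameBivector_muIdx h hx i 0 n).2) fun h0 => hd ?_
  ext p
  rw [form_eq_sum h hx (gradForm (α 0) x) p]
  refine Finset.sum_eq_zero fun b _ => ?_
  by_cases hb : b = n
  · rw [hb, h0, mul_zero]
  · rw [formF_eq_zero_of_collinear h hx hn hb, mul_zero]

lemma differentiableAt_orbitForm (h : IsOrthoFrame g U e lorentzSign) (hU : IsOpen U)
    (hJ : ∀ y ∈ U, unitJ g e y = J) (hα : ContDiffOn ℝ ∞ (α 0) U) (hx : x ∈ U)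
    (i : Fin 3) (p : Fin 4) : DifferentiableAt ℝ (fun y => orbitForm g e α i y p) x := by
  simp only [orbitForm, applyForm, gradForm]
  refine DifferentiableAt.fun_sum fun q _ => DifferentiableAt.fun_sum fun r _ => ?_
  refine ((differentiableAt_frameBivector h hU hJ hx i p q).fun_mul ?_).fun_mul ?_
  · exact Complex.ofRealCLM.differentiableAt.comp x
      (differentiableAt_of_smooth hU (h.smooth_inv q r) hx)
  · exact differentiableAt_of_smooth hU (contDiffOn_pd hU hα r) hx

/-- A 1-form proportional to an integrable one is integrable. -/
lemma integrable_of_smul (hU : IsOpen U) (hx : x ∈ U) {w l : Pt → Fin 4 → ℂ} {z : Pt → ℂ}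
    (hw : ∀ y ∈ U, ∀ p, w y p = z y * l y p) (hz : DifferentiableAt ℝ z x)
    (hl : ∀ p, DifferentiableAt ℝ (fun y => l y p) x) (hz0 : z x ≠ 0)
    (hi : IsIntegrableForm U w) (a b c : Fin 4) :
    l x a * (pd b (fun y => l y c) x - pd c (fun y => l y b) x)
    + l x b * (pd c (fun y => l y a) x - pd a (fun y => l y c) x)
    + l x c * (pd a (fun y => l y b) x - pd b (fun y => l y a) x) = 0 := by
  have h1 : ∀ p q, pd p (fun y => w y q) x = pd p z x * l x q + z x * pd p (fun y => l y q) x := by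
    intro p q
    rw [pd_congr_of_eqOn hU (fun y hy => hw y hy q) hx, pd_mul hz (hl q)]
  have h2 := hi x hx a b c
  simp only [h1, hw x hx] at h2
  -- For w = z l one has w ∧ dw = z² l ∧ dl, since the term in dz contains l ∧ l.
  apply mul_left_cancel₀ (mul_ne_zero hz0 hz0)
  linear_combination h2

/-- Evaluate e_m ∧ de_m on the frame vectors m, c, d: only the factor ε_m de_m(c,d) survives, and
the first structure equation expresses it by connection coefficients. -/
lemma connF_symm_of_integrable (h : IsOrthoFrame g U e ε) (hU : IsOpen U) (hx : x ∈ U)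
    {m : Fin 4}
    (hi : ∀ p q r, (lowerVec g x (e m x) p : ℂ)
        * (pd q (fun y => (lowerVec g y (e m y) r : ℂ)) x
          - pd r (fun y => (lowerVec g y (e m y) q : ℂ)) x)
      + (lowerVec g x (e m x) q : ℂ)
        * (pd r (fun y => (lowerVec g y (e m y) p : ℂ)) x
          - pd p (fun y => (lowerVec g y (e m y) r : ℂ)) x)
      + (lowerVec g x (e m x) r : ℂ)
        * (pd p (fun y => (lowerVec g y (e m y) q : ℂ)) x
          - pd q (fun y => (lowerVec g y (e m y) p : ℂ)) x) = 0)
    (c d : Fin 4) (hc : c ≠ m) (hd : d ≠ m) : connF g e x c m d = connF g e x d m c := by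
  have h1 := wedge_contract e x (fun p => (lowerVec g x (e m x) p : ℂ))
    (Matrix.of fun p q => pd p (fun y => (lowerVec g y (e m y) q : ℂ)) x
          - pd q (fun y => (lowerVec g y (e m y) p : ℂ)) x) m c d
  simp only [Matrix.of_apply, hi, mul_zero, Finset.sum_const_zero, formF_ofReal_lowerVec h hx,
    if_neg hc, if_neg hd, if_true, zero_mul, add_zero] at h1
  have h2 : (ε m : ℂ) ≠ 0 := by
    intro h0
    have := h.sign m
    rw [Complex.ofReal_eq_zero.mp h0] at this
    norm_num at this
  have h3 := (mul_eq_zero.mp h1.symm).resolve_left h2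
  have h4 := h.torsion_frame hU hx m c d
  have h5 : (biF e x (Matrix.of fun p q => pd p (fun y => (lowerVec g y (e m y) q : ℂ)) x
          - pd q (fun y => (lowerVec g y (e m y) p : ℂ)) x) c d)
      = ((connF g e x c m d - connF g e x d m c : ℝ) : ℂ) := by
    rw [← h4]
    simp only [biF, Matrix.of_apply, pd_ofReal (differentiableAt_lowerVec h hU hx _ _)]
    push_cast
    rfl
  rw [h5] at h3
  linarith [Complex.ofReal_eq_zero.mp h3]

/-- The orientation is continuous with values ±1, hence locally constant. Shrinking the domain this
way allows J to be treated as a constant in the derivative formulas. -/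
lemma exists_nhds_unitJ_const (h : IsOrthoFrame g U e lorentzSign) (hU : IsOpen U) (hx : x ∈ U) :
    ∃ V ⊆ U, IsOpen V ∧ x ∈ V ∧ ∀ y ∈ V, unitJ g e y = unitJ g e x := by
  have hdet : ∀ {M : Pt → Matrix (Fin 4) (Fin 4) ℝ}, SmoothMat U M →
      ContinuousOn (fun y => (M y).det) U := by
    intro M hM
    have : (fun y => (M y).det) = fun y => (Matrix.of fun a b => M y a b).det := rfl
    rw [this]
    simp only [det_fin_four, Matrix.of_apply]
    have hc := fun a b => (hM a b).continuousOn
    fun_prop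
  have hcont : ContinuousOn (orient g e) U :=
    ((Real.continuous_sqrt.comp continuous_abs).comp_continuousOn (hdet h.smooth_metric)).mul
      (hdet h.smooth_frameMat)
  have hat : ContinuousAt (orient g e) x := hcont.continuousAt (hU.mem_nhds hx)
  have hev : ∀ᶠ y in nhds x, dist (orient g e y) (orient g e x) < 1 :=
    hat (Metric.ball_mem_nhds _ one_pos)
  obtain ⟨V, hV, hVo, hxV⟩ := eventually_nhds_iff.mp (hev.and (hU.mem_nhds hx))
  refine ⟨V, fun y hy => (hV y hy).2, hVo, hxV, fun y hy => ?_⟩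
  have h1 := (hV y hy).1
  rw [Real.dist_eq, abs_lt] at h1
  have h2 := h.orient_sq (hV y hy).2
  have h3 := h.orient_sq hx
  rw [unitJ, unitJ]
  congr 2
  rcases mul_self_eq_one_iff.mp h2 with h4 | h4 <;>
    rcases mul_self_eq_one_iff.mp h3 with h5 | h5 <;> rw [h4, h5] at h1 ⊢ <;> norm_num at h1

end Frame

lemma IsPrincipalI13Vacuum.orthoFrame {g : MetricField} {U : Set Pt} {e : FrameField}
    {α : Fin 3 → Pt → ℂ} (H : IsPrincipalI13Vacuum g U e α) : IsOrthoFrame g U e lorentzSign where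
  smooth_metric := H.lorentz.smooth
  symm := H.lorentz.symm
  smooth_frame := H.frame.smooth_frame
  sign a := by fin_cases a <;> simp
  ortho := H.frame.orthonormal

/-- The connection of a vacuum metric of class I₁₃ with principal gradient. -/
theorem IsPrincipalI13Vacuum.warped {g : MetricField} {U : Set Pt} {e : FrameField}
    {α : Fin 3 → Pt → ℂ} (H : IsPrincipalI13Vacuum g U e α) (hU : IsOpen U) {n : Fin 4}
    (hn : ∀ x ∈ U, CollinearForms (gradForm (α 0) x) (fun b => (lowerVec g x (e n x) b : ℂ)))
    {x : Pt} (hx : x ∈ U) :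
    (∀ a b c, a ≠ n → b ≠ n → connF g e x c a b = 0) ∧
      ∀ a c, c ≠ a → connF g e x c n a = 0 := by
  obtain ⟨V, hVU, hV, hxV, hJ⟩ := exists_nhds_unitJ_const H.orthoFrame hU hx
  have h := H.orthoFrame.mono hVU
  have hα := fun i => (H.frame.smooth_eigenvalue i).mono hVU
  refine warped_of_support (h.connF_antisymm hV hxV) ?_ ?_
  · exact connF_support h hV hJ (fun y hy => H.vacuum y (hVU hy)) hα
      (fun y hy => H.frame.eigen y (hVU hy)) (fun y hy => H.classI13.classI1 y (hVU hy)) hxV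
      (H.classI13.grad_ne_zero x hx) (hn x hx)
  · intro m c d hm
    -- Every direction other than the gradient is reached by one of the three bivectors.
    obtain ⟨i, rfl⟩ : ∃ i, muIdx i n = m := by
      have : ∀ n m : Fin 4, m ≠ n → ∃ i, muIdx i n = m := by decide
      exact this n m hm
    refine connF_symm_of_integrable h hV hxV (fun p q r => ?_) c d
    refine integrable_of_smul (w := orbitForm g e α i)
      (l := fun y p => (lowerVec g y (e (muIdx i n) y) p : ℂ))
      (z := fun y => (lorentzSign (muIdx i n) : ℂ) * formF e y (orbitForm g e α i y) (muIdx i n))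
      hV hxV (fun y hy p => orbitForm_eq h hy (hn y (hVU hy)) i p) ?_ ?_ ?_
      (fun y hy => H.classI13.integrable i y (hVU hy)) p q r
    · refine DifferentiableAt.const_mul ?_ _
      simp only [formF]
      refine DifferentiableAt.fun_sum fun p _ => ?_
      exact (Complex.ofRealCLM.differentiableAt.comp x
        (differentiableAt_of_smooth hV (h.smooth_frame _ p) hxV)).fun_mul
        (differentiableAt_orbitForm h hV hJ (hα 0) hxV i p)
    · intro p
      exact Complex.ofRealCLM.differentiableAt.comp x (differentiableAt_lowerVec h hV hxV _ p)
    · refine mul_ne_zero ?_ (formF_orbitForm_ne_zero h hxV (H.classI13.grad_ne_zero x hx)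
        (hn x hx) i)
      have : ∀ a : Fin 4, (lorentzSign a : ℂ) ≠ 0 := by
        intro a
        fin_cases a <;> simp
      exact this _

/-! ### Petrov type I in terms of the principal frame. -/

section Petrov

variable {g : MetricField} {U : Set Pt} {e : FrameField} {x : Pt} {α : Fin 3 → Pt → ℂ}
  {ε : Fin 4 → ℝ} {n : Fin 4}

/-- `𝒲` as a linear map on 2-forms. -/
def weylLin (g : MetricField) (x : Pt) : Biform →ₗ[ℂ] Biform where
  toFun := weylMap g x
  map_add' B C := by
    ext a b
    simp only [weylMap, raiseBoth, Matrix.of_apply, Matrix.add_apply, mul_add,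
      Finset.sum_add_distrib]
  map_smul' z B := by
    ext a b
    simp only [weylMap, raiseBoth, Matrix.of_apply, Matrix.smul_apply, smul_eq_mul,
      Finset.mul_sum, RingHom.id_apply]
    refine Finset.sum_congr rfl fun c _ => Finset.sum_congr rfl fun d _ =>
      Finset.sum_congr rfl fun p _ => Finset.sum_congr rfl fun q _ => by ring

/-- The eigenvalues on self-dual 2-forms are the Weyl eigenvalues of a principal frame. -/
lemma eigenvalue_mem (h : IsOrthoFrame g U e lorentzSign) (hx : x ∈ U)
    (heig : ∀ i, weylMap g x (frameBivector g e i x) = α i x • frameBivector g e i x)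
    {B : Biform} {z : ℂ} (hB : IsSelfDual g x B) (hB0 : B ≠ 0) (hz : weylMap g x B = z • B) :
    ∃ i, z = α i x := by
  -- A self-dual B equals its own self-dual part, which expands it in the 𝒰_j.
  have h1 := selfDual_part h hx (biF_antisymm hB.1)
  rw [hB.2, smul_smul, Complex.I_mul_I, neg_smul, one_smul, sub_neg_eq_add, ← two_smul ℂ B,
    smul_smul] at h1
  norm_num at h1
  obtain ⟨b, hb⟩ : ∃ b : Fin 3 → ℂ, B = ∑ j, b j • frameBivector g e j x := ⟨_, h1⟩
  have h2 : weylMap g x B = ∑ j, (b j * α j x) • frameBivector g e j x := by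
    rw [hb]
    change weylLin g x _ = _
    simp only [map_sum, map_smul]
    refine Finset.sum_congr rfl fun j _ => ?_
    rw [mul_smul, ← heig j]
    rfl
  rw [hz, hb, Finset.smul_sum] at h2
  simp only [smul_smul] at h2
  have h3 := (combination_eq_iff h hx _ _).mp h2
  by_contra hne
  push Not at hne
  apply hB0
  rw [hb]
  refine Finset.sum_eq_zero fun j _ => ?_
  have h4 := congrFun h3 j
  have h5 : b j * (z - α j x) = 0 := by linear_combination h4
  rw [(mul_eq_zero.mp h5).resolve_right (sub_ne_zero.mpr (hne j)), zero_smul]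

/-- The three distinct eigenvalues of the type I condition all occur among the α_i; an injection of
a three-element set into itself is onto, so the α_i are distinct as well. -/
lemma eigenvalue_injective (h : IsOrthoFrame g U e lorentzSign) (hx : x ∈ U)
    (heig : ∀ i, weylMap g x (frameBivector g e i x) = α i x • frameBivector g e i x)
    (hI : IsPetrovTypeI g U) : Function.Injective fun i => α i x := by
  obtain ⟨lam, B, hinj, hB⟩ := hI x hx
  choose f hf using fun i => eigenvalue_mem h hx heig (hB i).1 (hB i).2.1 (hB i).2.2
  have hfi : Function.Injective f := fun i j hij => hinj (by rw [hf i, hf j, hij])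
  have hfs : Function.Surjective f := Finite.surjective_of_injective hfi
  intro i j hij
  obtain ⟨i', rfl⟩ := hfs i
  obtain ⟨j', rfl⟩ := hfs j
  simp only [← hf] at hij
  rw [hinj hij]

lemma sdCurv_eq_zero (h : IsOrthoFrame g U e lorentzSign) (hU : IsOpen U) (hx : x ∈ U)
    (hv : ∀ a b, ricci g x a b = 0)
    (heig : ∀ i, weylMap g x (frameBivector g e i x) = α i x • frameBivector g e i x)
    {i j : Fin 3} (hij : j ≠ i) :
    riemF g e x 0 j.succ 0 i.succ = 0 ∧ riemF g e x 0 j.succ (fstIdx i) (sndIdx i) = 0 := by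
  have h1 := (eigen_iff h hU hx hv i _).mp (heig i) j
  rw [if_neg hij, sdCurv_vacuum h hU hx hv, unitJ] at h1
  have hre := congrArg Complex.re h1
  have him := congrArg Complex.im h1
  simp at hre him
  refine ⟨hre, him.resolve_left fun ho => ?_⟩
  have := h.orient_sq hx
  rw [ho] at this
  norm_num at this

/-- The off-diagonal entries of the self-dual curvature vanish. Vacuum duality carries this from the
pairs containing 0 to the complementary spatial pairs. -/
lemma riemF_eq_zero_of_inPair (h : IsOrthoFrame g U e lorentzSign) (hU : IsOpen U) (hx : x ∈ U)
    (hv : ∀ a b, ricci g x a b = 0)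
    (heig : ∀ i, weylMap g x (frameBivector g e i x) = α i x • frameBivector g e i x)
    {i j : Fin 3} (hij : j ≠ i) {a b c d : Fin 4} (hab : InPair j a b) (hcd : InPair i c d) :
    riemF g e x a b c d = 0 := by
  obtain ⟨h1, h2⟩ := sdCurv_eq_zero h hU hx hv heig hij
  obtain ⟨h3, h4⟩ := vacuum_duality (h.riemF_antisymm_left hU hx)
    IsOrthoFrame.riemF_antisymm_right (h.riemF_pair_symm hU hx)
    ((h.ricci_eq_zero_iff hx).mp hv) j i
  rw [h1, neg_zero] at h3
  rw [h2] at h4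
  have hl := h.riemF_antisymm_left hU hx
  have hr := IsOrthoFrame.riemF_antisymm_right (g := g) (e := e) (x := x)
  refine eq_zero_of_inPair (f := fun a b => riemF g e x a b c d) (fun a b => hl a b c d) ?_ ?_ hab
  · exact eq_zero_of_inPair (f := fun c d => riemF g e x 0 j.succ c d) (fun c d => hr 0 _ c d)
      h1 h2 hcd
  · exact eq_zero_of_inPair (f := fun c d => riemF g e x (fstIdx j) (sndIdx j) c d)
      (fun c d => hr _ _ c d) h4 h3 hcd

end Petrov

/-! ### Frames warped over the direction of `e 0` -/

/-- The connection 1-forms `g(∇ e_0, e_a) ∝ e_a` and `g(∇ e_a, e_b) = 0`, for `a, b ≠ 0`. -/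
structure IsWarpedFrame (g : MetricField) (U : Set Pt) (e : FrameField) (ε : Fin 4 → ℝ) :
    Prop extends IsOrthoFrame g U e ε where
  spatial : ∀ x ∈ U, ∀ a b c, a ≠ 0 → b ≠ 0 → connF g e x c a b = 0
  radial : ∀ x ∈ U, ∀ a c, c ≠ a → connF g e x c 0 a = 0

/-- The expansion rate of the direction `e_i`. -/
def rate (g : MetricField) (e : FrameField) (ε : Fin 4 → ℝ) (i : Fin 4) (x : Pt) : ℝ :=
  ε i * connF g e x i 0 i

/-- The frame derivative of a function. -/
def frameDeriv (e : FrameField) (a : Fin 4) (f : Pt → ℝ) (x : Pt) : ℝ := ∑ p, e a x p * pd p f x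

namespace IsWarpedFrame

variable {g : MetricField} {U : Set Pt} {e : FrameField} {x : Pt} {ε : Fin 4 → ℝ}

lemma connMat_radial (h : IsWarpedFrame g U e ε) (hx : x ∈ U) (q i : Fin 4) :
    connMat g e q x 0 i = rate g e ε i x * lowerVec g x (e i x) q := by
  rw [h.conn_eq_sum hx, Finset.sum_eq_single i (fun c _ hc => ?_) (by simp), rate]
  · ring
  · rw [h.radial x hx i c hc, mul_zero]

lemma connMat_spatial (h : IsWarpedFrame g U e ε) (hx : x ∈ U) (q : Fin 4) {i j : Fin 4}
    (hi : i ≠ 0) (hj : j ≠ 0) : connMat g e q x i j = 0 := by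
  rw [h.conn_eq_sum hx]
  exact Finset.sum_eq_zero fun c _ => by rw [h.spatial x hx i j c hi hj, mul_zero]

lemma smooth_rate (h : IsWarpedFrame g U e ε) (hU : IsOpen U) (i : Fin 4) :
    ContDiffOn ℝ ∞ (rate g e ε i) U := by
  unfold rate connF
  exact contDiffOn_const.mul (ContDiffOn.sum fun p _ =>
    (h.smooth_frame i p).mul (h.smooth_conn hU p 0 i))

/-- Each spatial covector satisfies de_i = ε_0 r_i e_0 ∧ e_i, so a rescaling by a function with the
right e_0-derivative closes it. -/
lemma torsion_spatial (h : IsWarpedFrame g U e ε) (hU : IsOpen U) (hx : x ∈ U) {i : Fin 4}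
    (hi : i ≠ 0) (p q : Fin 4) :
    pd p (fun y => lowerVec g y (e i y) q) x - pd q (fun y => lowerVec g y (e i y) p) x
      = ε 0 * rate g e ε i x * (lowerVec g x (e 0 x) p * lowerVec g x (e i x) q
        - lowerVec g x (e 0 x) q * lowerVec g x (e i x) p) := by
  rw [h.torsion_free hU hx i q p, Finset.sum_eq_single 0 (fun d _ hd => ?_) (by simp)]
  · rw [h.conn_antisymm hU hx p i 0, h.conn_antisymm hU hx q i 0, h.connMat_radial hx,
      h.connMat_radial hx]
    ring
  · rw [h.connMat_spatial hx p hi hd, h.connMat_spatial hx q hi hd]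
    ring

/-- Differentiate ω_0i = r_i e_i. The quadratic term of the structure equation drops out: its middle
index is either 0, where ω_00 = 0, or spatial, where ω_mi = 0. -/
lemma riemF_radial (h : IsWarpedFrame g U e ε) (hU : IsOpen U) (hx : x ∈ U) {i : Fin 4}
    (hi : i ≠ 0) (a b : Fin 4) :
    riemF g e x 0 i a b = -(frameDeriv e a (rate g e ε i) x * (if b = i then ε b else 0)
      - frameDeriv e b (rate g e ε i) x * (if a = i then ε a else 0)
      + rate g e ε i x * (connF g e x a i b - connF g e x b i a)) := by
  rw [h.riemF_eq hU hx, Finset.sum_eq_zero, add_zero]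
  · congr 1
    have hd := fun q => differentiableAt_lowerVec h.toIsOrthoFrame hU hx i q
    have hr := differentiableAt_of_smooth hU (h.smooth_rate hU i) hx
    have h1 : ∀ p q, pd p (fun y => connMat g e q y 0 i) x
        = pd p (rate g e ε i) x * lowerVec g x (e i x) q
          + rate g e ε i x * pd p (fun y => lowerVec g y (e i y) q) x := by
      intro p q
      rw [pd_congr_of_eqOn hU (fun y hy => h.connMat_radial hy q i) hx, pd_mul hr (hd q)]
    rw [← h.torsion_frame hU hx i a b, ← h.sum_frame_coframe hx b i,
      ← h.sum_frame_coframe hx a i, dconnF, frameDeriv, frameDeriv, Finset.sum_mul_sum,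
      Finset.sum_mul_sum, Finset.mul_sum]
    rw [Finset.sum_comm (f := fun p q => e b x p * _ * _), ← Finset.sum_sub_distrib,
      ← Finset.sum_add_distrib]
    refine Finset.sum_congr rfl fun p _ => ?_
    rw [Finset.mul_sum, ← Finset.sum_sub_distrib, ← Finset.sum_add_distrib]
    refine Finset.sum_congr rfl fun q _ => ?_
    rw [h1, h1]
    ring
  · intro m _
    by_cases hm : m = 0
    · rw [hm, h.connF_diag hU hx, h.connF_diag hU hx]
      ring
    · rw [h.spatial x hx m i _ hm hi, h.spatial x hx m i _ hm hi]
      ring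

/-- With ω_ij = 0, only the quadratic term through the radial index is left: the Gauss equation for
flat leaves. -/
lemma riemF_spatial (h : IsWarpedFrame g U e ε) (hU : IsOpen U) (hx : x ∈ U) {i j : Fin 4}
    (hi : i ≠ 0) (hj : j ≠ 0) (a b : Fin 4) :
    riemF g e x i j a b = - ε 0 * (connF g e x a 0 i * connF g e x b 0 j
      - connF g e x b 0 i * connF g e x a 0 j) := by
  have h1 : dconnF g e x i j a b = 0 := by
    refine Finset.sum_eq_zero fun p _ => Finset.sum_eq_zero fun q _ => ?_
    rw [pd_congr_of_eqOn hU (fun y hy => h.connMat_spatial hy q hi hj) hx,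
      pd_congr_of_eqOn hU (fun y hy => h.connMat_spatial hy p hi hj) hx, pd_const, pd_const]
    ring
  rw [h.riemF_eq hU hx, h1, Finset.sum_eq_single 0 (fun m _ hm => ?_) (by simp)]
  · rw [h.connF_antisymm hU hx a i 0, h.connF_antisymm hU hx b i 0]
    ring
  · rw [h.spatial x hx i m _ hi hm, h.spatial x hx i m _ hi hm]
    ring

end IsWarpedFrame

/-! ### Vacuum metrics with a warped frame -/

lemma frameDeriv_add {e : FrameField} {x : Pt} {f h : Pt → ℝ} (hf : DifferentiableAt ℝ f x)
    (hh : DifferentiableAt ℝ h x) (a : Fin 4) :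
    frameDeriv e a (fun y => f y + h y) x = frameDeriv e a f x + frameDeriv e a h x := by
  simp only [frameDeriv, pd_add hf hh, mul_add, Finset.sum_add_distrib]

lemma frameDeriv_mul {e : FrameField} {x : Pt} {f h : Pt → ℝ} (hf : DifferentiableAt ℝ f x)
    (hh : DifferentiableAt ℝ h x) (a : Fin 4) :
    frameDeriv e a (fun y => f y * h y) x = frameDeriv e a f x * h x + f x * frameDeriv e a h x := by
  simp only [frameDeriv, pd_mul hf hh, Finset.mul_sum, Finset.sum_mul, ← Finset.sum_add_distrib]
  exact Finset.sum_congr rfl fun p _ => by ring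

lemma IsOrthoFrame.pd_eq_sum {g : MetricField} {U : Set Pt} {e : FrameField} {ε : Fin 4 → ℝ}
    {x : Pt} (h : IsOrthoFrame g U e ε) (hx : x ∈ U) (f : Pt → ℝ) (p : Fin 4) :
    pd p f x = ∑ a, ε a * lowerVec g x (e a x) p * frameDeriv e a f x := by
  simp only [frameDeriv, Finset.mul_sum]
  rw [Finset.sum_comm]
  simp only [← mul_assoc, ← Finset.sum_mul, h.sum_coframe_frame hx]
  simp

/-- A warped frame of a vacuum metric, with the nondegeneracy of Petrov type I. -/
structure IsKasnerFrame (g : MetricField) (U : Set Pt) (e : FrameField) (ε : Fin 4 → ℝ) :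
    Prop extends IsWarpedFrame g U e ε where
  vacuum : IsVacuum g U
  riem_off : ∀ x ∈ U, ∀ i j, i ≠ 0 → j ≠ 0 → i ≠ j → riemF g e x 0 i j i = 0
  distinct : ∀ x ∈ U, ∀ i j k, i ≠ 0 → j ≠ 0 → k ≠ 0 → i ≠ j → i ≠ k → j ≠ k →
    rate g e ε i x * rate g e ε j x ≠ rate g e ε i x * rate g e ε k x

/-- The sum of the expansion rates. -/
def totalRate (g : MetricField) (e : FrameField) (ε : Fin 4 → ℝ) (x : Pt) : ℝ :=
  rate g e ε 1 x + rate g e ε 2 x + rate g e ε 3 x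

namespace IsKasnerFrame

variable {g : MetricField} {U : Set Pt} {e : FrameField} {x : Pt} {ε : Fin 4 → ℝ}

lemma connF_self (h : IsKasnerFrame g U e ε) (i : Fin 4) :
    connF g e x i 0 i = ε i * rate g e ε i x := by
  rw [rate, ← mul_assoc, h.sign, one_mul]

lemma sign_ne (h : IsKasnerFrame g U e ε) (a : Fin 4) : ε a ≠ 0 := fun h0 => by
  have := h.sign a
  rw [h0] at this
  norm_num at this

/-- The curvature component R_{0iji} is, up to sign, the derivative of r_i along e_j. -/
lemma frameDeriv_off (h : IsKasnerFrame g U e ε) (hU : IsOpen U) (hx : x ∈ U) {i j : Fin 4}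
    (hi : i ≠ 0) (hj : j ≠ 0) (hij : i ≠ j) : frameDeriv e j (rate g e ε i) x = 0 := by
  have h1 := h.riem_off x hx i j hi hj hij
  rw [h.riemF_radial hU hx hi, if_pos rfl, if_neg (Ne.symm hij), h.spatial x hx i i j hi hi,
    h.spatial x hx i j i hi hj] at h1
  have h2 : frameDeriv e j (rate g e ε i) x * ε i = 0 := by linarith
  exact (mul_eq_zero.mp h2).resolve_right (h.sign_ne i)

lemma riemF_radial_self (h : IsKasnerFrame g U e ε) (hU : IsOpen U) (hx : x ∈ U) {i : Fin 4}
    (hi : i ≠ 0) : riemF g e x 0 i 0 i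
      = - ε i * (frameDeriv e 0 (rate g e ε i) x + rate g e ε i x ^ 2) := by
  rw [h.riemF_radial hU hx hi, if_pos rfl, if_neg (Ne.symm hi), h.spatial x hx i i 0 hi hi,
    h.connF_antisymm hU hx i i 0, h.connF_self]
  ring

lemma riemF_spatial_self (h : IsKasnerFrame g U e ε) (hU : IsOpen U) (hx : x ∈ U) {i j : Fin 4}
    (hi : i ≠ 0) (hj : j ≠ 0) (hij : i ≠ j) : riemF g e x i j i j
      = - ε 0 * ε i * ε j * (rate g e ε i x * rate g e ε j x) := by
  rw [h.riemF_spatial hU hx hi hj, h.connF_self, h.connF_self, h.radial x hx i j (Ne.symm hij)]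
  ring

lemma ricci_self (h : IsKasnerFrame g U e ε) (hU : IsOpen U) (hx : x ∈ U) {i j k : Fin 4}
    (hi : i ≠ 0) (hj : j ≠ 0) (hk : k ≠ 0) (hij : i ≠ j) (hik : i ≠ k) (hjk : j ≠ k) :
    frameDeriv e 0 (rate g e ε i) x
      = - rate g e ε i x * (rate g e ε i x + rate g e ε j x + rate g e ε k x) := by
  have h1 := (h.ricci_eq_zero_iff hx).mp (h.vacuum x hx) i i
  have huniv : ∀ i j k : Fin 4, i ≠ 0 → j ≠ 0 → k ≠ 0 → i ≠ j → i ≠ k → j ≠ k →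
      (Finset.univ : Finset (Fin 4)) = {0, i, j, k} := by decide
  have h2 := huniv i j k hi hj hk hij hik hjk
  have hii : riemF g e x i i i i = 0 := by linarith [h.riemF_antisymm_left hU hx i i i i]
  rw [h2, Finset.sum_insert (by simp [hi.symm, hj.symm, hk.symm]),
    Finset.sum_insert (by simp [hij, hik]), Finset.sum_insert (by simp [hjk]),
    Finset.sum_singleton, hii, h.riemF_radial_self hU hx hi,
    h.riemF_spatial_self hU hx hj hi hij.symm, h.riemF_spatial_self hU hx hk hi hik.symm] at h1
  have sj := h.sign j
  have sk := h.sign k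
  -- The contributions of j and k carry ε_j² and ε_k², so the Ricci component is a sign times an
  -- expression free of signs.
  have h3 : (ε 0 * ε i) * (frameDeriv e 0 (rate g e ε i) x
      + rate g e ε i x * (rate g e ε i x + rate g e ε j x + rate g e ε k x)) = 0 := by
    linear_combination -h1 - ε 0 * ε i * (rate g e ε j x * rate g e ε i x) * sj
      - ε 0 * ε i * (rate g e ε k x * rate g e ε i x) * sk
  have h4 := (mul_eq_zero.mp h3).resolve_left (mul_ne_zero (h.sign_ne 0) (h.sign_ne i))
  linarith

lemma frameDeriv_zero (h : IsKasnerFrame g U e ε) (hU : IsOpen U) (hx : x ∈ U) {i : Fin 4}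
    (hi : i ≠ 0) :
    frameDeriv e 0 (rate g e ε i) x = - rate g e ε i x * totalRate g e ε x := by
  have hf : ∀ i : Fin 4, i ≠ 0 → i = 1 ∨ i = 2 ∨ i = 3 := by decide
  rcases hf i hi with rfl | rfl | rfl
  · rw [h.ricci_self hU hx (i := 1) (j := 2) (k := 3) (by decide) (by decide) (by decide)
      (by decide) (by decide) (by decide), totalRate]
  · rw [h.ricci_self hU hx (i := 2) (j := 1) (k := 3) (by decide) (by decide) (by decide)
      (by decide) (by decide) (by decide), totalRate]
    ring
  · rw [h.ricci_self hU hx (i := 3) (j := 1) (k := 2) (by decide) (by decide) (by decide)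
      (by decide) (by decide) (by decide), totalRate]
    ring

/-- The Kasner condition. -/
lemma quadratic (h : IsKasnerFrame g U e ε) (hU : IsOpen U) (hx : x ∈ U) :
    rate g e ε 1 x * rate g e ε 2 x + rate g e ε 1 x * rate g e ε 3 x
      + rate g e ε 2 x * rate g e ε 3 x = 0 := by
  have h1 := (h.ricci_eq_zero_iff hx).mp (h.vacuum x hx) 0 0
  have h00 : riemF g e x 0 0 0 0 = 0 := by linarith [h.riemF_antisymm_left hU hx 0 0 0 0]
  have hs : ∀ i, riemF g e x i 0 i 0 = riemF g e x 0 i 0 i := fun i => by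
    rw [h.riemF_antisymm_left hU hx, IsOrthoFrame.riemF_antisymm_right, neg_neg]
  rw [Fin.sum_univ_four, h00, hs, hs, hs, h.riemF_radial_self hU hx (by decide),
    h.riemF_radial_self hU hx (by decide), h.riemF_radial_self hU hx (by decide),
    h.frameDeriv_zero hU hx (by decide), h.frameDeriv_zero hU hx (by decide),
    h.frameDeriv_zero hU hx (by decide), totalRate] at h1
  linear_combination (1 / 2) * h1
    + (1 / 2) * (- rate g e ε 1 x * (rate g e ε 1 x + rate g e ε 2 x + rate g e ε 3 x) + rate g e ε 1 x ^ 2) * h.sign 1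
    + (1 / 2) * (- rate g e ε 2 x * (rate g e ε 1 x + rate g e ε 2 x + rate g e ε 3 x) + rate g e ε 2 x ^ 2) * h.sign 2
    + (1 / 2) * (- rate g e ε 3 x * (rate g e ε 1 x + rate g e ε 2 x + rate g e ε 3 x) + rate g e ε 3 x ^ 2) * h.sign 3

/-- A vanishing r_i would make the two eigenvalue products r_i r_j and r_i r_k coincide. -/
lemma rate_ne_zero (h : IsKasnerFrame g U e ε) (hx : x ∈ U) {i : Fin 4} (hi : i ≠ 0) :
    rate g e ε i x ≠ 0 := by
  intro h0
  have hf : ∀ i : Fin 4, i ≠ 0 → ∃ j k : Fin 4, j ≠ 0 ∧ k ≠ 0 ∧ i ≠ j ∧ i ≠ k ∧ j ≠ k := by decide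
  obtain ⟨j, k, hj, hk, hij, hik, hjk⟩ := hf i hi
  exact h.distinct x hx i j k hi hj hk hij hik hjk (by rw [h0, zero_mul, zero_mul])

lemma rate_ne (h : IsKasnerFrame g U e ε) (hx : x ∈ U) {i j : Fin 4} (hi : i ≠ 0) (hj : j ≠ 0)
    (hij : i ≠ j) : rate g e ε i x ≠ rate g e ε j x := by
  intro h0
  have hf : ∀ i j : Fin 4, i ≠ 0 → j ≠ 0 → i ≠ j → ∃ k : Fin 4, k ≠ 0 ∧ k ≠ i ∧ k ≠ j := by decide
  obtain ⟨k, hk, hki, hkj⟩ := hf i j hi hj hij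
  exact h.distinct x hx k i j hk hi hj hki hkj hij (by rw [h0])

/-- If r_i + r_j = 0, the Kasner condition reduces to r_i r_j = 0. -/
lemma rate_add_ne_zero (h : IsKasnerFrame g U e ε) (hU : IsOpen U) (hx : x ∈ U) {i j : Fin 4}
    (hi : i ≠ 0) (hj : j ≠ 0) (hij : i ≠ j) : rate g e ε i x + rate g e ε j x ≠ 0 := by
  intro h0
  have hq := h.quadratic hU hx
  have hf : ∀ i j : Fin 4, i ≠ 0 → j ≠ 0 → i ≠ j → (i = 1 ∧ j = 2) ∨ (i = 2 ∧ j = 1) ∨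
    (i = 1 ∧ j = 3) ∨ (i = 3 ∧ j = 1) ∨ (i = 2 ∧ j = 3) ∨ (i = 3 ∧ j = 2) := by decide
  have hmul : rate g e ε i x * rate g e ε j x = 0 := by
    rcases hf i j hi hj hij with ⟨rfl, rfl⟩ | ⟨rfl, rfl⟩ | ⟨rfl, rfl⟩ | ⟨rfl, rfl⟩ | ⟨rfl, rfl⟩ |
      ⟨rfl, rfl⟩
    · linear_combination hq - rate g e ε 3 x * h0
    · linear_combination hq - rate g e ε 3 x * h0
    · linear_combination hq - rate g e ε 2 x * h0
    · linear_combination hq - rate g e ε 2 x * h0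
    · linear_combination hq - rate g e ε 1 x * h0
    · linear_combination hq - rate g e ε 1 x * h0
  exact mul_ne_zero (h.rate_ne_zero hx hi) (h.rate_ne_zero hx hj) hmul

/-- Under the Kasner condition S² = r_1² + r_2² + r_3². -/
lemma totalRate_ne_zero (h : IsKasnerFrame g U e ε) (hU : IsOpen U) (hx : x ∈ U) :
    totalRate g e ε x ≠ 0 := by
  intro h0
  rw [totalRate] at h0
  have hq := h.quadratic hU hx
  have h1 : rate g e ε 1 x ^ 2 + rate g e ε 2 x ^ 2 + rate g e ε 3 x ^ 2 = 0 := by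
    linear_combination (rate g e ε 1 x + rate g e ε 2 x + rate g e ε 3 x) * h0 - 2 * hq
  have h2 : 0 < rate g e ε 1 x ^ 2 := by
    have := h.rate_ne_zero hx (i := 1) (by decide)
    positivity
  nlinarith [sq_nonneg (rate g e ε 2 x), sq_nonneg (rate g e ε 3 x)]

/-- The off-diagonal curvature says nothing about e_i(r_i). Differentiating the Kasner condition
along e_i leaves e_i(r_i)(r_j + r_k) = 0, because the other two rates are constant in that
direction. -/
lemma frameDeriv_self (h : IsKasnerFrame g U e ε) (hU : IsOpen U) (hx : x ∈ U) {i : Fin 4}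
    (hi : i ≠ 0) : frameDeriv e i (rate g e ε i) x = 0 := by
  have hd := fun j => differentiableAt_of_smooth hU (h.smooth_rate hU j) hx
  have hz : frameDeriv e i (fun y => rate g e ε 1 y * rate g e ε 2 y
      + rate g e ε 1 y * rate g e ε 3 y + rate g e ε 2 y * rate g e ε 3 y) x = 0 := by
    refine Finset.sum_eq_zero fun p _ => ?_
    rw [pd_congr_of_eqOn hU (fun y hy => h.quadratic hU hy) hx, pd_const, mul_zero]
  rw [frameDeriv_add (((hd 1).fun_mul (hd 2)).fun_add ((hd 1).fun_mul (hd 3)))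
      ((hd 2).fun_mul (hd 3)), frameDeriv_add ((hd 1).fun_mul (hd 2)) ((hd 1).fun_mul (hd 3)),
    frameDeriv_mul (hd 1) (hd 2), frameDeriv_mul (hd 1) (hd 3), frameDeriv_mul (hd 2) (hd 3)] at hz
  have hf : ∀ i : Fin 4, i ≠ 0 → i = 1 ∨ i = 2 ∨ i = 3 := by decide
  rcases hf i hi with rfl | rfl | rfl
  · rw [h.frameDeriv_off hU hx (i := 2) (j := 1) (by decide) (by decide) (by decide),
      h.frameDeriv_off hU hx (i := 3) (j := 1) (by decide) (by decide) (by decide)] at hz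
    have hne := h.rate_add_ne_zero hU hx (i := 2) (j := 3) (by decide) (by decide) (by decide)
    refine (mul_eq_zero.mp ?_).resolve_right hne
    linear_combination hz
  · rw [h.frameDeriv_off hU hx (i := 1) (j := 2) (by decide) (by decide) (by decide),
      h.frameDeriv_off hU hx (i := 3) (j := 2) (by decide) (by decide) (by decide)] at hz
    have hne := h.rate_add_ne_zero hU hx (i := 1) (j := 3) (by decide) (by decide) (by decide)
    refine (mul_eq_zero.mp ?_).resolve_right hne
    linear_combination hz
  · rw [h.frameDeriv_off hU hx (i := 1) (j := 3) (by decide) (by decide) (by decide),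
      h.frameDeriv_off hU hx (i := 2) (j := 3) (by decide) (by decide) (by decide)] at hz
    have hne := h.rate_add_ne_zero hU hx (i := 1) (j := 2) (by decide) (by decide) (by decide)
    refine (mul_eq_zero.mp ?_).resolve_right hne
    linear_combination hz

lemma pd_rate (h : IsKasnerFrame g U e ε) (hU : IsOpen U) (hx : x ∈ U) {i : Fin 4}
    (hi : i ≠ 0) (q : Fin 4) : pd q (rate g e ε i) x
      = - ε 0 * rate g e ε i x * totalRate g e ε x * lowerVec g x (e 0 x) q := by
  rw [h.pd_eq_sum hx, Finset.sum_eq_single 0 (fun a _ ha => ?_) (by simp),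
    h.frameDeriv_zero hU hx hi]
  · ring
  · by_cases hia : i = a
    · rw [← hia, h.frameDeriv_self hU hx hi, mul_zero]
    · rw [h.frameDeriv_off hU hx hi ha hia, mul_zero]

lemma smooth_totalRate (h : IsKasnerFrame g U e ε) (hU : IsOpen U) :
    ContDiffOn ℝ ∞ (totalRate g e ε) U :=
  ((h.smooth_rate hU 1).add (h.smooth_rate hU 2)).add (h.smooth_rate hU 3)

lemma pd_totalRate (h : IsKasnerFrame g U e ε) (hU : IsOpen U) (hx : x ∈ U) (q : Fin 4) :
    pd q (totalRate g e ε) x = - ε 0 * totalRate g e ε x ^ 2 * lowerVec g x (e 0 x) q := by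
  have hd := fun j => differentiableAt_of_smooth hU (h.smooth_rate hU j) hx
  have h1 : pd q (totalRate g e ε) x
      = pd q (rate g e ε 1) x + pd q (rate g e ε 2) x + pd q (rate g e ε 3) x := by
    rw [← pd_add (hd 1) (hd 2), ← pd_add ((hd 1).fun_add (hd 2)) (hd 3)]
    rfl
  rw [h1, h.pd_rate hU hx (by decide), h.pd_rate hU hx (by decide), h.pd_rate hU hx (by decide)]
  rw [totalRate]
  ring

end IsKasnerFrame

/-! ### Relabelling the principal frame with the gradient first. -/

/-- A relabelling of the frame that puts the index `n` first and keeps a timelike direction at one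
of the first two places. -/
def radialPerm (n : Fin 4) : Equiv.Perm (Fin 4) := Equiv.swap 1 n * Equiv.swap 0 1

lemma radialPerm_zero : ∀ n, radialPerm n 0 = n := by decide

section Perm

variable {g : MetricField} {U : Set Pt} {e : FrameField} {x : Pt} {α : Fin 3 → Pt → ℂ}
  {ε : Fin 4 → ℝ}

/-- The signs travel with the vectors. Frames with arbitrary signs let the radial direction occupy
index 0 whether it is timelike or spacelike. -/
lemma IsOrthoFrame.perm (h : IsOrthoFrame g U e ε) (π : Equiv.Perm (Fin 4)) :
    IsOrthoFrame g U (fun a => e (π a)) (fun a => ε (π a)) where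
  smooth_metric := h.smooth_metric
  symm := h.symm
  smooth_frame a b := h.smooth_frame (π a) b
  sign a := h.sign (π a)
  ortho x hx a b := by
    rw [h.ortho x hx (π a) (π b), Matrix.diagonal_apply, Matrix.diagonal_apply]
    simp only [π.injective.eq_iff]

lemma connF_perm (π : Equiv.Perm (Fin 4)) (c a b : Fin 4) :
    connF g (fun a => e (π a)) x c a b = connF g e x (π c) (π a) (π b) := rfl

lemma riemF_perm (π : Equiv.Perm (Fin 4)) (a b c d : Fin 4) :
    riemF g (fun a => e (π a)) x a b c d = riemF g e x (π a) (π b) (π c) (π d) := rfl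

/-- The Weyl eigenvalues in terms of the expansion rates. -/
lemma eigenvalue_eq_rate (h : IsOrthoFrame g U e lorentzSign) {π : Equiv.Perm (Fin 4)}
    (hw : IsWarpedFrame g U (fun a => e (π a)) (fun a => lorentzSign (π a)))
    (hU : IsOpen U) (hx : x ∈ U) (hv : ∀ a b, ricci g x a b = 0)
    {c : Fin 3} {z : ℂ} (hz : weylMap g x (frameBivector g e c x) = z • frameBivector g e c x)
    {i j : Fin 4} (hi : i ≠ 0) (hj : j ≠ 0) (hij : i ≠ j) (hc : InPair c (π i) (π j)) :
    z = ((- lorentzSign (π 0)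
      * (rate g (fun a => e (π a)) (fun a => lorentzSign (π a)) i x
        * rate g (fun a => e (π a)) (fun a => lorentzSign (π a)) j x) : ℝ) : ℂ) := by
  have hw0 : ∀ p q, p ≠ i → p ≠ j → q ≠ i → q ≠ j →
      riemF g e x (π i) (π j) (π p) (π q) = 0 := by
    intro p q hpi hpj hqi hqj
    rw [← riemF_perm, hw.riemF_spatial hU hx hi hj, hw.radial x hx i p hpi,
      hw.radial x hx i q hqi]
    ring
  have hoff : ∀ p q, p ≠ π i → p ≠ π j → q ≠ π i → q ≠ π j →
      riemF g e x (π i) (π j) p q = 0 := by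
    intro p q hpi hpj hqi hqj
    have := hw0 (π.symm p) (π.symm q) (by rw [Ne, Equiv.symm_apply_eq]; exact hpi)
      (by rw [Ne, Equiv.symm_apply_eq]; exact hpj) (by rw [Ne, Equiv.symm_apply_eq]; exact hqi)
      (by rw [Ne, Equiv.symm_apply_eq]; exact hqj)
    simpa using this
  have hself : riemF g e x (π i) (π j) (π i) (π j) = - lorentzSign (π 0) * lorentzSign (π i)
      * lorentzSign (π j) * (rate g (fun a => e (π a)) (fun a => lorentzSign (π a)) i x
        * rate g (fun a => e (π a)) (fun a => lorentzSign (π a)) j x) := by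
    rw [← riemF_perm, hw.riemF_spatial hU hx hi hj, hw.radial x hx i j (Ne.symm hij), rate, rate]
    have s1 := hw.sign i
    have s2 := hw.sign j
    linear_combination (lorentzSign (π 0) * connF g (fun a => e (π a)) x i 0 i
      * connF g (fun a => e (π a)) x j 0 j) * (lorentzSign (π i) * lorentzSign (π i) * s2 + s1)
  have h1 := (eigen_iff h hU hx hv c z).mp hz c
  rw [if_pos rfl, sdCurv_vacuum h hU hx hv] at h1
  obtain ⟨h3, h4⟩ := vacuum_duality (h.riemF_antisymm_left hU hx)
    IsOrthoFrame.riemF_antisymm_right (h.riemF_pair_symm hU hx)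
    ((h.ricci_eq_zero_iff hx).mp hv) c c
  have hl := h.riemF_antisymm_left hU hx
  have hr := IsOrthoFrame.riemF_antisymm_right (g := g) (e := e) (x := x)
  have hp := h.riemF_pair_symm hU hx
  have hfs : ∀ c : Fin 3, fstIdx c ≠ 0 ∧ sndIdx c ≠ 0 ∧ fstIdx c ≠ c.succ ∧ sndIdx c ≠ c.succ := by
    decide
  have hsgn : ∀ c : Fin 3, lorentzSign c.succ = 1 ∧ lorentzSign (fstIdx c) = 1
      ∧ lorentzSign (sndIdx c) = 1 ∧ lorentzSign 0 = -1 := by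
    intro c
    fin_cases c <;> simp [fstIdx, sndIdx]
  obtain ⟨f1, f2, f3, f4⟩ := hfs c
  obtain ⟨g1, g2, g3, g4⟩ := hsgn c
  -- The pair (π i, π j) is either {0, c} or its spatial complement; in the second case vacuum
  -- duality converts the sectional component to R_{0c0c}.
  have key : riemF g e x 0 c.succ (fstIdx c) (sndIdx c) = 0 ∧
      - riemF g e x 0 c.succ 0 c.succ = - lorentzSign (π 0)
      * (rate g (fun a => e (π a)) (fun a => lorentzSign (π a)) i x
        * rate g (fun a => e (π a)) (fun a => lorentzSign (π a)) j x) := by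
    rcases hc with ⟨ha, hb⟩ | ⟨hb, ha⟩ | ⟨ha, hb⟩ | ⟨hb, ha⟩ <;> rw [ha, hb] at hself hoff
    · refine ⟨hoff _ _ f1 f3 f2 f4, ?_⟩
      rw [hself, g1, g4]
      ring
    · refine ⟨?_, ?_⟩
      · rw [hl, hoff _ _ f3 f1 f4 f2, neg_zero]
      · rw [hl, hr, hself, g1, g4]
        ring
    · refine ⟨?_, ?_⟩
      · rw [hp, hoff _ _ f1.symm f2.symm f3.symm f4.symm]
      · rw [← h3, hself, g2, g3]
        ring
    · refine ⟨?_, ?_⟩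
      · rw [hp, hl, hoff _ _ f2.symm f1.symm f4.symm f3.symm, neg_zero]
      · rw [← h3, hl, hr, hself, g2, g3]
        ring
  rw [key.1] at h1
  rw [← h1, ← key.2]
  push_cast
  ring

end Perm

/-- The principal frame of a vacuum metric of class I₁₃ with principal gradient, relabelled so that
the gradient comes first. -/
theorem IsPrincipalI13Vacuum.isKasnerFrame {g : MetricField} {U : Set Pt} {e : FrameField}
    {α : Fin 3 → Pt → ℂ} (H : IsPrincipalI13Vacuum g U e α) (hU : IsOpen U) {n : Fin 4}
    (hn : ∀ x ∈ U, CollinearForms (gradForm (α 0) x) (fun b => (lowerVec g x (e n x) b : ℂ))) :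
    IsKasnerFrame g U (fun a => e (radialPerm n a)) (fun a => lorentzSign (radialPerm n a)) := by
  have h := H.orthoFrame
  have hne : ∀ {a : Fin 4}, a ≠ 0 → radialPerm n a ≠ n := by
    intro a ha h0
    rw [← radialPerm_zero n] at h0
    exact ha ((radialPerm _).injective (by simpa [radialPerm_zero] using h0))
  have hw : IsWarpedFrame g U (fun a => e (radialPerm n a))
      (fun a => lorentzSign (radialPerm n a)) :=
    { h.perm (radialPerm n) with
      spatial := fun x hx a b c ha hb => by
        rw [connF_perm]
        exact (H.warped hU hn hx).1 _ _ _ (hne ha) (hne hb)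
      radial := fun x hx a c hca => by
        rw [connF_perm, radialPerm_zero]
        exact (H.warped hU hn hx).2 _ _ ((radialPerm n).injective.ne hca) }
  refine { hw with vacuum := H.vacuum, riem_off := ?_, distinct := ?_ }
  · intro x hx i j hi hj hij
    rw [riemF_perm]
    have hfin : ∀ n i j : Fin 4, n ≠ i → n ≠ j → i ≠ j → ∃ c d : Fin 3, c ≠ d ∧ InPair c n i ∧
      InPair d j i := by decide
    obtain ⟨c, d, hcd, h1, h2⟩ := hfin (radialPerm n 0) (radialPerm n i) (radialPerm n j)
      ((radialPerm n).injective.ne hi.symm) ((radialPerm n).injective.ne hj.symm)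
      ((radialPerm n).injective.ne hij)
    exact riemF_eq_zero_of_inPair h hU hx (H.vacuum x hx) (H.frame.eigen x hx) hcd h1 h2
  · intro x hx i j k hi hj hk hij hik hjk h0
    -- The pairs {i,j} and {i,k} share exactly one index, so they belong to different bivectors and
    -- hence to different eigenvalues.
    have hfin : ∀ i j k : Fin 4, i ≠ j → i ≠ k → j ≠ k → ∃ c d : Fin 3, c ≠ d ∧ InPair c i j ∧
      InPair d i k := by decide
    obtain ⟨c, d, hcd, h1, h2⟩ := hfin (radialPerm n i) (radialPerm n j) (radialPerm n k)
      ((radialPerm n).injective.ne hij) ((radialPerm n).injective.ne hik)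
      ((radialPerm n).injective.ne hjk)
    have e1 := eigenvalue_eq_rate h hw hU hx (H.vacuum x hx) (H.frame.eigen x hx c) hi hj hij h1
    have e2 := eigenvalue_eq_rate h hw hU hx (H.vacuum x hx) (H.frame.eigen x hx d) hi hk hik h2
    rw [h0, ← e2] at e1
    exact hcd (eigenvalue_injective h hx (H.frame.eigen x hx) H.typeI e1)

/-! ### Killing fields of a Kasner frame. -/

namespace IsKasnerFrame

variable {g : MetricField} {U : Set Pt} {e : FrameField} {x : Pt} {ε : Fin 4 → ℝ}

lemma smooth_ratio (h : IsKasnerFrame g U e ε) (hU : IsOpen U) (i : Fin 4) :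
    ContDiffOn ℝ ∞ (fun y => rate g e ε i y / totalRate g e ε y) U :=
  (h.smooth_rate hU i).div (h.smooth_totalRate hU) fun _ hy => h.totalRate_ne_zero hU hy

/-- Both r_i and S satisfy the linear equation du = −ε_0 S u e_0, so their quotient has zero
differential. -/
lemma pd_ratio (h : IsKasnerFrame g U e ε) (hU : IsOpen U) (hx : x ∈ U) {i : Fin 4} (hi : i ≠ 0)
    (q : Fin 4) : pd q (fun y => rate g e ε i y / totalRate g e ε y) x = 0 := by
  have hr := differentiableAt_of_smooth hU (h.smooth_ratio hU i) hx
  have hS := differentiableAt_of_smooth hU (h.smooth_totalRate hU) hx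
  have hS0 := h.totalRate_ne_zero hU hx
  have h1 : pd q (rate g e ε i) x
      = pd q (fun y => rate g e ε i y / totalRate g e ε y * totalRate g e ε y) x :=
    pd_congr_of_eqOn hU (fun y hy => (div_mul_cancel₀ _ (h.totalRate_ne_zero hU hy)).symm) hx q
  rw [pd_mul hr hS, h.pd_rate hU hx hi, h.pd_totalRate hU hx] at h1
  refine (mul_eq_zero.mp ?_).resolve_right hS0
  have h2 : rate g e ε i x / totalRate g e ε x * totalRate g e ε x = rate g e ε i x :=
    div_mul_cancel₀ _ hS0
  linear_combination -h1 + ε 0 * totalRate g e ε x * lowerVec g x (e 0 x) q * h2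

/-- `Real.log` of a negative number is the logarithm of its absolute value, so the formula covers
either sign of S. -/
lemma pd_log_totalRate (h : IsKasnerFrame g U e ε) (hU : IsOpen U) (hx : x ∈ U) (q : Fin 4) :
    pd q (fun y => Real.log (totalRate g e ε y)) x
      = - ε 0 * totalRate g e ε x * lowerVec g x (e 0 x) q := by
  have hS := differentiableAt_of_smooth hU (h.smooth_totalRate hU) hx
  have hS0 := h.totalRate_ne_zero hU hx
  have h1 := h.pd_totalRate hU hx q
  rw [pd] at h1
  rw [pd, fderiv.log hS hS0, smul_apply, h1, smul_eq_mul]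
  field_simp

/-- The logarithm of the norm of the Killing field in the direction `e i`. -/
def logNorm (g : MetricField) (e : FrameField) (ε : Fin 4 → ℝ) (i : Fin 4) (x : Pt) : ℝ :=
  -(rate g e ε i x / totalRate g e ε x) * Real.log (totalRate g e ε x)

lemma smooth_logNorm (h : IsKasnerFrame g U e ε) (hU : IsOpen U) (i : Fin 4) :
    ContDiffOn ℝ ∞ (logNorm g e ε i) U :=
  (h.smooth_ratio hU i).neg.mul
    ((h.smooth_totalRate hU).log fun _ hy => h.totalRate_ne_zero hU hy)

/-- The ratio r_i/S has zero differential, so only the logarithm contributes. The derivative is the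
one that closes the covector exp(−L_i) e_i and antisymmetrizes the covariant derivative of exp(L_i)
e_i. -/
lemma pd_logNorm (h : IsKasnerFrame g U e ε) (hU : IsOpen U) (hx : x ∈ U) {i : Fin 4}
    (hi : i ≠ 0) (q : Fin 4) : pd q (logNorm g e ε i) x
      = ε 0 * rate g e ε i x * lowerVec g x (e 0 x) q := by
  have hr := differentiableAt_of_smooth hU (h.smooth_ratio hU i) hx
  have hS := differentiableAt_of_smooth hU (h.smooth_totalRate hU) hx
  have hS0 := h.totalRate_ne_zero hU hx
  unfold logNorm
  rw [pd_mul hr.fun_neg (hS.log hS0), pd_neg, h.pd_ratio hU hx hi,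
    h.pd_log_totalRate hU hx]
  field_simp
  ring

lemma pd_exp_logNorm (h : IsKasnerFrame g U e ε) (hU : IsOpen U) (hx : x ∈ U) {i : Fin 4}
    (hi : i ≠ 0) (q : Fin 4) : pd q (fun y => Real.exp (logNorm g e ε i y)) x
      = Real.exp (logNorm g e ε i x) * (ε 0 * rate g e ε i x * lowerVec g x (e 0 x) q) := by
  have hd := differentiableAt_of_smooth hU (h.smooth_logNorm hU i) hx
  have h1 := h.pd_logNorm hU hx hi q
  rw [pd] at h1
  rw [pd, fderiv_exp hd, smul_apply, h1, smul_eq_mul]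

/-- The Killing field in the direction `e i`. -/
def killingField (g : MetricField) (e : FrameField) (ε : Fin 4 → ℝ) (i : Fin 4) (x : Pt) :
    Fin 4 → ℝ := Real.exp (logNorm g e ε i x) • e i x

lemma lowerVec_smul (g : MetricField) (x : Pt) (c : ℝ) (v : Fin 4 → ℝ) (a : Fin 4) :
    lowerVec g x (c • v) a = c * lowerVec g x v a := by
  simp only [lowerVec, Finset.mul_sum, Pi.smul_apply, smul_eq_mul]
  exact Finset.sum_congr rfl fun b _ => by ring

/-- ∇e_i contributes −ε_0 r_i e_i ⊗ e_0 and the derivative of the scale factor ε_0 r_i e_0 ⊗ e_i.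
Their sum is antisymmetric, which is Killing's equation, and spans the plane e_0 ∧ e_i. -/
lemma papapetrou_killingField (h : IsKasnerFrame g U e ε) (hU : IsOpen U) (hx : x ∈ U) {i : Fin 4}
    (hi : i ≠ 0) (a b : Fin 4) : papapetrou g (killingField g e ε i) x a b
      = (Real.exp (logNorm g e ε i x) * (ε 0 * rate g e ε i x))
        * (lowerVec g x (e 0 x) a * lowerVec g x (e i x) b
          - lowerVec g x (e i x) a * lowerVec g x (e 0 x) b) := by
  have hd := differentiableAt_of_smooth hU (h.smooth_logNorm hU i) hx
  have h1 := h.papapetrou_frame hx i b a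
  rw [Finset.sum_eq_single 0 (fun d _ hd => ?_) (by simp), h.conn_antisymm hU hx,
    h.connMat_radial hx, papapetrou] at h1
  · simp only [papapetrou, killingField, lowerVec_smul]
    rw [pd_mul hd.exp (differentiableAt_lowerVec h.toIsOrthoFrame hU hx i b),
      h.pd_exp_logNorm hU hx hi]
    have h2 : ∑ c, christoffel g x c a b * (Real.exp (logNorm g e ε i x) * lowerVec g x (e i x) c)
        = Real.exp (logNorm g e ε i x) * ∑ c, christoffel g x c a b * lowerVec g x (e i x) c := by
      rw [Finset.mul_sum]
      exact Finset.sum_congr rfl fun c _ => by ring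
    rw [h2]
    linear_combination Real.exp (logNorm g e ε i x) * h1
  · rw [h.connMat_spatial hx a hi hd]
    ring

lemma isKilling_killingField (h : IsKasnerFrame g U e ε) (hU : IsOpen U) {i : Fin 4}
    (hi : i ≠ 0) : IsKilling g U (killingField g e ε i) where
  smooth a := (h.smooth_logNorm hU i).exp.mul (h.smooth_frame i a)
  killing x hx a b := by
    rw [h.papapetrou_killingField hU hx hi, h.papapetrou_killingField hU hx hi]
    ring

lemma killingField_ne_zero (h : IsKasnerFrame g U e ε) (hx : x ∈ U) (i : Fin 4) :
    killingField g e ε i x ≠ 0 := by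
  refine smul_ne_zero (Real.exp_ne_zero _) fun h0 => ?_
  have h1 := h.sum_frame_coframe hx i i
  rw [if_pos rfl] at h1
  refine h.sign_ne i ?_
  rw [← h1]
  refine Finset.sum_eq_zero fun p _ => ?_
  rw [h0, Pi.zero_apply, zero_mul]

end IsKasnerFrame

/-- The simple 2-forms of the principal planes are aligned with the principal bivectors. -/
lemma isAlignedWith_of_inPair {g : MetricField} {U : Set Pt} {e : FrameField} {x : Pt}
    (h : IsOrthoFrame g U e lorentzSign) (hx : x ∈ U) {i : Fin 3} {a b : Fin 4}
    (hab : InPair i a b) {c : ℝ} (hc : c ≠ 0) :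
    IsAlignedWith (fun p q => c * (lowerVec g x (e a x) p * lowerVec g x (e b x) q
      - lowerVec g x (e b x) p * lowerVec g x (e a x) q)) (frameBivector g e i x) := by
  have hs : ((Real.sqrt 2 : ℝ) : ℂ) ≠ 0 := by
    simp
  have hJ2 := unitJ_sq h hx
  have hJ0 : unitJ g e x ≠ 0 := by
    intro h0
    rw [h0] at hJ2
    norm_num at hJ2
  have hJc : (starRingEnd ℂ) (unitJ g e x) = - unitJ g e x := by
    rw [unitJ, map_mul, Complex.conj_ofReal, Complex.conj_I]
    ring
  have hc0 : (c : ℂ) ≠ 0 := by exact_mod_cast hc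
  -- Since conj J = −J, the real part of 𝒰_i is a multiple of e_0 ∧ e_i and that of J 𝒰_i a multiple
  -- of the complementary plane; √2/2 compensates the normalization and the doubling.
  have key : ∀ t : ℝ, ∀ Ω : ℂ, (Ω = ((Real.sqrt 2 : ℝ) : ℂ) * t / 2 →
      ∀ p q, Ω * frameBivector g e i x p q + (starRingEnd ℂ) (Ω * frameBivector g e i x p q)
        = t * (lowerVec g x (e 0 x) p * lowerVec g x (e i.succ x) q
          - lowerVec g x (e i.succ x) p * lowerVec g x (e 0 x) q)) ∧
      (Ω = ((Real.sqrt 2 : ℝ) : ℂ) * t * unitJ g e x / 2 →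
      ∀ p q, Ω * frameBivector g e i x p q + (starRingEnd ℂ) (Ω * frameBivector g e i x p q)
        = t * (lowerVec g x (e (fstIdx i) x) p * lowerVec g x (e (sndIdx i) x) q
          - lowerVec g x (e (sndIdx i) x) p * lowerVec g x (e (fstIdx i) x) q)) := by
    intro t Ω
    constructor <;> intro hΩ p q
    · rw [hΩ, frameBivector_eq h hx]
      simp only [Matrix.smul_apply, Matrix.sub_apply, smul_eq_mul, wedgeL, Matrix.of_apply,
        map_mul, map_sub, map_div₀, map_inv₀, Complex.conj_ofReal, hJc, Complex.ofReal_sub,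
        Complex.ofReal_mul, map_ofNat]
      field_simp
      ring
    · rw [hΩ, frameBivector_eq h hx]
      simp only [Matrix.smul_apply, Matrix.sub_apply, smul_eq_mul, wedgeL, Matrix.of_apply,
        map_mul, map_sub, map_div₀, map_inv₀, Complex.conj_ofReal, hJc, Complex.ofReal_sub,
        Complex.ofReal_mul, map_ofNat]
      field_simp
      generalize unitJ g e x = J at hJ2 ⊢
      grind
  rcases hab with ⟨ha, hb⟩ | ⟨hb, ha⟩ | ⟨ha, hb⟩ | ⟨hb, ha⟩
  · refine ⟨((Real.sqrt 2 : ℝ) : ℂ) * (c : ℝ) / 2, by simp [hc0], fun p q => ?_⟩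
    rw [(key c _).1 rfl, ha, hb]
    push_cast
    ring
  · refine ⟨((Real.sqrt 2 : ℝ) : ℂ) * (-c : ℝ) / 2, by simp [hc0], fun p q => ?_⟩
    rw [(key (-c) _).1 rfl, ha, hb]
    push_cast
    ring
  · refine ⟨((Real.sqrt 2 : ℝ) : ℂ) * (c : ℝ) * unitJ g e x / 2, by simp [hc0, hJ0],
      fun p q => ?_⟩
    rw [(key c _).2 rfl, ha, hb]
    push_cast
    ring
  · refine ⟨((Real.sqrt 2 : ℝ) : ℂ) * (-c : ℝ) * unitJ g e x / 2, by simp [hc0, hJ0],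
      fun p q => ?_⟩
    rw [(key (-c) _).2 rfl, ha, hb]
    push_cast
    ring

/-- The three Killing fields with aligned Papapetrou fields. -/
theorem IsPrincipalI13Vacuum.exists_killing {g : MetricField} {U : Set Pt} {e : FrameField}
    {α : Fin 3 → Pt → ℂ} (hU : IsOpen U) (H : IsPrincipalI13Vacuum g U e α) :
    ∃ ξ : Fin 3 → Pt → Fin 4 → ℝ, ∀ i, IsKilling g U (ξ i) ∧ ∀ x ∈ U, ξ i x ≠ 0 ∧
      CollinearForms (fun b => (lowerVec g x (ξ i x) b : ℂ)) (orbitForm g e α i x) ∧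
      IsAlignedWith (papapetrou g (ξ i) x) (frameBivector g e i x) := by
  obtain ⟨n, hn⟩ := H.gradient
  have h := H.isKasnerFrame hU hn
  have hm : ∀ (n : Fin 4) (i : Fin 3), muIdx i n ≠ n ∧ InPair i n (muIdx i n) := by decide
  refine ⟨fun i => IsKasnerFrame.killingField g (fun a => e (radialPerm n a))
    (fun a => lorentzSign (radialPerm n a)) ((radialPerm n).symm (muIdx i n)), fun i => ?_⟩
  have hi : (radialPerm n).symm (muIdx i n) ≠ 0 := by
    rw [Ne, Equiv.symm_apply_eq, radialPerm_zero]
    exact (hm n i).1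
  refine ⟨h.isKilling_killingField hU hi, fun x hx => ⟨h.killingField_ne_zero hx _, ?_, ?_⟩⟩
  · intro a b
    rw [orbitForm_eq H.orthoFrame hx (hn x hx), orbitForm_eq H.orthoFrame hx (hn x hx)]
    simp only [IsKasnerFrame.killingField, IsKasnerFrame.lowerVec_smul, Equiv.apply_symm_apply]
    push_cast
    ring
  · have hp := funext fun a => funext fun b => h.papapetrou_killingField hU hx hi a b
    rw [hp]
    simp only [Equiv.apply_symm_apply, radialPerm_zero]
    refine isAlignedWith_of_inPair H.orthoFrame hx (hm n i).2 ?_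
    exact mul_ne_zero (Real.exp_ne_zero _) (mul_ne_zero
      (by simpa only [radialPerm_zero] using h.sign_ne 0) (h.rate_ne_zero hx hi))

/-! ### Coordinates -/

/-- A closed smooth 1-form on a convex open set is the differential of a smooth function. -/
lemma exists_potential {B : Set Pt} (hB : IsOpen B) (hBc : Convex ℝ B) {w : Fin 4 → Pt → ℝ}
    (hw : ∀ q, ContDiffOn ℝ ∞ (w q) B)
    (hc : ∀ x ∈ B, ∀ p q, pd p (w q) x = pd q (w p) x) :
    ∃ f : Pt → ℝ, ContDiffOn ℝ ∞ f B ∧ ∀ x ∈ B, ∀ q, pd q f x = w q x := by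
  let P : Fin 4 → Pt →L[ℝ] ℝ := fun q => ContinuousLinearMap.proj q
  have hP : ∀ q v, P q v = v q := fun _ _ => rfl
  let η : Pt → Pt →L[ℝ] ℝ := fun x => ∑ q, w q x • P q
  have hη : ContDiffOn ℝ ∞ η B := ContDiffOn.sum fun q _ => (hw q).smul contDiffOn_const
  have hd : ∀ x ∈ B, ∀ u v, fderiv ℝ η x u v = ∑ q, ∑ p, u p * v q * pd p (w q) x := by
    intro x hx u v
    have h1 : HasFDerivAt η (∑ q, (fderiv ℝ (w q) x).smulRight (P q)) x :=
      HasFDerivAt.fun_sum fun q _ =>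
        ((differentiableAt_of_smooth hB (hw q) hx).hasFDerivAt).smul_const (P q)
    rw [h1.fderiv]
    simp only [sum_apply, ContinuousLinearMap.smulRight_apply, smul_apply,
      hP, fderiv_apply_eq_sum_pd, smul_eq_mul, Finset.sum_mul]
    exact Finset.sum_congr rfl fun q _ => Finset.sum_congr rfl fun p _ => by ring
  obtain ⟨f, hf⟩ := hBc.exists_forall_hasFDerivAt_of_fderiv_symmetric hB
    (hη.differentiableOn (by simp)) (fun x hx u v => by
      rw [hd x hx, hd x hx, Finset.sum_comm]
      refine Finset.sum_congr rfl fun q _ => Finset.sum_congr rfl fun p _ => ?_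
      rw [hc x hx q p]
      ring)
  refine ⟨f, ?_, fun x hx q => ?_⟩
  · rw [contDiffOn_infty_iff_fderiv_of_isOpen hB]
    exact ⟨fun x hx => (hf x hx).differentiableAt.differentiableWithinAt,
      hη.congr fun x hx => (hf x hx).fderiv⟩
  · rw [pd, (hf x hx).fderiv]
    simp [η, hP, Pi.single_apply]

/-- A smooth map with injective differentials is locally a smooth chart. -/
lemma exists_chart {B : Set Pt} (hB : IsOpen B) {φ : Pt → Pt} (hφ : ContDiffOn ℝ ∞ φ B)
    (hinj : ∀ x ∈ B, Function.Injective (fderiv ℝ φ x)) {p : Pt} (hp : p ∈ B) :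
    ∃ ψ : OpenPartialHomeomorph Pt Pt, p ∈ ψ.source ∧ ψ.source ⊆ B ∧ (∀ x, ψ x = φ x) ∧
      ContDiffOn ℝ ∞ ψ.symm ψ.target := by
  have hE : ∀ x ∈ B, ∃ D : Pt ≃L[ℝ] Pt, HasFDerivAt φ (D : Pt →L[ℝ] Pt) x := by
    intro x hx
    have h1 := (differentiableAt_of_smooth hB hφ hx).hasFDerivAt
    exact ⟨(LinearEquiv.ofInjectiveEndo (fderiv ℝ φ x).toLinearMap
      (hinj x hx)).toContinuousLinearEquiv, h1⟩
  have hat : ∀ x ∈ B, ContDiffAt ℝ ∞ φ x := fun x hx => hφ.contDiffAt (hB.mem_nhds hx)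
  obtain ⟨D, hD⟩ := hE p hp
  -- Restricting to B keeps the differential invertible at every point of the source, so the inverse
  -- is smooth on the whole target.
  let ψ := ((hat p hp).toOpenPartialHomeomorph φ hD (by simp)).restrOpen B hB
  have hψ : ∀ x, ψ x = φ x := fun x => rfl
  have hsrc : ψ.source ⊆ B := fun x hx => hx.2
  refine ⟨ψ, ⟨(hat p hp).mem_toOpenPartialHomeomorph_source hD (by simp), hp⟩, hsrc, hψ, ?_⟩
  intro y hy
  have hm := hsrc (ψ.map_target hy)
  obtain ⟨D', hD'⟩ := hE _ hm
  exact (ψ.contDiffAt_symm hy hD' (hat _ hm)).contDiffWithinAt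

/-- The parametrization of the Kasner exponents. -/
lemma exists_kasner_parameter {r₁ r₂ r₃ : ℝ}
    (hq : r₁ * r₂ + r₁ * r₃ + r₂ * r₃ = 0) (hS : r₁ + r₂ + r₃ ≠ 0) (h1 : r₁ ≠ 0) (h2 : r₂ ≠ 0)
    (h12 : r₁ + r₂ ≠ 0) (d12 : r₁ ≠ r₂) (d13 : r₁ ≠ r₃) (d23 : r₂ ≠ r₃) :
    ∃ k, Admissible k ∧ r₁ / (r₁ + r₂ + r₃) = 1 - 1 / kasnerBeta k ∧
      r₂ / (r₁ + r₂ + r₃) = 1 - k ^ 2 / kasnerBeta k ∧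
      r₃ / (r₁ + r₂ + r₃) = 1 - (1 + k) ^ 2 / kasnerBeta k := by
  -- With k = r_1/r_2 the Kasner condition gives r_3 = −k r_2/(1+k), whence S = r_2 β/(1+k).
  obtain ⟨k, rfl⟩ : ∃ k, r₁ = k * r₂ := ⟨r₁ / r₂, by field_simp⟩
  have hk1 : 1 + k ≠ 0 := fun h0 => h12 (by linear_combination r₂ * h0)
  have h3 : r₃ = -(k * r₂) / (1 + k) := by
    rw [eq_div_iff hk1]
    apply mul_left_cancel₀ h2
    linear_combination hq
  have hβ : 0 < kasnerBeta k := by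
    unfold kasnerBeta
    nlinarith [sq_nonneg (k + 1 / 2)]
  have hS' : k * r₂ + r₂ + r₃ = r₂ * kasnerBeta k / (1 + k) := by
    rw [h3, kasnerBeta]
    field_simp
    ring
  -- The excluded values 0, −1, 1, −2, −1/2 correspond to r_1 = 0, r_1 + r_2 = 0, r_1 = r_2, r_1 =
  -- r_3 and r_2 = r_3.
  refine ⟨k, ⟨?_, ?_, ?_, ?_, ?_⟩, ?_, ?_, ?_⟩
  · rintro rfl
    exact h1 (zero_mul _)
  · rintro rfl
    norm_num at hk1
  · rintro rfl
    exact d12 (one_mul _)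
  · rintro rfl
    apply d13
    rw [h3]
    ring
  · rintro rfl
    apply d23
    rw [h3]
    ring
  · rw [hS', div_div_eq_mul_div]
    field_simp
    rw [kasnerBeta]
    ring
  · rw [hS', div_div_eq_mul_div]
    field_simp
    rw [kasnerBeta]
    ring
  · rw [hS', h3]
    field_simp
    rw [kasnerBeta]
    ring

/-! ### Kasner coordinates. -/

namespace IsKasnerFrame

variable {g : MetricField} {U : Set Pt} {e : FrameField} {x : Pt} {ε : Fin 4 → ℝ}

lemma ratio_const (h : IsKasnerFrame g U e ε) (hU : IsOpen U) {B : Set Pt} (hB : IsOpen B)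
    (hBc : Convex ℝ B) (hBU : B ⊆ U) {i : Fin 4} (hi : i ≠ 0) {p : Pt} (hp : p ∈ B)
    (hx : x ∈ B) : rate g e ε i x / totalRate g e ε x = rate g e ε i p / totalRate g e ε p := by
  refine hB.is_const_of_fderiv_eq_zero (𝕜 := ℝ)
    (f := fun y => rate g e ε i y / totalRate g e ε y) hBc.isPreconnected
    (((h.smooth_ratio hU i).mono hBU).differentiableOn (by simp)) (fun y hy => ?_) hx hp
  ext v
  rw [fderiv_apply_eq_sum_pd]
  simp [h.pd_ratio hU (hBU hy) hi]

/-- The covector exp(−L_i) e_i is closed: the derivative of L_i cancels the factor ε_0 r_i in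
`torsion_spatial`. Convexity then gives a potential. -/
lemma exists_coordinate (h : IsKasnerFrame g U e ε) (hU : IsOpen U) {B : Set Pt} (hB : IsOpen B)
    (hBc : Convex ℝ B) (hBU : B ⊆ U) {i : Fin 4} (hi : i ≠ 0) :
    ∃ f : Pt → ℝ, ContDiffOn ℝ ∞ f B ∧ ∀ x ∈ B, ∀ q,
      pd q f x = Real.exp (-logNorm g e ε i x) * lowerVec g x (e i x) q := by
  refine exists_potential hB hBc (fun q => ?_) fun x hx p q => ?_
  · exact ((h.smooth_logNorm hU i).neg.exp.mul (h.smooth_coframe i q)).mono hBU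
  · have hx := hBU hx
    have hd := differentiableAt_of_smooth hU (h.smooth_logNorm hU i) hx
    have h1 : ∀ p, pd p (fun y => Real.exp (-logNorm g e ε i y)) x
        = - Real.exp (-logNorm g e ε i x) * (ε 0 * rate g e ε i x * lowerVec g x (e 0 x) p) := by
      intro p
      have h2 := h.pd_logNorm hU hx hi p
      rw [pd] at h2
      rw [pd, fderiv_exp hd.fun_neg, smul_apply, fderiv_fun_neg, neg_apply, h2, smul_eq_mul]
      ring
    have h3 := h.torsion_spatial hU hx hi p q
    rw [pd_mul hd.fun_neg.exp (differentiableAt_lowerVec h.toIsOrthoFrame hU hx i q),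
      pd_mul hd.fun_neg.exp (differentiableAt_lowerVec h.toIsOrthoFrame hU hx i p), h1, h1]
    linear_combination Real.exp (-logNorm g e ε i x) * h3

/-- A vacuum metric with a Kasner frame is, in suitable coordinates, a Kasner metric. -/
theorem exists_hasFormNear (h : IsKasnerFrame g U e ε) (hU : IsOpen U) {p : Pt} (hp : p ∈ U) :
    ∃ k, Admissible k ∧ HasFormNear g U p (fun x => Matrix.diagonal
      ![ε 0 * Real.exp (-2 * x 0),
        ε 1 * Real.exp (2 * (1 / kasnerBeta k - 1) * x 0),
        ε 2 * Real.exp (2 * (k ^ 2 / kasnerBeta k - 1) * x 0),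
        ε 3 * Real.exp (2 * ((1 + k) ^ 2 / kasnerBeta k - 1) * x 0)]) := by
  have n1 : (1 : Fin 4) ≠ 0 := by decide
  have n2 : (2 : Fin 4) ≠ 0 := by decide
  have n3 : (3 : Fin 4) ≠ 0 := by decide
  obtain ⟨k, hk, hk1, hk2, hk3⟩ := exists_kasner_parameter (h.quadratic hU hp)
    (h.totalRate_ne_zero hU hp) (h.rate_ne_zero hp n1) (h.rate_ne_zero hp n2)
    (h.rate_add_ne_zero hU hp n1 n2 (by decide)) (h.rate_ne hp n1 n2 (by decide))
    (h.rate_ne hp n1 n3 (by decide)) (h.rate_ne hp n2 n3 (by decide))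
  refine ⟨k, hk, ?_⟩
  -- A ball is convex, as required both by the Poincaré lemma and for r_i/S to be constant.
  obtain ⟨r, hr, hball⟩ := Metric.isOpen_iff.mp hU p hp
  have hB : IsOpen (Metric.ball p r) := Metric.isOpen_ball
  have hBc : Convex ℝ (Metric.ball p r) := convex_ball p r
  have hpB : p ∈ Metric.ball p r := Metric.mem_ball_self hr
  generalize Metric.ball p r = B at hball hB hBc hpB
  obtain ⟨f₁, hf₁, df₁⟩ := h.exists_coordinate hU hB hBc hball n1
  obtain ⟨f₂, hf₂, df₂⟩ := h.exists_coordinate hU hB hBc hball n2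
  obtain ⟨f₃, hf₃, df₃⟩ := h.exists_coordinate hU hB hBc hball n3
  let τ : Pt → ℝ := fun y => Real.log (totalRate g e ε y)
  have hτ : ContDiffOn ℝ ∞ τ B :=
    ((h.smooth_totalRate hU).log fun _ hy => h.totalRate_ne_zero hU hy).mono hball
  let φ : Pt → Pt := fun y => ![τ y, f₁ y, f₂ y, f₃ y]
  have hφ : ContDiffOn ℝ ∞ φ B := by
    rw [contDiffOn_pi]
    intro c
    fin_cases c
    exacts [hτ, hf₁, hf₂, hf₃]
  -- In these coordinates dφ^c = σ_c e_c, so the Jacobian is diagonal with respect to the frame and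
  -- each σ_c is nonzero.
  let σ : Pt → Fin 4 → ℝ := fun y => ![- ε 0 * totalRate g e ε y,
    Real.exp (-logNorm g e ε 1 y), Real.exp (-logNorm g e ε 2 y), Real.exp (-logNorm g e ε 3 y)]
  have hpd : ∀ x ∈ B, ∀ q c, pd q (fun y => φ y c) x = σ x c * lowerVec g x (e c x) q := by
    intro x hx q c
    fin_cases c
    exacts [h.pd_log_totalRate hU (hball hx) q, df₁ x hx q, df₂ x hx q, df₃ x hx q]
  have hσ : ∀ x ∈ B, ∀ c, σ x c ≠ 0 := by
    intro x hx c
    have h1 := h.totalRate_ne_zero hU (hball hx)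
    have h2 := h.sign_ne 0
    fin_cases c <;> simp [σ, h1, h2, Real.exp_ne_zero]
  have hinj : ∀ x ∈ B, Function.Injective (fderiv ℝ φ x) := by
    intro x hx
    rw [injective_iff_map_eq_zero]
    intro v hv
    have hdφ := differentiableAt_of_smooth hB hφ hx
    have h1 : ∀ c, ∑ q, lowerVec g x (e c x) q * v q = 0 := by
      intro c
      have h2 : fderiv ℝ (fun y => φ y c) x v = 0 := by
        have h3 := ((ContinuousLinearMap.proj (R := ℝ) (φ := fun _ : Fin 4 => ℝ)
          c).hasFDerivAt.comp x hdφ.hasFDerivAt).fderiv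
        change fderiv ℝ (fun y => φ y c) x = _ at h3
        rw [h3, ContinuousLinearMap.comp_apply, hv, map_zero]
      rw [fderiv_apply_eq_sum_pd] at h2
      simp only [hpd x hx, smul_eq_mul] at h2
      apply mul_left_cancel₀ (hσ x hx c)
      rw [mul_zero, ← h2, Finset.mul_sum]
      exact Finset.sum_congr rfl fun q _ => by ring
    ext p
    have h2 : v p = ∑ q, (∑ a, ε a * lowerVec g x (e a x) q * e a x p) * v q := by
      simp [h.sum_coframe_frame (hball hx)]
    rw [h2]
    simp only [Finset.sum_mul]
    rw [Finset.sum_comm]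
    refine Finset.sum_eq_zero fun a _ => ?_
    have := h1 a
    rw [show ∑ q, ε a * lowerVec g x (e a x) q * e a x p * v q
      = ε a * e a x p * ∑ q, lowerVec g x (e a x) q * v q from by
        rw [Finset.mul_sum]; exact Finset.sum_congr rfl fun q _ => by ring, this, mul_zero]
  obtain ⟨ψ, hpψ, hψB, hψ, hsymm⟩ := exists_chart hB hφ hinj hpB
  refine ⟨ψ, hpψ, hψB.trans hball, ?_, hsymm, fun x hx a b => ?_⟩
  · exact (hφ.mono hψB).congr fun x _ => hψ x
  · have hxB := hψB hx
    have hxU := hball hxB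
    simp only [hψ, hpd x hxB]
    rw [h.metric_apply hxU]
    refine Finset.sum_congr rfl fun c _ => ?_
    rw [Finset.sum_eq_single c (fun d _ hd => by rw [Matrix.diagonal_apply_ne _ hd.symm, mul_zero])
      (by simp), Matrix.diagonal_apply_eq]
    have hS0 := h.totalRate_ne_zero hU hxU
    -- Comparing g = ∑ ε_c e_c ⊗ e_c with the pullback of the diagonal form leaves one scalar
    -- identity for each direction.
    have key : σ x c * σ x c * (![ε 0 * Real.exp (-2 * φ x 0),
        ε 1 * Real.exp (2 * (1 / kasnerBeta k - 1) * φ x 0),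
        ε 2 * Real.exp (2 * (k ^ 2 / kasnerBeta k - 1) * φ x 0),
        ε 3 * Real.exp (2 * ((1 + k) ^ 2 / kasnerBeta k - 1) * φ x 0)] : Fin 4 → ℝ) c = ε c := by
      -- With r_i/S = 1 − s and log|S| = τ one has exp(−L_i) = exp((1−s)τ), whose square cancels the
      -- metric coefficient.
      have hexp : ∀ i : Fin 4, i ≠ 0 → ∀ s : ℝ, rate g e ε i p / totalRate g e ε p = 1 - s →
          Real.exp (-logNorm g e ε i x) * Real.exp (-logNorm g e ε i x)
            * (ε i * Real.exp (2 * (s - 1) * τ x)) = ε i := by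
        intro i hi s hs
        rw [← h.ratio_const hU hB hBc hball hi hpB hxB] at hs
        rw [mul_left_comm, ← Real.exp_add, ← Real.exp_add, logNorm, hs]
        simp only [τ]
        ring_nf
        simp
      fin_cases c
      · have h1 : Real.exp (-2 * τ x) = (totalRate g e ε x ^ 2)⁻¹ := by
          have h2 : (totalRate g e ε x) ^ 2 = Real.exp (2 * τ x) := by
            rw [two_mul, Real.exp_add, ← sq, Real.exp_log_eq_abs hS0, sq_abs]
          rw [h2, ← Real.exp_neg]
          ring_nf
        change - ε 0 * totalRate g e ε x * (- ε 0 * totalRate g e ε x)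
          * (ε 0 * Real.exp (-2 * τ x)) = ε 0
        rw [h1]
        field_simp
        linear_combination ε 0 * h.sign 0
      · exact hexp 1 n1 _ hk1
      · exact hexp 2 n2 _ hk2
      · exact hexp 3 n3 _ hk3
    linear_combination -(lowerVec g x (e c x) a * lowerVec g x (e c x) b) * key

end IsKasnerFrame

lemma HasFormNear.mono {g h : MetricField} {U V : Set Pt} {p : Pt} (H : HasFormNear g V p h)
    (hVU : V ⊆ U) : HasFormNear g U p h := by
  obtain ⟨φ, h1, h2, h3⟩ := H
  exact ⟨φ, h1, h2.trans hVU, h3⟩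

theorem IsPrincipalI13Vacuum.exists_hasFormNear {g : MetricField} {U : Set Pt} {e : FrameField}
    {α : Fin 3 → Pt → ℂ} (H : IsPrincipalI13Vacuum g U e α) (hU : IsOpen U) {p : Pt}
    (hp : p ∈ U) : ∃ k : ℝ, Admissible k ∧
      (HasFormNear g U p (kasner k) ∨ HasFormNear g U p (staticKasner k)) := by
  obtain ⟨n, hn⟩ := H.gradient
  obtain ⟨k, hk, hf⟩ := (H.isKasnerFrame hU hn).exists_hasFormNear hU hp
  refine ⟨k, hk, ?_⟩
  -- A timelike gradient keeps the signs (−,+,+,+). Otherwise `radialPerm` moves the timelike vector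
  -- to place 1, giving (+,−,+,+).
  by_cases h0 : n = 0
  · left
    subst h0
    have h1 : ∀ a, radialPerm 0 a = a := by decide
    simp only [h1] at hf
    convert hf using 4
    simp [kasner]
  · right
    have h1 : ∀ n : Fin 4, n ≠ 0 → radialPerm n 0 ≠ 0 ∧ radialPerm n 1 = 0 ∧ radialPerm n 2 ≠ 0
      ∧ radialPerm n 3 ≠ 0 := by decide
    have h2 : ∀ a : Fin 4, a ≠ 0 → lorentzSign a = 1 := by
      intro a ha
      fin_cases a <;> simp at ha ⊢
    obtain ⟨e0, e1, e2, e3⟩ := h1 n h0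
    simp only [h2 _ e0, h2 _ e2, h2 _ e3, e1] at hf
    convert hf using 4
    simp [staticKasner]

/-! ### Criteria for Petrov type I and class I₁₃ -/

section Criteria

variable {g : MetricField} {U : Set Pt} {e : FrameField} {x : Pt} {n : Fin 4}

lemma isLorentzMetric_of_frame (h : IsOrthoFrame g U e lorentzSign) : IsLorentzMetric g U where
  smooth := h.smooth_metric
  symm := h.symm
  signature x hx := ⟨(frameMat e x).transpose, by
    rw [Matrix.transpose_transpose, ← h.coframe_eq hx, h.coframe_mul_frame hx]⟩

lemma isSelfDual_frameBivector (h : IsOrthoFrame g U e lorentzSign) (hx : x ∈ U) (i : Fin 3) :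
    IsSelfDual g x (frameBivector g e i x) := by
  have ha := biF_frameBivector_antisymm h hx i
  have ho := congrArg (fun r : ℝ => (r : ℂ)) (h.orient_sq hx)
  push_cast at ho
  refine ⟨fun a b => frameBivector_antisymm h hx i a b,
    biform_ext_lorentz h hx (h.biF_hodge_antisymm hx _) (biF_smul_antisymm ha _) ?_ ?_⟩
  · intro j
    rw [biF_hodge_zero h hx ha, biF_smul, biF_frameBivector_zero h hx,
      biF_frameBivector_spatial h hx, unitJ]
    split_ifs
    · linear_combination -(Complex.I * ((Real.sqrt 2 : ℝ) : ℂ)⁻¹) * ho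
    · ring
  · intro j
    rw [biF_hodge_spatial h hx ha, biF_smul, biF_frameBivector_zero h hx,
      biF_frameBivector_spatial h hx, unitJ]
    split_ifs
    · linear_combination ((orient g e x : ℂ) * ((Real.sqrt 2 : ℝ) : ℂ)⁻¹) * Complex.I_mul_I
    · ring

lemma frameBivector_ne_zero (h : IsOrthoFrame g U e lorentzSign) (hx : x ∈ U) (i : Fin 3) :
    frameBivector g e i x ≠ 0 := by
  intro h0
  have h1 := biF_frameBivector_zero h hx i i
  rw [h0, if_pos rfl] at h1
  exact inv_sqrt_two_ne (neg_eq_zero.mp (h1.symm.trans (by simp [biF])))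

lemma isPetrovTypeI_of_frame (h : IsOrthoFrame g U e lorentzSign) {α : Fin 3 → Pt → ℂ}
    (heig : ∀ x ∈ U, ∀ i, weylMap g x (frameBivector g e i x) = α i x • frameBivector g e i x)
    (hα : ∀ x ∈ U, Function.Injective fun i => α i x) : IsPetrovTypeI g U := fun x hx =>
  ⟨fun i => α i x, fun i => frameBivector g e i x, hα x hx, fun i =>
    ⟨isSelfDual_frameBivector h hx i, frameBivector_ne_zero h hx i, heig x hx i⟩⟩

lemma dualForm_eq_zero_of {J : ℂ} {i : Fin 3} {S : Fin 4 → ℂ} {a : Fin 4}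
    (h : S (muIdx i a) = 0) : dualForm J i S a = 0 := by
  unfold muIdx at h
  unfold dualForm
  split_ifs at h ⊢ <;> simp_all

/-- A frame warped over the direction `e n` is of class I₁. -/
lemma isClassI1_of_warped (h : IsOrthoFrame g U e lorentzSign) (hU : IsOpen U)
    (hs : ∀ x ∈ U, ∀ a b c, a ≠ n → b ≠ n → connF g e x c a b = 0)
    (hr : ∀ x ∈ U, ∀ a c, c ≠ a → connF g e x c n a = 0)
    (h0 : ∀ x ∈ U, connF g e x (muIdx 0 n) n (muIdx 0 n) ≠ 0) : IsClassI1 g U e := by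
  intro x hx
  obtain ⟨V, hVU, hV, hxV, hJ⟩ := exists_nhds_unitJ_const h hU hx
  have hl := formF_lambdaForm (h.mono hVU) hV hJ hxV
  have hJ0 : unitJ g e x ≠ 0 := by
    intro h0
    have := unitJ_sq h hx
    rw [h0] at this
    norm_num at this
  have hpair : ∀ i a b c, InPair i a b → c ≠ muIdx i n → connF g e x c a b = 0 := by
    intro i a b c hab hc
    have hfin : ∀ (i : Fin 3) (a b n : Fin 4), InPair i a b → a = n ∧ b = muIdx i n ∨
      b = n ∧ a = muIdx i n ∨ a ≠ n ∧ b ≠ n := by decide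
    rcases hfin i a b n hab with ⟨ha, hb⟩ | ⟨hb, ha⟩ | ⟨ha, hb⟩
    · rw [ha, hb, hr x hx _ _ hc]
    · rw [h.connF_antisymm hU hx, ha, hb, hr x hx _ _ hc, neg_zero]
    · exact hs x hx a b c ha hb
  have hσ : ∀ i c, c ≠ muIdx i n → sigmaF g e (unitJ g e x) x i c = 0 := by
    intro i c hc
    rw [sigmaF, hpair i (fstIdx i) (sndIdx i) c (by simp [InPair]) hc,
      hpair i 0 i.succ c (by simp [InPair]) hc]
    simp
  have hD : ∀ i a, a ≠ n →
      dualForm (unitJ g e x) i (sigmaF g e (unitJ g e x) x i) a = 0 := by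
    intro i a ha
    refine dualForm_eq_zero_of (hσ i _ fun h1 => ha ?_)
    rw [← muIdx_muIdx i a, h1, muIdx_muIdx]
  let v : Fin 4 → ℂ := fun p => (lowerVec g x (e n x) p : ℂ)
  have hv : v ≠ 0 := by
    intro hv0
    have h1 := formF_ofReal_lowerVec h hx n n
    rw [if_pos rfl] at h1
    have h2 : formF e x v n = 0 := by rw [hv0]; simp [formF]
    have h3 := h.sign n
    rw [Complex.ofReal_eq_zero.mp (h1.symm.trans h2)] at h3
    norm_num at h3
  have hlam : ∀ i, lambdaForm g e i x
      = ((lorentzSign n : ℂ) * formF e x (lambdaForm g e i x) n) • v := by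
    intro i
    ext p
    rw [form_eq_sum h hx (lambdaForm g e i x) p, Finset.sum_eq_single n (fun a _ ha => ?_)
      (by simp)]
    · simp only [v, Pi.smul_apply, smul_eq_mul]
      push_cast
      ring
    · rw [hl, hD _ _ ha, hD _ _ ha]
      ring
  -- If all three λ_i vanished, inverting their relation to the V_i would give V_0 = 0, against the
  -- nonzero connection coefficient assumed for the bivector of index 0.
  have hex : ∃ i, formF e x (lambdaForm g e i x) n ≠ 0 := by
    by_contra hall
    push Not at hall
    have e0 := (hl 0 n).symm.trans (hall 0)
    have e1 := (hl 1 n).symm.trans (hall 1)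
    have e2 := (hl 2 n).symm.trans (hall 2)
    have d0 : dualForm (unitJ g e x) 0 (sigmaF g e (unitJ g e x) x 0) n = 0 := by
      norm_num at e0 e1 e2
      rw [show (1 : Fin 3) + 2 = 0 from rfl, show (1 : Fin 3) + 1 = 2 from rfl] at e1
      rw [show (2 : Fin 3) + 2 = 1 from rfl, show (2 : Fin 3) + 1 = 0 from rfl] at e2
      linear_combination (1 / 2) * (e1 + e2 - e0)
    have s0 := sigmaF_eq_zero h hx rfl (dualForm_eq_zero hJ0 d0)
    refine h0 x hx ?_
    have hfin : ∀ n : Fin 4, InPair 0 n (muIdx 0 n) := by decide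
    exact eq_zero_of_inPair (f := fun a b => connF g e x (muIdx 0 n) a b)
      (fun a b => h.connF_antisymm hU hx _ a b) s0.2 s0.1 (hfin n)
  obtain ⟨i, hi⟩ := hex
  have hspan : Submodule.span ℂ (Set.range fun i : Fin 3 => lambdaForm g e i x)
      = Submodule.span ℂ {v} := by
    apply le_antisymm
    · rw [Submodule.span_le]
      rintro _ ⟨j, rfl⟩
      exact Submodule.mem_span_singleton.mpr ⟨_, (hlam j).symm⟩
    · rw [Submodule.span_singleton_le_iff_mem]
      have hc : (lorentzSign n : ℂ) * formF e x (lambdaForm g e i x) n ≠ 0 := by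
        refine mul_ne_zero (fun h1 => ?_) hi
        have h3 := h.sign n
        rw [Complex.ofReal_eq_zero.mp h1] at h3
        norm_num at h3
      rw [← inv_smul_smul₀ hc v, ← hlam i]
      exact Submodule.smul_mem _ _ (Submodule.subset_span ⟨i, rfl⟩)
  rw [hspan, finrank_span_singleton hv]

/-- A 1-form with a single nonzero component is integrable. -/
lemma isIntegrableForm_of_single {w : Pt → Fin 4 → ℂ} {z : Pt → ℂ} {m : Fin 4}
    (hw : ∀ x p, w x p = if p = m then z x else 0) : IsIntegrableForm U w := by
  have h1 : ∀ x b c, pd b (fun y => w y c) x = if c = m then pd b z x else 0 := by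
    intro x b c
    simp only [hw]
    split_ifs
    · rfl
    · exact pd_const b 0 x
  intro x _ a b c
  simp only [h1]
  simp only [hw]
  split_ifs <;> ring1

end Criteria

/-! ### Diagonal metrics with exponential coefficients -/

/-- The metric `∑ ε_a exp (2 q_a x⁰) (dx^a)²`. -/
def diagMetric (ε q : Fin 4 → ℝ) : MetricField := fun x =>
  Matrix.diagonal fun a => ε a * Real.exp (2 * q a * x 0)

/-- The normalized coordinate frame of `diagMetric`. -/
def diagFrame (q : Fin 4 → ℝ) : FrameField := fun a x b =>
  if b = a then Real.exp (-(q a * x 0)) else 0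

lemma pd_exp_coord (c : ℝ) (p : Fin 4) (x : Pt) :
    pd p (fun y : Pt => Real.exp (c * y 0)) x = if p = 0 then c * Real.exp (c * x 0) else 0 := by
  have h1 : HasFDerivAt (fun y : Pt => y 0)
      (ContinuousLinearMap.proj (R := ℝ) (φ := fun _ : Fin 4 => ℝ) 0) x :=
    (ContinuousLinearMap.proj (R := ℝ) (φ := fun _ : Fin 4 => ℝ) 0).hasFDerivAt
  have h2 := (h1.const_mul c).exp
  rw [pd, h2.fderiv]
  by_cases hp : p = 0
  · subst hp
    simp [mul_comm]
  · simp [hp]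

lemma contDiff_exp_coord (c : ℝ) : ContDiff ℝ ∞ (fun y : Pt => Real.exp (c * y 0)) :=
  (contDiff_const.mul (contDiff_apply ℝ ℝ 0)).exp

section Diag

variable {ε q : Fin 4 → ℝ} {x : Pt}

lemma lowerVec_diagFrame (ε q : Fin 4 → ℝ) (x : Pt) (a b : Fin 4) :
    lowerVec (diagMetric ε q) x (diagFrame q a x) b
      = if b = a then ε a * Real.exp (q a * x 0) else 0 := by
  rw [lowerVec, Finset.sum_eq_single b (fun c _ hc => by
    rw [diagMetric, Matrix.diagonal_apply_ne _ hc.symm, zero_mul]) (by simp), diagMetric,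
    Matrix.diagonal_apply_eq, diagFrame]
  split_ifs with h
  · subst h
    rw [mul_assoc, ← Real.exp_add]
    ring_nf
  · rw [mul_zero]

lemma isOrthoFrame_diagFrame (hε : ∀ a, ε a * ε a = 1) (q : Fin 4 → ℝ) :
    IsOrthoFrame (diagMetric ε q) Set.univ (diagFrame q) ε where
  smooth_metric a b := by
    simp only [diagMetric, Matrix.diagonal_apply]
    split_ifs
    · exact (contDiff_const.mul (contDiff_exp_coord _)).contDiffOn
    · exact contDiffOn_const
  symm x _ := Matrix.isSymm_diagonal _
  smooth_frame a b := by
    simp only [diagFrame]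
    split_ifs
    · simp only [← neg_mul]
      exact (contDiff_exp_coord _).contDiffOn
    · exact contDiffOn_const
  sign := hε
  ortho x _ a b := by
    simp only [lowerVec_diagFrame, diagFrame]
    rw [Finset.sum_eq_single a (fun c _ hc => by rw [if_neg hc, zero_mul]) (by simp), if_pos rfl,
      Matrix.diagonal_apply]
    split_ifs with h
    · subst h
      rw [mul_left_comm, ← Real.exp_add]
      simp
    · rw [mul_zero]

/-- The Koszul formula: the first structure equation gives the antisymmetrized coefficients, and
three cyclic instances recover the coefficient itself. The choice q_0 = −1 makes e_0 = exp(x⁰)∂_0,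
so all structure functions share the factor exp(x⁰). -/
lemma connF_diagFrame (hε : ∀ a, ε a * ε a = 1) (h0 : q 0 = -1) (x : Pt) (c a d : Fin 4) :
    connF (diagMetric ε q) (diagFrame q) x c a d =
      (if c = d ∧ a = 0 then ε d * q d * Real.exp (x 0) else 0)
      - (if c = a ∧ d = 0 then ε a * q a * Real.exp (x 0) else 0) := by
  have h := isOrthoFrame_diagFrame hε q
  have hx : x ∈ Set.univ := Set.mem_univ x
  have hL : ∀ a p r, pd p (fun y => lowerVec (diagMetric ε q) y (diagFrame q a y) r) x
      = if r = a then (if p = 0 then ε a * (q a * Real.exp (q a * x 0)) else 0) else 0 := by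
    intro a p r
    simp only [lowerVec_diagFrame]
    split_ifs with h1 h2
    · rw [pd_const_mul _ ((contDiff_exp_coord _).differentiable (by simp)).differentiableAt,
        pd_exp_coord, if_pos h2]
    · rw [pd_const_mul _ ((contDiff_exp_coord _).differentiable (by simp)).differentiableAt,
        pd_exp_coord, if_neg h2, mul_zero]
    · exact pd_const p 0 x
  have hT : ∀ a c d, connF (diagMetric ε q) (diagFrame q) x c a d
      - connF (diagMetric ε q) (diagFrame q) x d a c
      = ε a * q a * Real.exp (x 0) * ((if c = 0 ∧ d = a then 1 else 0)
        - (if d = 0 ∧ c = a then 1 else 0)) := by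
    intro a c d
    rw [← h.torsion_frame isOpen_univ hx a c d, Finset.sum_eq_single c (fun p _ hp =>
      Finset.sum_eq_zero fun r _ => by simp [diagFrame, hp]) (by simp),
      Finset.sum_eq_single d (fun p _ hp => by simp [diagFrame, hp]) (by simp), hL, hL]
    have hE : Real.exp (x 0) = Real.exp (-(q 0 * x 0)) := by rw [h0]; ring_nf
    have hE' : ∀ b, Real.exp (-(q b * x 0)) * Real.exp (q b * x 0) = 1 := by
      intro b
      rw [← Real.exp_add]
      simp
    simp only [diagFrame, if_true]
    rw [hE]
    by_cases hc : c = 0 <;> by_cases hd : d = 0 <;> by_cases hca : c = a <;>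
      by_cases hda : d = a <;> simp only [hc, hd, hca, hda, if_true, if_false, and_true, and_false,
        true_and, false_and] <;> grind
  have ha := h.connF_antisymm isOpen_univ hx
  have e1 := hT a c d
  have e2 := hT d a c
  have e3 := hT c d a
  rw [ha d a c] at e1
  rw [ha a d c, ha c d a] at e2
  have e4 : 2 * connF (diagMetric ε q) (diagFrame q) x c a d
      = ε a * q a * Real.exp (x 0) * ((if c = 0 ∧ d = a then 1 else 0)
        - (if d = 0 ∧ c = a then 1 else 0))
      + ε d * q d * Real.exp (x 0) * ((if a = 0 ∧ c = d then 1 else 0)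
        - (if c = 0 ∧ a = d then 1 else 0))
      - ε c * q c * Real.exp (x 0) * ((if d = 0 ∧ a = c then 1 else 0)
        - (if a = 0 ∧ d = c then 1 else 0)) := by
    linear_combination e1 + e2 - e3
  clear e1 e2 e3 ha hT hL h h0 hε
  generalize connF (diagMetric ε q) (diagFrame q) x c a d = w at e4 ⊢
  generalize Real.exp (x 0) = s at e4 ⊢
  have e5 : w = (1 / 2) * (2 * w) := by ring
  rw [e5, e4]
  by_cases hcd : c = d
  · subst hcd
    by_cases hca : c = a
    · subst hca
      simp
    · simp [hca, Ne.symm hca]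
      split_ifs <;> ring
  · by_cases hca : c = a
    · subst hca
      simp [hcd, Ne.symm hcd]
      split_ifs <;> ring
    · by_cases hda : d = a
      · subst hda
        simp [hcd]
      · simp [hcd, hca, hda, Ne.symm hcd, Ne.symm hca, Ne.symm hda]

end Diag

/-! ### Curvature of the diagonal metrics and the existence criterion. -/

/-- The sectional components of the curvature of `diagMetric`, up to the factor `exp (2 x⁰)`. -/
def diagCurv (ε q : Fin 4 → ℝ) (a b : Fin 4) : ℝ :=
  if a = 0 then -(ε b * (q b + q b ^ 2)) else if b = 0 then -(ε a * (q a + q a ^ 2))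
    else -(ε 0 * ε a * ε b * (q a * q b))

section Diag

variable {ε q : Fin 4 → ℝ} {x : Pt}

lemma isWarpedFrame_diagFrame (hε : ∀ a, ε a * ε a = 1) (h0 : q 0 = -1) :
    IsWarpedFrame (diagMetric ε q) Set.univ (diagFrame q) ε :=
  { isOrthoFrame_diagFrame hε q with
    spatial := fun x _ a b c ha hb => by simp [connF_diagFrame hε h0, ha, hb]
    radial := fun x _ a c hca => by
      rw [connF_diagFrame hε h0]
      by_cases ha : a = 0
      · subst ha
        simp [hca]
      · simp [hca, ha] }

lemma rate_diagFrame (hε : ∀ a, ε a * ε a = 1) (h0 : q 0 = -1) {i : Fin 4} (hi : i ≠ 0) :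
    rate (diagMetric ε q) (diagFrame q) ε i x = q i * Real.exp (x 0) := by
  rw [rate, connF_diagFrame hε h0]
  simp only [and_self, if_true, hi, if_false]
  linear_combination q i * Real.exp (x 0) * hε i

lemma frameDeriv_rate_diagFrame (hε : ∀ a, ε a * ε a = 1) (h0 : q 0 = -1) {i : Fin 4}
    (hi : i ≠ 0) (a : Fin 4) :
    frameDeriv (diagFrame q) a (rate (diagMetric ε q) (diagFrame q) ε i) x
      = if a = 0 then q i * Real.exp (2 * x 0) else 0 := by
  have h1 : ∀ p, pd p (rate (diagMetric ε q) (diagFrame q) ε i) x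
      = if p = 0 then q i * Real.exp (x 0) else 0 := by
    intro p
    have h2 := pd_exp_coord 1 p x
    simp only [one_mul] at h2
    rw [pd_congr_of_eqOn isOpen_univ (fun y _ => rate_diagFrame hε h0 hi) (Set.mem_univ x),
      pd_const_mul _ (by fun_prop), h2]
    split_ifs <;> ring
  rw [frameDeriv, Finset.sum_eq_single a (fun p _ hp => by simp [diagFrame, hp]) (by simp), h1,
    diagFrame, if_pos rfl]
  split_ifs with ha
  · rw [ha, h0, mul_left_comm, ← Real.exp_add]
    ring_nf
  · ring

/-- The rates q_i exp(x⁰) depend on x⁰ only, so all components outside R_{abab} and its index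
permutations vanish. -/
lemma riemF_diagFrame (hε : ∀ a, ε a * ε a = 1) (h0 : q 0 = -1) (a b c d : Fin 4) :
    riemF (diagMetric ε q) (diagFrame q) x a b c d = diagCurv ε q a b * Real.exp (2 * x 0)
      * ((if c = a ∧ d = b then 1 else 0) - (if d = a ∧ c = b then 1 else 0)) := by
  have h := isWarpedFrame_diagFrame hε h0
  have hx := Set.mem_univ x
  have hs : Real.exp (2 * x 0) = Real.exp (x 0) * Real.exp (x 0) := by
    rw [← Real.exp_add]
    ring_nf
  have hrad : ∀ i c d : Fin 4, i ≠ 0 → riemF (diagMetric ε q) (diagFrame q) x 0 i c d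
      = -(ε i * (q i + q i ^ 2)) * Real.exp (2 * x 0)
        * ((if c = 0 ∧ d = i then 1 else 0) - (if d = 0 ∧ c = i then 1 else 0)) := by
    intro i c d hi
    rw [h.riemF_radial isOpen_univ hx hi, frameDeriv_rate_diagFrame hε h0 hi,
      frameDeriv_rate_diagFrame hε h0 hi, rate_diagFrame hε h0 hi, connF_diagFrame hε h0,
      connF_diagFrame hε h0, hs]
    by_cases hc : c = 0
    · subst hc
      by_cases hd : d = i
      · subst hd
        simp [hi, Ne.symm hi]
        ring
      · simp [hi, hd, Ne.symm hi]
    · by_cases hd : d = 0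
      · subst hd
        by_cases hci : c = i
        · subst hci
          simp [hi, Ne.symm hi]
          ring
        · simp [hi, hci, Ne.symm hi]
      · simp [hi, hc, hd]
  by_cases hab : a = b
  · subst hab
    rw [show riemF (diagMetric ε q) (diagFrame q) x a a c d = 0 by
      linarith [h.riemF_antisymm_left isOpen_univ hx a a c d]]
    simp only [and_comm, sub_self, mul_zero]
  by_cases ha : a = 0
  · subst ha
    rw [hrad b c d (Ne.symm hab), diagCurv, if_pos rfl]
  by_cases hb : b = 0
  · subst hb
    rw [h.riemF_antisymm_left isOpen_univ hx, hrad a c d hab, diagCurv, if_neg ha, if_pos rfl]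
    simp only [and_comm]
    ring
  · rw [h.riemF_spatial isOpen_univ hx ha hb, diagCurv, if_neg ha, if_neg hb, hs]
    simp only [connF_diagFrame hε h0, ha, hb, and_true, and_false, if_false, sub_zero]
    by_cases hca : c = a
    · subst hca
      by_cases hdb : d = b
      · subst hdb
        simp [hab, Ne.symm hab]
        ring
      · simp [hab, hdb]
    · by_cases hda : d = a
      · subst hda
        by_cases hcb : c = b
        · subst hcb
          simp [hab, hca]
          ring
        · simp [hca, hcb, hab]
      · simp [hca, hda]

/-- The diagonal Ricci components are proportional to q_i (1 + q_1 + q_2 + q_3) and to ∑ (q_i +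
q_i²). With s = ∑ q_i, the latter equals s + s² minus twice the quadratic relation. -/
lemma isVacuum_diagMetric (hε : ∀ a, ε a * ε a = 1) (h0 : q 0 = -1)
    (hsum : q 1 + q 2 + q 3 = -1) (hquad : q 1 * q 2 + q 1 * q 3 + q 2 * q 3 = 0) :
    IsVacuum (diagMetric ε q) Set.univ := by
  intro x hx
  rw [(isOrthoFrame_diagFrame hε q).ricci_eq_zero_iff hx]
  intro b d
  simp only [riemF_diagFrame hε h0]
  by_cases hdb : d = b
  · subst hdb
    simp only [Fin.sum_univ_four, diagCurv]
    have e1 := hε 1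
    have e2 := hε 2
    have e3 := hε 3
    fin_cases d <;> simp
    · linear_combination (-(q 1 + q 1 ^ 2) * e1 - (q 2 + q 2 ^ 2) * e2 - (q 3 + q 3 ^ 2) * e3
        - (q 1 + q 2 + q 3) * hsum + 2 * hquad) * Real.exp (2 * x 0)
    · linear_combination (-(ε 0 * ε 1 * q 1) * (q 2 * e2 + q 3 * e3)
        - ε 0 * ε 1 * q 1 * hsum) * Real.exp (2 * x 0)
    · linear_combination (-(ε 0 * ε 2 * q 2) * (q 1 * e1 + q 3 * e3)
        - ε 0 * ε 2 * q 2 * hsum) * Real.exp (2 * x 0)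
    · linear_combination (-(ε 0 * ε 3 * q 3) * (q 1 * e1 + q 2 * e2)
        - ε 0 * ε 3 * q 3 * hsum) * Real.exp (2 * x 0)
  · refine Finset.sum_eq_zero fun a _ => ?_
    have : ¬ (d = a ∧ a = b) := fun h => hdb (h.1.trans h.2)
    simp [hdb, this]

/-- A criterion for a diagonal metric to be a vacuum solution of class I₁₃. -/
theorem isPrincipalI13Vacuum_diagMetric {π : Equiv.Perm (Fin 4)} {C : Fin 3 → ℝ}
    (hπ : ∀ a, ε (π a) = lorentzSign a) (h0 : q 0 = -1) (hne : ∀ i, i ≠ 0 → q i ≠ 0)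
    (hsum : q 1 + q 2 + q 3 = -1) (hquad : q 1 * q 2 + q 1 * q 3 + q 2 * q 3 = 0)
    (hC : ∀ i, C i = - diagCurv ε q (π 0) (π i.succ)) (hC0 : C 0 ≠ 0)
    (hCi : Function.Injective C) :
    IsPrincipalI13Vacuum (diagMetric ε q) Set.univ (fun a => diagFrame q (π a))
      (fun i x => ((C i * Real.exp (2 * x 0) : ℝ) : ℂ)) := by
  have hε : ∀ a, ε a * ε a = 1 := by
    intro a
    obtain ⟨b, rfl⟩ := π.surjective a
    rw [hπ]
    fin_cases b <;> simp
  have hvac := isVacuum_diagMetric hε h0 hsum hquad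
  have h : IsOrthoFrame (diagMetric ε q) Set.univ (fun a => diagFrame q (π a)) lorentzSign := by
    have := (isOrthoFrame_diagFrame hε q).perm π
    rwa [show (fun a => ε (π a)) = lorentzSign from funext hπ] at this
  have hriem : ∀ (x : Pt) (a b c d : Fin 4),
      riemF (diagMetric ε q) (fun a => diagFrame q (π a)) x a b c d
      = diagCurv ε q (π a) (π b) * Real.exp (2 * x 0)
        * ((if c = a ∧ d = b then 1 else 0) - (if d = a ∧ c = b then 1 else 0)) := by
    intro x a b c d
    rw [riemF_perm, riemF_diagFrame hε h0]
    simp only [π.injective.eq_iff]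
  have heig : ∀ x ∈ Set.univ, ∀ i,
      weylMap (diagMetric ε q) x (frameBivector (diagMetric ε q) (fun a => diagFrame q (π a)) i x)
      = ((C i * Real.exp (2 * x 0) : ℝ) : ℂ)
        • frameBivector (diagMetric ε q) (fun a => diagFrame q (π a)) i x := by
    intro x hx i
    rw [eigen_iff h isOpen_univ hx (hvac x hx)]
    intro j
    have hfin : ∀ i : Fin 3, fstIdx i ≠ 0 ∧ sndIdx i ≠ 0 := by decide
    rw [sdCurv_vacuum h isOpen_univ hx (hvac x hx), hriem, hriem]
    simp only [(hfin i).1, (hfin i).2, false_and, if_false, sub_zero, true_and, Fin.succ_inj, hC,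
      and_false, sub_self, mul_zero, Fin.succ_ne_zero, Ne.symm (Fin.succ_ne_zero _)]
    by_cases hij : j = i
    · subst hij
      simp
    · simp [hij, Ne.symm hij]
  have hsmooth : ∀ i, ContDiff ℝ ∞ fun x : Pt => ((C i * Real.exp (2 * x 0) : ℝ) : ℂ) := fun i =>
    Complex.ofRealCLM.contDiff.comp (contDiff_const.mul (contDiff_exp_coord 2))
  have hgrad : ∀ (x : Pt) p, gradForm (fun x : Pt => ((C 0 * Real.exp (2 * x 0) : ℝ) : ℂ)) x p
      = if p = 0 then ((2 * C 0 * Real.exp (2 * x 0) : ℝ) : ℂ) else 0 := by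
    intro x p
    rw [gradForm, pd_ofReal (by fun_prop), pd_const_mul _ (by fun_prop), pd_exp_coord]
    split_ifs
    · push_cast
      ring
    · simp
  have hL : ∀ (x : Pt) a b, lowerVec (diagMetric ε q) x (diagFrame q (π a) x) b
      = if b = π a then ε (π a) * Real.exp (q (π a) * x 0) else 0 := fun x a b =>
    lowerVec_diagFrame ε q x (π a) b
  -- The eigenvalues depend on x⁰ alone, and dx⁰ sits at the place `π.symm 0` of the relabelled
  -- frame.
  have hn : ∀ x : Pt, CollinearForms
      (gradForm (fun x : Pt => ((C 0 * Real.exp (2 * x 0) : ℝ) : ℂ)) x)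
      (fun b => (lowerVec (diagMetric ε q) x (diagFrame q (π (π.symm 0)) x) b : ℂ)) := by
    intro x a b
    simp only [hgrad, Equiv.apply_symm_apply, lowerVec_diagFrame]
    split_ifs <;> simp
  have hconn : ∀ (x : Pt) (c a b : Fin 4),
      connF (diagMetric ε q) (fun a => diagFrame q (π a)) x c a b
        = connF (diagMetric ε q) (diagFrame q) x (π c) (π a) (π b) := fun x c a b => rfl
  have hw := isWarpedFrame_diagFrame hε h0
  have hne0 : ∀ a, a ≠ π.symm 0 → π a ≠ 0 := fun a ha h1 => ha (by rw [← h1, π.symm_apply_apply])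
  refine ⟨isLorentzMetric_of_frame h, hvac, isPetrovTypeI_of_frame h heig fun x _ i j hij => ?_,
    ⟨h.smooth_frame, fun i => (hsmooth i).contDiffOn, h.ortho, heig⟩, ⟨?_, ?_, ?_⟩,
    ⟨π.symm 0, fun x _ => hn x⟩⟩
  · apply hCi
    exact mul_right_cancel₀ (Real.exp_ne_zero _) (Complex.ofReal_injective hij)
  · refine isClassI1_of_warped (n := π.symm 0) h isOpen_univ ?_ ?_ ?_
    · intro x hx a b c ha hb
      rw [hconn]
      exact hw.spatial x hx _ _ _ (hne0 a ha) (hne0 b hb)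
    · intro x hx a c hca
      rw [hconn, Equiv.apply_symm_apply]
      exact hw.radial x hx _ _ (π.injective.ne hca)
    · intro x hx
      have hm : ∀ n : Fin 4, muIdx 0 n ≠ n := by decide
      have h1 := hne0 _ (hm (π.symm 0))
      rw [hconn, Equiv.apply_symm_apply, connF_diagFrame hε h0]
      simp only [and_self, if_true, h1, if_false, sub_zero]
      refine mul_ne_zero (mul_ne_zero (fun h2 => ?_) (hne _ h1)) (Real.exp_ne_zero _)
      have := hε (π (muIdx 0 (π.symm 0)))
      rw [h2] at this
      norm_num at this
  · intro x _ h1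
    have h2 := congrFun h1 0
    rw [hgrad, if_pos rfl, Pi.zero_apply, Complex.ofReal_eq_zero] at h2
    exact mul_ne_zero (mul_ne_zero two_ne_zero hC0) (Real.exp_ne_zero _) h2
  · intro i
    -- The coframe is proportional to the coordinate differentials, so each orbit form is a function
    -- times a single dx^m.
    refine isIntegrableForm_of_single (m := π (muIdx i (π.symm 0)))
      (z := fun x => orbitForm (diagMetric ε q) (fun a => diagFrame q (π a))
        (fun i x => ((C i * Real.exp (2 * x 0) : ℝ) : ℂ)) i x (π (muIdx i (π.symm 0))))
      fun x p => ?_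
    split_ifs with hp
    · rw [hp]
    · rw [orbitForm_eq h (Set.mem_univ x) (hn x), hL, if_neg hp]
      simp

end Diag

/-! ### The Kasner exponents and the two families of solutions. -/

/-- The exponents of the Kasner metrics. -/
def kasnerExponent (k : ℝ) : Fin 4 → ℝ :=
  ![-1, 1 / kasnerBeta k - 1, k ^ 2 / kasnerBeta k - 1, (1 + k) ^ 2 / kasnerBeta k - 1]

lemma kasner_eq (k : ℝ) : kasner k = diagMetric lorentzSign (kasnerExponent k) := by
  funext x
  rw [kasner, diagMetric]
  congr 1
  funext a
  fin_cases a <;> simp [kasnerExponent]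

lemma staticKasner_eq (k : ℝ) :
    staticKasner k = diagMetric ![1, -1, 1, 1] (kasnerExponent k) := by
  funext x
  rw [staticKasner, diagMetric]
  congr 1
  funext a
  fin_cases a <;> simp [kasnerExponent]

lemma kasnerBeta_pos (k : ℝ) : 0 < kasnerBeta k := by
  unfold kasnerBeta
  nlinarith [sq_nonneg (k + 1 / 2)]

lemma kasnerExponent_eq (k : ℝ) : kasnerExponent k 1 = -(k * (1 + k)) / kasnerBeta k ∧
    kasnerExponent k 2 = -(1 + k) / kasnerBeta k ∧ kasnerExponent k 3 = k / kasnerBeta k := by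
  have hβ := (kasnerBeta_pos k).ne'
  refine ⟨?_, ?_, ?_⟩
  all_goals
    simp [kasnerExponent]
    field_simp
    rw [kasnerBeta]
    ring

lemma kasnerExponent_sum (k : ℝ) :
    kasnerExponent k 1 + kasnerExponent k 2 + kasnerExponent k 3 = -1 := by
  obtain ⟨h1, h2, h3⟩ := kasnerExponent_eq k
  have hβ := (kasnerBeta_pos k).ne'
  rw [h1, h2, h3]
  field_simp
  rw [kasnerBeta]
  ring

lemma kasnerExponent_quadratic (k : ℝ) :
    kasnerExponent k 1 * kasnerExponent k 2 + kasnerExponent k 1 * kasnerExponent k 3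
      + kasnerExponent k 2 * kasnerExponent k 3 = 0 := by
  obtain ⟨h1, h2, h3⟩ := kasnerExponent_eq k
  have hβ := (kasnerBeta_pos k).ne'
  rw [h1, h2, h3]
  field_simp
  ring

lemma kasnerExponent_ne_zero {k : ℝ} (hk : Admissible k) (i : Fin 4) (hi : i ≠ 0) :
    kasnerExponent k i ≠ 0 := by
  obtain ⟨h1, h2, h3⟩ := kasnerExponent_eq k
  have hβ := (kasnerBeta_pos k).ne'
  have k0 := hk.1
  have k1 : 1 + k ≠ 0 := fun h0 => hk.2.1 (by linarith)
  have hf : ∀ i : Fin 4, i ≠ 0 → i = 1 ∨ i = 2 ∨ i = 3 := by decide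
  rcases hf i hi with rfl | rfl | rfl
  · rw [h1]
    exact div_ne_zero (neg_ne_zero.mpr (mul_ne_zero k0 k1)) hβ
  · rw [h2]
    exact div_ne_zero (neg_ne_zero.mpr k1) hβ
  · rw [h3]
    exact div_ne_zero k0 hβ

/-- The products of the Kasner exponents are distinct. -/
lemma kasnerExponent_mul_ne {k : ℝ} (hk : Admissible k) :
    kasnerExponent k 2 * kasnerExponent k 3 ≠ kasnerExponent k 1 * kasnerExponent k 3 ∧
    kasnerExponent k 2 * kasnerExponent k 3 ≠ kasnerExponent k 1 * kasnerExponent k 2 ∧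
    kasnerExponent k 1 * kasnerExponent k 3 ≠ kasnerExponent k 1 * kasnerExponent k 2 := by
  obtain ⟨h1, h2, h3⟩ := kasnerExponent_eq k
  have hβ := (kasnerBeta_pos k).ne'
  have n1 := kasnerExponent_ne_zero hk 1 (by decide)
  have n2 := kasnerExponent_ne_zero hk 2 (by decide)
  have n3 := kasnerExponent_ne_zero hk 3 (by decide)
  have k1 : 1 + k ≠ 0 := fun h0 => hk.2.1 (by linarith)
  refine ⟨fun h => ?_, fun h => ?_, fun h => ?_⟩
  · have h4 := mul_right_cancel₀ n3 h
    rw [h1, h2, div_left_inj' hβ] at h4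
    have h5 : (1 + k) * (k - 1) = 0 := by linear_combination h4
    exact hk.2.2.1 (by linarith [(mul_eq_zero.mp h5).resolve_left k1])
  · rw [mul_comm] at h
    have h4 := mul_right_cancel₀ n2 h
    rw [h1, h3, div_left_inj' hβ] at h4
    have h5 : k * (k + 2) = 0 := by linear_combination h4
    exact hk.2.2.2.1 (by linarith [(mul_eq_zero.mp h5).resolve_left hk.1])
  · have h4 := mul_left_cancel₀ n1 h
    rw [h2, h3, div_left_inj' hβ] at h4
    exact hk.2.2.2.2 (by linarith)

lemma injective_fin_three {A : Type*} {f : Fin 3 → A} (h01 : f 0 ≠ f 1) (h02 : f 0 ≠ f 2)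
    (h12 : f 1 ≠ f 2) : Function.Injective f := by
  intro i j hij
  fin_cases i <;> fin_cases j <;> first | rfl | (exfalso; simp_all)

theorem exists_isPrincipalI13Vacuum_kasner {k : ℝ} (hk : Admissible k) :
    ∃ e α, IsPrincipalI13Vacuum (kasner k) Set.univ e α := by
  obtain ⟨m1, m2, m3⟩ := kasnerExponent_mul_ne hk
  have hs := kasnerExponent_sum k
  have hq := kasnerExponent_quadratic k
  rw [kasner_eq]
  -- The curvature yields C_i = q_i + q_i². The sum and quadratic relations turn this into the
  -- product of the other two exponents, a form in which distinctness is visible.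
  refine ⟨_, _, isPrincipalI13Vacuum_diagMetric (π := 1)
    (C := ![kasnerExponent k 2 * kasnerExponent k 3, kasnerExponent k 1 * kasnerExponent k 3,
      kasnerExponent k 1 * kasnerExponent k 2]) (fun a => rfl) rfl (kasnerExponent_ne_zero hk)
    hs hq ?_ ?_ ?_⟩
  · intro i
    fin_cases i <;> simp [diagCurv]
    · linear_combination hq - kasnerExponent k 1 * hs
    · linear_combination hq - kasnerExponent k 2 * hs
    · linear_combination hq - kasnerExponent k 3 * hs
  · exact mul_ne_zero (kasnerExponent_ne_zero hk _ (by decide))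
      (kasnerExponent_ne_zero hk _ (by decide))
  · exact injective_fin_three m1 m2 m3

theorem exists_isPrincipalI13Vacuum_staticKasner {k : ℝ} (hk : Admissible k) :
    ∃ e α, IsPrincipalI13Vacuum (staticKasner k) Set.univ e α := by
  obtain ⟨m1, m2, m3⟩ := kasnerExponent_mul_ne hk
  have hs := kasnerExponent_sum k
  have hq := kasnerExponent_quadratic k
  rw [staticKasner_eq]
  -- The timelike vector is the coordinate direction 1, so the swap puts it first in the principal
  -- frame; the radial direction becomes frame index 1. The eigenvalues change sign and the last two
  -- trade places.
  refine ⟨_, _, isPrincipalI13Vacuum_diagMetric (π := Equiv.swap 0 1)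
    (C := ![-(kasnerExponent k 2 * kasnerExponent k 3), -(kasnerExponent k 1 * kasnerExponent k 2),
      -(kasnerExponent k 1 * kasnerExponent k 3)]) ?_ rfl (kasnerExponent_ne_zero hk)
    hs hq ?_ ?_ ?_⟩
  · intro a
    have hp : ∀ a : Fin 4, Equiv.swap (0 : Fin 4) 1 a = ![1, 0, 2, 3] a := by decide
    rw [hp]
    fin_cases a <;> simp
  · have hp : ∀ a : Fin 4, Equiv.swap (0 : Fin 4) 1 a = ![1, 0, 2, 3] a := by decide
    intro i
    rw [hp, hp]
    fin_cases i <;> simp [diagCurv]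
    · linear_combination -hq + kasnerExponent k 1 * hs
  · exact neg_ne_zero.mpr (mul_ne_zero (kasnerExponent_ne_zero hk _ (by decide))
      (kasnerExponent_ne_zero hk _ (by decide)))
  · exact injective_fin_three (neg_injective.ne m2) (neg_injective.ne m1)
      (neg_injective.ne m3.symm)

end Spacetime

end

theorem mainTheorem2 :
    -- the Kasner metrics are vacuum solutions of the stated class
    (∀ k : ℝ, Spacetime.Admissible k →
      (∃ e α, Spacetime.IsPrincipalI13Vacuum (Spacetime.kasner k) Set.univ e α) ∧
      (∃ e α, Spacetime.IsPrincipalI13Vacuum (Spacetime.staticKasner k) Set.univ e α)) ∧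
    -- they are, locally and up to coordinates, the only ones
    (∀ (U : Set Spacetime.Pt) (g : Spacetime.MetricField), IsOpen U →
      (∀ p ∈ U, ∃ V ⊆ U, IsOpen V ∧ p ∈ V ∧ ∃ e α, Spacetime.IsPrincipalI13Vacuum g V e α) →
      ∀ p ∈ U, ∃ k : ℝ, Spacetime.Admissible k ∧
        (Spacetime.HasFormNear g U p (Spacetime.kasner k) ∨
          Spacetime.HasFormNear g U p (Spacetime.staticKasner k))) ∧
    -- the three Killing fields with aligned Papapetrou fields
    (∀ (U : Set Spacetime.Pt) (g : Spacetime.MetricField) (e : Spacetime.FrameField)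
      (α : Fin 3 → Spacetime.Pt → ℂ), IsOpen U → Spacetime.IsPrincipalI13Vacuum g U e α →
      ∃ ξ : Fin 3 → Spacetime.Pt → Fin 4 → ℝ, ∀ i,
        Spacetime.IsKilling g U (ξ i) ∧
        ∀ x ∈ U, ξ i x ≠ 0 ∧
          Spacetime.CollinearForms (fun b => (Spacetime.lowerVec g x (ξ i x) b : ℂ))
            (Spacetime.orbitForm g e α i x) ∧
          Spacetime.IsAlignedWith (Spacetime.papapetrou g (ξ i) x)
            (Spacetime.frameBivector g e i x)) := by
  refine ⟨fun k hk => ⟨Spacetime.exists_isPrincipalI13Vacuum_kasner hk,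
    Spacetime.exists_isPrincipalI13Vacuum_staticKasner hk⟩, fun U g _ H p hp => ?_,
    fun U g e α hU H => H.exists_killing hU⟩
  obtain ⟨V, hVU, hV, hpV, e, α, hg⟩ := H p hp
  obtain ⟨k, hk, hf⟩ := hg.exists_hasFormNear hV hpV
  exact ⟨k, hk, hf.imp (fun h => h.mono hVU) fun h => h.mono hVU⟩
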